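/- **System.** A base station (BS) with $M$ antennas serves $K$ single-antenna users with the help of a reconfigurable intelligent surface (RIS) with $N$ elements, $N$ a perfect square. Let $p,\sigma,\alpha_k,\beta>0$ and $\sigma_e,\gamma_k,\delta\ge 0$. Let $\tau\le\tau_c$ be the pilot length and the length of the coherence interval, $\tau^o=\frac{\tau_c-\tau}{\tau_c}$, and let the pilot matrix $\mathbf S=[\mathbf s_1,\dots,\mathbf s_K]\in\mathbb C^{\tau\times K}$ satisfy $\mathbf S^H\mathbf S=\mathbf I_K$. Let $\mathbf\Phi=\mathrm{diag}(e^{j\theta_1},\dots,e^{j\theta_N})$ with real $\theta_n$. With wavelength $\lambda>0$ and spacings $d_{bs},d_{ris}>0$ let $$[\mathbf a_M(\vartheta^a,\vartheta^e)]_x=e^{j2\pi\frac{d_{bs}}{\lambda}(x-1)\sin\vartheta^e\sin\vartheta^a},\qquad [\mathbf a_N(\vartheta^a,\vartheta^e)]_x=e^{j2\pi\frac{d_{ris}}{\lambda}(\lfloor (x-1)/\sqrt N\rfloor\sin\vartheta^e\sin\vartheta^a+((x-1)\bmod\sqrt N)\cos\vartheta^e)},$$ $\overline{\mathbf h}_k=\mathbf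 a_N(\varphi^a_{kr},\varphi^e_{kr})$, $\mathbf a_M=\mathbf a_M(\phi_r^a,\phi_r^e)$, $\mathbf a_N=\mathbf a_N(\varphi_t^a,\varphi_t^e)$, $\overline{\mathbf H}_2=\mathbf a_M\mathbf a_N^H$ for arbitrary real angles. Let $\mathbf R_{ris},\mathbf R_{emi}\in\mathbb C^{N\times N}$ be positive semidefinite spatial correlation matrices. (For isotropic scattering, $\mathbf R_{ris}=\mathbf R_{emi}=\mathbf R$ with $[\mathbf R]_{a,b}=\mathrm{sinc}(2\|\mathbf u_a-\mathbf u_b\|/\lambda)$, $\mathrm{sinc}(x)=\frac{\sin \pi x}{\pi x}$, where $\mathbf u_a$ are the positions of the RIS elements on the square grid of spacing $d_{ris}$; this matrix is positive semidefinite.) Let $\tilde{\mathbf H}_2\in\mathbb C^{M\times N}$, $\tilde{\mathbf d}_k\in\mathbb C^M$ ($1\le k\le K$), $\tilde{\mathbf V}\in\mathbb C^{N\times\tau}$, $\mathbf N\in\mathbb C^{M\times\tau}$ be random with jointly independent circularly symmetric complex Gaussian entries of mean $0$ and variance $1$, $1$, $\sigma_e^2$, $\sigma^2$, respectively. Put $\mathbf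 h_k=\sqrt{\alpha_k}\,\overline{\mathbf h}_k$, $\mathbf H_{c,2}=\sqrt{\tfrac{\beta}{\delta+1}}(\sqrt\delta\,\overline{\mathbf H}_2+\tilde{\mathbf H}_2\mathbf R_{ris}^{1/2})$, $\mathbf q_{c,k}=\mathbf H_{c,2}\mathbf\Phi\mathbf h_k+\sqrt{\gamma_k}\,\tilde{\mathbf d}_k$, $\mathbf Q_c=[\mathbf q_{c,1},\dots,\mathbf q_{c,K}]$. The received pilot signal, with thermal noise and electromagnetic interference (EMI), is $\mathbf Y_{c,P}=\sqrt{\tau p}\,\mathbf Q_c\mathbf S^H+\mathbf H_{c,2}\mathbf\Phi\mathbf R_{emi}^{1/2}\tilde{\mathbf V}+\mathbf N$. Put $\mathbf y^k_{c,p}=\frac1{\sqrt{\tau p}}\mathbf Y_{c,P}\mathbf s_k$, and let $\hat{\mathbf q}_{c,k}=\mathbb E\{\mathbf q_{c,k}\}+\mathrm{Cov}\{\mathbf q_{c,k},\mathbf y^k_{c,p}\}\,\mathrm{Cov}\{\mathbf y^k_{c,p},\mathbf y^k_{c,p}\}^{-1}(\mathbf y^k_{c,p}-\mathbb E\{\mathbf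 y^k_{c,p}\})$ be the LMMSE estimate of $\mathbf q_{c,k}$ from $\mathbf y^k_{c,p}$. The use-and-then-forget (UatF) bound of the achievable rate of user $k$ under maximum ratio combining is $\underline R_{c,k}=\tau^o\log_2(1+\mathrm{SINR}_{c,k})$ with $$\mathrm{SINR}_{c,k}=\frac{pE^{signal}_{c,k}}{pE^{leak}_{c,k}+p\sum_{i\ne k}I_{c,ki}+\sigma_e^2E^{emi}_{c,k}+\sigma^2E^{noise}_{c,k}},$$ $E^{signal}_{c,k}=|\mathbb E\{\hat{\mathbf q}_{c,k}^H\mathbf q_{c,k}\}|^2$, $E^{leak}_{c,k}=\mathbb E\{|\hat{\mathbf q}_{c,k}^H\mathbf q_{c,k}|^2\}-|\mathbb E\{\hat{\mathbf q}_{c,k}^H\mathbf q_{c,k}\}|^2$, $I_{c,ki}=\mathbb E\{|\hat{\mathbf q}_{c,k}^H\mathbf q_{c,i}|^2\}$, $E^{emi}_{c,k}=\mathbb E\{\hat{\mathbf q}_{c,k}^H\mathbf H_{c,2}\mathbf\Phi\mathbf R_{emi}\mathbf\Phi^H\mathbf H_{c,2}^H\hat{\mathbf q}_{c,k}\}$,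 $E^{noise}_{c,k}=\mathbb E\{\|\hat{\mathbf q}_{c,k}\|^2\}$. **Notation.** $\widehat c_k=\frac{\alpha_k\beta}{\delta+1}$, $\eta=\frac{\beta\sigma_e^2}{\tau p(\delta+1)}$, $\nu=\frac{\sigma^2}{\tau p}$, $f_k=\mathbf a_N^H\mathbf\Phi\overline{\mathbf h}_k$, $f_{c,1}=\mathrm{Tr}\{\mathbf R_{ris}\mathbf\Phi\mathbf R_{emi}\mathbf\Phi^H\}$, $f_{c,k,2}=\overline{\mathbf h}_k^H\mathbf\Phi^H\mathbf R_{ris}\mathbf\Phi\overline{\mathbf h}_k$, $$\mathbf\Upsilon_k=(\widehat c_kf_{c,k,2}+\gamma_k)\Big\{\big(\widehat c_kf_{c,k,2}+\gamma_k+\nu+\eta\,\mathrm{Tr}\{\mathbf R_{emi}\mathbf\Phi^H\mathbf R_{ris}\mathbf\Phi\}\big)\mathbf I_M+\eta\delta\,\overline{\mathbf H}_2\mathbf\Phi\mathbf R_{emi}\mathbf\Phi^H\overline{\mathbf H}_2^H\Big\}^{-1},$$ $f_{c,k,3}=\mathrm{Tr}\{\mathbf\Upsilon_k^2\overline{\mathbf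 H}_2\mathbf\Phi\mathbf R_{emi}\mathbf\Phi^H\overline{\mathbf H}_2^H\}$, $f_{c,k,4}=\mathrm{Tr}\{\mathbf\Upsilon_k^2\}$, $f_{c,k,5}=|\mathrm{Tr}\{\mathbf\Upsilon_k\}|^2$, $f_{c,k,6}=\overline{\mathbf h}_k^H\mathbf\Phi^H\mathbf R_{ris}\mathbf\Phi\mathbf R_{emi}\mathbf\Phi^H\mathbf R_{ris}\mathbf\Phi\overline{\mathbf h}_k$, $f_{c,k,7}=|f_k|^2$, $f_{c,ki,8}=\overline{\mathbf h}_i^H\mathbf\Phi^H\overline{\mathbf H}_2^H\mathbf\Upsilon_k^2\overline{\mathbf H}_2\mathbf\Phi\overline{\mathbf h}_i$, $f_{c,ki,9}=\overline{\mathbf h}_i^H\mathbf\Phi^H\overline{\mathbf H}_2^H\mathbf\Upsilon_k\overline{\mathbf H}_2\mathbf\Phi\mathbf R_{emi}\mathbf\Phi^H\overline{\mathbf H}_2^H\mathbf\Upsilon_k^H\overline{\mathbf H}_2\mathbf\Phi\overline{\mathbf h}_i$. **Theorem.** All the expectations above are finite, and $\underline R_{c,k}=\tau^o\log_2(1+\mathrm{SINR}_{c,k})$,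 where the terms of $\mathrm{SINR}_{c,k}$ have the following closed forms. (In the degenerate case where the denominator of $\mathrm{SINR}_{c,k}$ vanishes, $\mathrm{SINR}_{c,k}$ is read as $0$.) First, $E^{signal}_{c,k}=(E^{noise}_{c,k})^2$ and $$E^{noise}_{c,k}=M\widehat c_k\delta|f_k|^2+\widehat c_k\mathrm{Tr}\{\mathbf\Upsilon_k\}\,\overline{\mathbf h}_k^H\mathbf\Phi^H\mathbf R_{ris}\mathbf\Phi\overline{\mathbf h}_k+\gamma_k\mathrm{Tr}\{\mathbf\Upsilon_k\}.$$ $E^{emi}_{c,k}=\frac{\beta}{\delta+1}\sum_{\omega=1}^8E^{\omega,emi}_{c,k}$ with $$\begin{aligned} E^{1,emi}_{c,k}&=M^2\widehat c_k\delta^2f_{c,k,7}\,\mathbf a_N^H\mathbf\Phi\mathbf R_{emi}\mathbf\Phi^H\mathbf a_N,\\ E^{2,emi}_{c,k}&=\big(\widehat c_k\delta f_{c,k,2}+2\delta\eta f_{c,1}+\delta(\gamma_k+\nu)\big)f_{c,k,3},\\ E^{3,emi}_{c,k}&=\big(M\widehat c_k\delta f_{c,k,7}+(\nu+\gamma_k+\widehat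 c_kf_{c,k,2}+\eta f_{c,1})f_{c,k,4}\big)f_{c,1},\\ E^{4,emi}_{c,k}&=\delta^2\eta\,\mathrm{Tr}\{(\mathbf R_{emi}\mathbf\Phi^H\overline{\mathbf H}_2^H\mathbf\Upsilon_k\overline{\mathbf H}_2\mathbf\Phi)^2\},\\ E^{5,emi}_{c,k}&=2\widehat c_k\delta\,\mathrm{Tr}\{\mathbf\Upsilon_k\}\mathrm{Re}\{\overline{\mathbf h}_k^H\mathbf\Phi^H\overline{\mathbf H}_2^H\overline{\mathbf H}_2\mathbf\Phi\mathbf R_{emi}\mathbf\Phi^H\mathbf R_{ris}\mathbf\Phi\overline{\mathbf h}_k\},\\ E^{6,emi}_{c,k}&=2\delta\eta\,\mathrm{Tr}\{\mathbf\Upsilon_k\}\mathrm{Tr}\{\mathbf R_{emi}\mathbf\Phi^H\overline{\mathbf H}_2^H\mathbf\Upsilon_k^H\overline{\mathbf H}_2\mathbf\Phi\mathbf R_{emi}\mathbf\Phi^H\mathbf R_{ris}\mathbf\Phi\},\\ E^{7,emi}_{c,k}&=\widehat c_kf_{c,k,5}f_{c,k,6},\qquad E^{8,emi}_{c,k}=\eta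 f_{c,k,5}\mathrm{Tr}\{(\mathbf R_{ris}\mathbf\Phi\mathbf R_{emi}\mathbf\Phi^H)^2\}. \end{aligned}$$ For $i\ne k$, $I_{c,ki}=\sum_{\omega=1}^8I^\omega_{c,ki}$ with $$\begin{aligned} I^1_{c,ki}&=\gamma_iE^{noise}_{c,k}+M^2\widehat c_k\widehat c_i\delta^2f_{c,k,7}f_{c,i,7},\\ I^2_{c,ki}&=\big\{M\widehat c_k\widehat c_i\delta f_{c,k,7}+(\widehat c_i(\gamma_k+\nu)+\widehat c_i\eta f_{c,1})f_{c,k,4}+\widehat c_i\delta\eta f_{c,k,3}\big\}f_{c,i,2},\\ I^3_{c,ki}&=\{\widehat c_k\widehat c_i\delta f_{c,ki,8}+\widehat c_k\widehat c_if_{c,k,4}f_{c,i,2}\}f_{c,k,2},\\ I^4_{c,ki}&=\{\widehat c_i\delta\eta f_{c,1}+\widehat c_i\delta(\gamma_k+\nu)\}f_{c,ki,8},\\ I^5_{c,ki}&=\{\widehat c_k\widehat c_i|\overline{\mathbf h}_k^H\mathbf\Phi^H\mathbf R_{ris}\mathbf\Phi\overline{\mathbf h}_i|^2+\widehat c_i\eta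 f_{c,i,6}\}f_{c,k,5},\\ I^6_{c,ki}&=2\widehat c_k\widehat c_i\delta\,\mathrm{Tr}\{\mathbf\Upsilon_k\}\mathrm{Re}\{\overline{\mathbf h}_k^H\mathbf\Phi^H\overline{\mathbf H}_2^H\overline{\mathbf H}_2\mathbf\Phi\overline{\mathbf h}_i\overline{\mathbf h}_i^H\mathbf\Phi^H\mathbf R_{ris}\mathbf\Phi\overline{\mathbf h}_k\},\\ I^7_{c,ki}&=\widehat c_i\delta^2\eta f_{c,ki,9},\\ I^8_{c,ki}&=2\widehat c_i\delta\eta\,\mathrm{Tr}\{\mathbf\Upsilon_k\}\mathrm{Re}\{\overline{\mathbf h}_i^H\mathbf\Phi^H\mathbf R_{ris}\mathbf\Phi\mathbf R_{emi}\mathbf\Phi^H\overline{\mathbf H}_2^H\mathbf\Upsilon_k^H\overline{\mathbf H}_2\mathbf\Phi\overline{\mathbf h}_i\}. \end{aligned}$$ $E^{leak}_{c,k}=\sum_{\omega=1}^8E^{\omega,leak}_{c,k}$ with $$\begin{aligned} E^{1,leak}_{c,k}&=M\widehat c_k\delta\gamma_kf_{c,k,7},\\ E^{2,leak}_{c,k}&=\big\{M\widehat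 c_k^2\delta f_{c,k,7}+\widehat c_k^2\delta f_{c,kk,8}+(\widehat c_k^2f_{c,k,2}+2\widehat c_k\gamma_k+\widehat c_k\nu)f_{c,k,4}\big\}f_{c,k,2},\\ E^{3,leak}_{c,k}&=\{\widehat c_k\delta\gamma_k+\widehat c_k\delta\eta f_{c,1}+\widehat c_k\delta\nu\}f_{c,kk,8},\\ E^{4,leak}_{c,k}&=\{\gamma_k^2+\gamma_k\nu+\eta(\gamma_k+\widehat c_kf_{c,k,2})f_{c,1}\}f_{c,k,4},\\ E^{5,leak}_{c,k}&=\widehat c_k\delta^2\eta f_{c,kk,9},\\ E^{6,leak}_{c,k}&=2\widehat c_k\delta\eta\,\mathrm{Tr}\{\mathbf\Upsilon_k^H\}\mathrm{Re}\{\overline{\mathbf h}_k^H\mathbf\Phi^H\overline{\mathbf H}_2^H\mathbf\Upsilon_k\overline{\mathbf H}_2\mathbf\Phi\mathbf R_{emi}\mathbf\Phi^H\mathbf R_{ris}\mathbf\Phi\overline{\mathbf h}_k\},\\ E^{7,leak}_{c,k}&=\delta\eta\{\gamma_k+\widehat c_kf_{c,k,2}\}f_{c,k,3},\qquad E^{8,leak}_{c,k}=\widehat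 c_k\eta f_{c,k,5}f_{c,k,6}. \end{aligned}$$ -/

import Mathlib

open MeasureTheory ProbabilityTheory Matrix
open scoped NNReal MatrixOrder ComplexOrder

namespace RIS

/-! ## Positive semidefiniteness of the isotropic correlation kernel

The kernel `sinc ‖x - y‖` on `ℝ³` is positive semidefinite. Hence the isotropic spatial correlation
matrix defined below is a correlation matrix, and its square root is a genuine one. -/

lemma integral_parabola_mul_cos (r t : ℝ) (ht : t ≠ 0) :
    ∫ s in (-r)..r, (r^2 - s^2) * Real.cos (t*s) =
      4 * Real.sin (t*r) / t^3 - 4 * r * Real.cos (t*r) / t^2 := by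
  have h : ∀ s ∈ Set.uIcc (-r) r, HasDerivAt
      (fun s => (r^2-s^2) * Real.sin (t*s) / t - 2*s*Real.cos (t*s)/t^2 + 2*Real.sin (t*s)/t^3)
      ((r^2 - s^2) * Real.cos (t*s)) s := by
    intro s _
    have h1 : HasDerivAt (fun s : ℝ => t*s) t s := by simpa using (hasDerivAt_id s).const_mul t
    have hs := h1.sin
    have hc := h1.cos
    have hq : HasDerivAt (fun s : ℝ => r^2 - s^2) (-(2*s)) s := by
      simpa using ((hasDerivAt_id s).pow 2).const_sub (r^2)
    have h2 : HasDerivAt (fun s : ℝ => 2*s) 2 s := by simpa using (hasDerivAt_id s).const_mul 2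
    refine ((((hq.mul hs).div_const t).sub ((h2.mul hc).div_const (t^2))).add
      ((hs.const_mul 2).div_const (t^3))).congr_deriv ?_
    field_simp
    ring
  rw [intervalIntegral.integral_eq_sub_of_hasDerivAt h (by apply Continuous.intervalIntegrable; fun_prop)]
  simp only [mul_neg, Real.sin_neg, Real.cos_neg]
  field_simp
  ring

lemma integral_parabola (r : ℝ) : ∫ s in (-r)..r, (r^2 - s^2) = 4 * r^3 / 3 := by
  rw [intervalIntegral.integral_sub (by simp) (by apply Continuous.intervalIntegrable; fun_prop)]
  simp; ring

lemma hasDerivAt_integral_parabola_mul_cos (t : ℝ) : HasDerivAt (fun r => ∫ s in (-r)..r, (r^2 - s^2) * Real.cos (t*s))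
    (4 * Real.sinc t) 1 := by
  by_cases ht : t = 0
  · subst ht
    simp only [zero_mul, Real.cos_zero, mul_one, integral_parabola, Real.sinc_zero]
    have := ((hasDerivAt_pow 3 (1:ℝ)).const_mul 4).div_const 3
    exact this.congr_deriv (by norm_num)
  · simp only [fun r => integral_parabola_mul_cos r t ht, Real.sinc_of_ne_zero ht]
    have h1 : HasDerivAt (fun s : ℝ => t*s) t 1 := by simpa using (hasDerivAt_id (1:ℝ)).const_mul t
    have h2 : HasDerivAt (fun s : ℝ => 4*s) 4 1 := by simpa using (hasDerivAt_id (1:ℝ)).const_mul 4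
    refine (((h1.sin.const_mul 4).div_const (t^3)).sub
      ((h2.mul h1.cos).div_const (t^2))).congr_deriv ?_
    field_simp
    ring

lemma exists_measurePreserving_split : ∃ e : EuclideanSpace ℝ (Fin 3) ≃ᵐ ℝ × EuclideanSpace ℝ (Fin 2), MeasurePreserving e volume (volume.prod volume) ∧
    ∀ y, (e y).1 = y 0 ∧ ‖y‖^2 = (e y).1^2 + ‖(e y).2‖^2 := by
  let e1 := (MeasurableEquiv.toLp 2 (Fin 3 → ℝ)).symm
  let e2 := MeasurableEquiv.piFinSuccAbove (fun _ : Fin 3 => ℝ) 0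
  let e3 := (MeasurableEquiv.refl ℝ).prodCongr (MeasurableEquiv.toLp 2 (Fin 2 → ℝ))
  refine ⟨(e1.trans e2).trans e3, ?_, ?_⟩
  · refine MeasurePreserving.trans (μb := volume) (MeasurePreserving.trans (μb := volume)
      (PiLp.volume_preserving_ofLp (Fin 3)) (volume_preserving_piFinSuccAbove _ 0)) ?_
    exact (MeasurePreserving.id volume).prod (PiLp.volume_preserving_toLp (Fin 2))
  · intro y
    refine ⟨rfl, ?_⟩
    simp only [EuclideanSpace.norm_sq_eq, Fin.sum_univ_three, Fin.sum_univ_two, Real.norm_eq_abs,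
      sq_abs]
    change y 0 ^ 2 + y 1 ^ 2 + y 2 ^ 2 = y 0 ^ 2 + (y 1 ^ 2 + y 2 ^ 2)
    ring

lemma integral_ball_cos_axis (r : ℝ) (hr : 0 ≤ r) (t : ℝ) :
    ∫ y in Metric.ball (0:EuclideanSpace ℝ (Fin 3)) r, Real.cos (t * y 0) =
      Real.pi * ∫ s in (-r)..r, (r^2 - s^2) * Real.cos (t*s) := by
  obtain ⟨e, he, hy⟩ := exists_measurePreserving_split
  let S : Set (ℝ × EuclideanSpace ℝ (Fin 2)) := {q | q.1^2 + ‖q.2‖^2 < r^2}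
  have hSo : IsOpen S := isOpen_lt (by fun_prop) (by fun_prop)
  have hpre : e ⁻¹' S = Metric.ball 0 r := by
    ext y
    simp only [S, Set.mem_preimage, Set.mem_ofPred_eq, mem_ball_zero_iff, ← (hy y).2]
    exact pow_lt_pow_iff_left₀ (norm_nonneg _) hr two_ne_zero
  have hvol : (volume.prod volume) S < ⊤ := by
    rw [← he.measure_preimage_equiv, hpre]; exact measure_ball_lt_top
  have h1 : ∫ y in Metric.ball (0:EuclideanSpace ℝ (Fin 3)) r, Real.cos (t * y 0) =
      ∫ q in S, Real.cos (t * q.1) ∂(volume.prod volume) := by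
    rw [← he.setIntegral_preimage_emb e.measurableEmbedding, hpre]
    refine setIntegral_congr_fun measurableSet_ball fun y _ => ?_
    simp only [(hy y).1]
  have hint : IntegrableOn (fun q : ℝ × EuclideanSpace ℝ (Fin 2) => Real.cos (t * q.1)) S (volume.prod volume) := by
    refine Measure.integrableOn_of_bounded (M := 1) hvol.ne
      (by apply Continuous.aestronglyMeasurable; fun_prop) ?_
    exact Filter.Eventually.of_forall fun q => Real.abs_cos_le_one _
  rw [h1, ← integral_indicator hSo.measurableSet,
    integral_prod _ (hint.integrable_indicator hSo.measurableSet)]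
  have h2 : ∀ s, ∫ z : EuclideanSpace ℝ (Fin 2), S.indicator (fun q => Real.cos (t * q.1)) (s, z) =
      (Set.Ioc (-r) r).indicator (fun s => Real.pi * ((r^2 - s^2) * Real.cos (t*s))) s := by
    intro s
    have h3 : (fun z : EuclideanSpace ℝ (Fin 2) => S.indicator (fun q => Real.cos (t * q.1)) (s, z)) =
        (Metric.ball (0:EuclideanSpace ℝ (Fin 2)) (√(r^2 - s^2))).indicator (fun _ => Real.cos (t*s)) := by
      ext z
      have : (s, z) ∈ S ↔ z ∈ Metric.ball (0:EuclideanSpace ℝ (Fin 2)) (√(r^2 - s^2)) := by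
        simp only [S, Set.mem_ofPred_eq, mem_ball_zero_iff]
        rw [Real.lt_sqrt (norm_nonneg _)]
        constructor <;> intro h <;> linarith
      by_cases h : (s, z) ∈ S
      · rw [Set.indicator_of_mem h, Set.indicator_of_mem (this.1 h)]
      · rw [Set.indicator_of_notMem h, Set.indicator_of_notMem (fun h' => h (this.2 h'))]
    rw [h3, integral_indicator measurableSet_ball, setIntegral_const, Measure.real,
      EuclideanSpace.volume_ball_fin_two]
    by_cases hs : s ∈ Set.Ioc (-r) r
    · have : 0 ≤ r^2 - s^2 := by nlinarith [hs.1, hs.2]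
      rw [Set.indicator_of_mem hs]
      simp [← ENNReal.ofReal_pow, Real.sqrt_nonneg, Real.sq_sqrt this, this, ENNReal.toReal_ofReal,
        Real.pi_nonneg]
      ring
    · have : r^2 - s^2 ≤ 0 := by
        simp only [Set.mem_Ioc, not_and_or, not_lt, not_le] at hs
        rcases hs with h | h <;> nlinarith
      rw [Set.indicator_of_notMem hs, Real.sqrt_eq_zero'.2 this]
      simp
  simp_rw [h2]
  rw [integral_indicator measurableSet_Ioc, ← intervalIntegral.integral_of_le (by linarith),
    intervalIntegral.integral_const_mul]

lemma integral_ball_cos_inner (r : ℝ) (hr : 0 ≤ r) (x : EuclideanSpace ℝ (Fin 3)) :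
    ∫ y in Metric.ball (0:EuclideanSpace ℝ (Fin 3)) r, Real.cos (inner ℝ x y) =
      Real.pi * ∫ s in (-r)..r, (r^2 - s^2) * Real.cos (‖x‖*s) := by
  rw [← integral_ball_cos_axis r hr]
  set e : EuclideanSpace ℝ (Fin 3) := ‖x‖ • EuclideanSpace.single 0 1 with he
  have hn : ‖x‖ = ‖e‖ := by simp [he, norm_smul]
  let T : EuclideanSpace ℝ (Fin 3) ≃ₗᵢ[ℝ] EuclideanSpace ℝ (Fin 3) := Submodule.reflection (Submodule.span ℝ {x - e})ᗮ
  have hT : T x = e := Submodule.reflection_sub hn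
  have hpre : T ⁻¹' Metric.ball 0 r = Metric.ball 0 r := by
    ext y; simp
  rw [← (T.measurePreserving).setIntegral_preimage_emb T.toHomeomorph.measurableEmbedding
    (fun y : EuclideanSpace ℝ (Fin 3) => Real.cos (‖x‖ * y 0)), hpre]
  congr 1
  ext y
  have : inner ℝ x y = inner ℝ e (T y) := by rw [← hT, T.inner_map_map]
  rw [this, he, inner_smul_left, EuclideanSpace.inner_single_left]
  simp

theorem posSemidef_sinc_dist {ι : Type*} [Fintype ι] (u : ι → EuclideanSpace ℝ (Fin 3)) :
    (Matrix.of fun a b => Real.sinc ‖u a - u b‖ : Matrix ι ι ℝ).PosSemidef := by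
  refine Matrix.PosSemidef.of_dotProduct_mulVec_nonneg ?_ ?_
  · ext a b; simp [Matrix.conjTranspose_apply, norm_sub_rev]
  intro c
  set Q : ℝ → ℝ := fun r => ∑ a, ∑ b, c a * c b *
    ∫ s in (-r)..r, (r^2 - s^2) * Real.cos (‖u a - u b‖*s) with hQ
  have hd : HasDerivAt Q (∑ a, ∑ b, c a * c b * (4 * Real.sinc ‖u a - u b‖)) 1 := by
    apply HasDerivAt.fun_sum; intro a _
    apply HasDerivAt.fun_sum; intro b _
    exact (hasDerivAt_integral_parabola_mul_cos _).const_mul _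
  let g : EuclideanSpace ℝ (Fin 3) → ℝ := fun y => (∑ a, c a * Real.cos (inner ℝ (u a) y))^2 +
      (∑ a, c a * Real.sin (inner ℝ (u a) y))^2
  have hgi : ∀ r, IntegrableOn g (Metric.ball 0 r) := by
    intro r
    have : Continuous g := by fun_prop
    exact (this.continuousOn.integrableOn_compact (isCompact_closedBall 0 r)).mono_set
      Metric.ball_subset_closedBall
  have hQg : ∀ r, 0 ≤ r → Real.pi * Q r = ∫ y in Metric.ball (0:EuclideanSpace ℝ (Fin 3)) r, g y := by
    intro r hr
    have hi : ∀ a b, IntegrableOn (fun y : EuclideanSpace ℝ (Fin 3) => c a * c b * Real.cos (inner ℝ (u a - u b) y))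
        (Metric.ball 0 r) := by
      intro a b
      have : Continuous (fun y : EuclideanSpace ℝ (Fin 3) => c a * c b * Real.cos (inner ℝ (u a - u b) y)) := by fun_prop
      exact (this.continuousOn.integrableOn_compact (isCompact_closedBall 0 r)).mono_set
        Metric.ball_subset_closedBall
    have : g = fun y => ∑ a, ∑ b, c a * c b * Real.cos (inner ℝ (u a - u b) y) := by
      ext y
      simp only [g, pow_two, Finset.sum_mul_sum, ← Finset.sum_add_distrib]
      refine Finset.sum_congr rfl fun a _ => Finset.sum_congr rfl fun b _ => ?_
      rw [inner_sub_left, Real.cos_sub]; ring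
    rw [this, integral_finsetSum _ (fun a _ => integrable_finsetSum _ fun b _ => hi a b), hQ,
      Finset.mul_sum]
    refine Finset.sum_congr rfl fun a _ => ?_
    rw [integral_finsetSum _ (fun b _ => hi a b), Finset.mul_sum]
    refine Finset.sum_congr rfl fun b _ => ?_
    rw [integral_const_mul, integral_ball_cos_inner r hr]; ring
  have hmono : MonotoneOn Q (Set.Ici 0) := by
    intro r hr s hs hrs
    have : Real.pi * Q r ≤ Real.pi * Q s := by
      rw [hQg r hr, hQg s hs]
      refine setIntegral_mono_set (hgi s) ?_ (Metric.ball_subset_ball hrs).eventuallyLE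
      exact Filter.Eventually.of_forall fun y => by simp only [g]; positivity
    exact le_of_mul_le_mul_left this Real.pi_pos
  have hnn : 0 ≤ ∑ a, ∑ b, c a * c b * (4 * Real.sinc ‖u a - u b‖) := by
    have h1 := hmono.derivWithin_nonneg (x := 1)
    rwa [hd.hasDerivWithinAt.derivWithin ((uniqueDiffOn_Ici 0) 1 (by simp))] at h1
  have : star c ⬝ᵥ (Matrix.of fun a b => Real.sinc ‖u a - u b‖ : Matrix ι ι ℝ).mulVec c =
      (∑ a, ∑ b, c a * c b * (4 * Real.sinc ‖u a - u b‖)) / 4 := by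
    simp only [dotProduct, Matrix.mulVec, Finset.mul_sum, Finset.sum_div, Matrix.of_apply]
    refine Finset.sum_congr rfl fun a _ => Finset.sum_congr rfl fun b _ => ?_
    simp; ring
  rw [this]; positivity

/-! ## System model -/

/-- The circularly symmetric complex Gaussian law `CN(0, v)`: independent real and imaginary parts,
each of law `N(0, v/2)`. -/
noncomputable def complexGaussian (v : ℝ≥0) : Measure ℂ :=
  ((gaussianReal 0 (v / 2)).prod (gaussianReal 0 (v / 2))).map
    (fun z : ℝ × ℝ => (z.1 : ℂ) + (z.2 : ℂ) * Complex.I)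

/-- The deterministic parameters of the system, with `M` antennas at the base station (BS),
`N` elements of the reconfigurable intelligent surface (RIS), `K` users and `τ` pilot slots. -/
structure Params (M N K τ : ℕ) where
  /-- length of the coherence interval -/
  τc : ℕ
  /-- transmit power of each user -/
  p : ℝ
  /-- `σ ^ 2` is the thermal noise power -/
  σ : ℝ
  /-- `σe ^ 2` is the power of the electromagnetic interference (EMI) -/
  σe : ℝ
  /-- path loss from the users to the RIS -/
  α : Fin K → ℝ
  /-- path loss from the RIS to the BS -/
  β : ℝ
  /-- path loss of the direct links -/
  γ : Fin K → ℝ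
  /-- Rician factor of the RIS-BS link -/
  δ : ℝ
  /-- wavelength -/
  wl : ℝ
  /-- spacing of the BS antennas -/
  dbs : ℝ
  /-- spacing of the RIS elements -/
  dris : ℝ
  /-- azimuth angle of arrival at the RIS from the users -/
  azUser : Fin K → ℝ
  /-- elevation angle of arrival at the RIS from the users -/
  elUser : Fin K → ℝ
  /-- azimuth angle of departure from the RIS to the BS -/
  azDep : ℝ
  /-- elevation angle of departure from the RIS to the BS -/
  elDep : ℝ
  /-- azimuth angle of arrival at the BS from the RIS -/
  azBS : ℝ
  /-- elevation angle of arrival at the BS from the RIS -/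
  elBS : ℝ
  /-- phase shifts of the RIS elements -/
  θ : Fin N → ℝ
  /-- pilot matrix, the pilot sequence of user `k` is the column `k` -/
  S : Matrix (Fin τ) (Fin K) ℂ
  /-- spatial correlation matrix of the scattered RIS-BS channel at the RIS -/
  Rris : Matrix (Fin N) (Fin N) ℂ
  /-- spatial correlation matrix of the EMI at the RIS -/
  Remi : Matrix (Fin N) (Fin N) ℂ

namespace Params

variable {M N K τ : ℕ} (P : Params M N K τ)

/-- The standing assumptions on the parameters. The RIS is a square array, so `N` is a perfect
square; the pilot sequences are orthonormal (which forces `K ≤ τ`). -/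
structure Valid : Prop where
  square : IsSquare N
  pilot_le : τ ≤ P.τc
  p_pos : 0 < P.p
  σ_pos : 0 < P.σ
  σe_nonneg : 0 ≤ P.σe
  α_pos : ∀ k, 0 < P.α k
  β_pos : 0 < P.β
  γ_nonneg : ∀ k, 0 ≤ P.γ k
  δ_nonneg : 0 ≤ P.δ
  wl_pos : 0 < P.wl
  dbs_pos : 0 < P.dbs
  dris_pos : 0 < P.dris
  pilots : P.Sᴴ * P.S = 1
  Rris_psd : P.Rris.PosSemidef
  Remi_psd : P.Remi.PosSemidef

/-- Array response of the BS (uniform linear array); indices start at `0`. -/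
noncomputable def respBS (az el : ℝ) : Fin M → ℂ := fun x =>
  Complex.exp (Complex.I *
    ((2 * Real.pi * (P.dbs / P.wl) * ((x : ℕ) * (Real.sin el * Real.sin az)) : ℝ) : ℂ))

/-- Array response of the RIS (uniform square planar array with side `√N`); indices start at
`0`. -/
noncomputable def respRIS (az el : ℝ) : Fin N → ℂ := fun x =>
  Complex.exp (Complex.I *
    ((2 * Real.pi * (P.dris / P.wl) *
      (((x : ℕ) / Nat.sqrt N : ℕ) * (Real.sin el * Real.sin az)
        + ((x : ℕ) % Nat.sqrt N : ℕ) * Real.cos el) : ℝ) : ℂ))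

/-- Position in space of an element of the RIS. -/
noncomputable def risPos (x : Fin N) : EuclideanSpace ℝ (Fin 3) :=
  !₂[0, P.dris * ((x : ℕ) / Nat.sqrt N : ℕ), P.dris * ((x : ℕ) % Nat.sqrt N : ℕ)]

/-- The correlation matrix of isotropic scattering, with entries `sinc (2 ‖u_a - u_b‖ / wl)`,
where `sinc x = sin (π x) / (π x)`. (`Real.sinc` is not normalized: it is `sin x / x`.) -/
noncomputable def isotropicCorrelation : Matrix (Fin N) (Fin N) ℂ :=
  Matrix.of fun a b => ((Real.sinc (Real.pi * (2 * ‖P.risPos a - P.risPos b‖ / P.wl)) : ℝ) : ℂ)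

/-- The isotropic model is admissible: `Valid` allows `P.Rris = P.Remi = P.isotropicCorrelation`. -/
theorem isotropicCorrelation_posSemidef (h : 0 < P.wl) : P.isotropicCorrelation.PosSemidef := by
  have h1 := posSemidef_sinc_dist (fun a : Fin N => (2 * Real.pi / P.wl) • P.risPos a)
  have h2 : P.isotropicCorrelation = (Matrix.of fun a b =>
      Real.sinc ‖(2 * Real.pi / P.wl) • P.risPos a - (2 * Real.pi / P.wl) • P.risPos b‖ :
        Matrix (Fin N) (Fin N) ℝ).map Complex.ofReal := by
    ext a b
    have h3 : 0 ≤ 2 * Real.pi / P.wl := by positivity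
    simp only [isotropicCorrelation, Matrix.of_apply, Matrix.map_apply, ← smul_sub, norm_smul,
      Real.norm_of_nonneg h3]
    congr 2
    ring
  obtain ⟨B, hB⟩ := CStarAlgebra.nonneg_iff_eq_star_mul_self.mp h1.nonneg
  rw [h2, hB, Matrix.star_eq_conjTranspose]
  have h4 : (Bᴴ * B).map Complex.ofReal = (B.map Complex.ofReal)ᴴ * B.map Complex.ofReal := by
    ext a b
    simp [Matrix.mul_apply]
  rw [h4]
  exact Matrix.posSemidef_conjTranspose_mul_self _

/-- Line-of-sight direction `h̄_k` of the link from user `k` to the RIS. -/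
noncomputable def hbar (k : Fin K) : Fin N → ℂ := P.respRIS (P.azUser k) (P.elUser k)

/-- `a_M`. -/
noncomputable def aM : Fin M → ℂ := P.respBS P.azBS P.elBS

/-- `a_N`. -/
noncomputable def aN : Fin N → ℂ := P.respRIS P.azDep P.elDep

/-- Line-of-sight part `H̄₂ = a_M a_Nᴴ` of the RIS-BS link. -/
noncomputable def Hbar : Matrix (Fin M) (Fin N) ℂ := Matrix.vecMulVec P.aM (star P.aN)

/-- Phase shift matrix of the RIS. -/
noncomputable def Φ : Matrix (Fin N) (Fin N) ℂ :=
  Matrix.diagonal fun n => Complex.exp (Complex.I * (P.θ n : ℂ))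

end Params

/-- The random quantities: the scattered RIS-BS channel `H̃₂`, the direct channels `d̃_k`, and the
EMI and noise matrices `Ṽ`, `N` received during the pilot phase. -/
structure Inputs (Ω : Type*) (M N K τ : ℕ) where
  Ht : Ω → Matrix (Fin M) (Fin N) ℂ
  dt : Fin K → Ω → Fin M → ℂ
  Vt : Ω → Matrix (Fin N) (Fin τ) ℂ
  Nz : Ω → Matrix (Fin M) (Fin τ) ℂ

/-- The scalar entries of all random quantities, as one family. -/
def Inputs.entry {Ω : Type*} {M N K τ : ℕ} (X : Inputs Ω M N K τ) :
    (Fin M × Fin N) ⊕ (Fin K × Fin M) ⊕ (Fin N × Fin τ) ⊕ (Fin M × Fin τ) → Ω → ℂ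
  | .inl (m, n) => fun ω => X.Ht ω m n
  | .inr (.inl (k, m)) => fun ω => X.dt k ω m
  | .inr (.inr (.inl (n, t))) => fun ω => X.Vt ω n t
  | .inr (.inr (.inr (m, t))) => fun ω => X.Nz ω m t

/-- The joint law: all entries are independent; those of `H̃₂` and `d̃_k` have law `CN(0, 1)`,
those of `Ṽ` have law `CN(0, σe²)` and those of `N` have law `CN(0, σ²)`. -/
structure IsModel {Ω : Type*} [MeasurableSpace Ω] (μ : Measure Ω) {M N K τ : ℕ}
    (P : Params M N K τ) (X : Inputs Ω M N K τ) : Prop where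
  law_Ht : ∀ m n, HasLaw (fun ω => X.Ht ω m n) (complexGaussian 1) μ
  law_dt : ∀ k m, HasLaw (fun ω => X.dt k ω m) (complexGaussian 1) μ
  law_Vt : ∀ n t, HasLaw (fun ω => X.Vt ω n t) (complexGaussian (P.σe ^ 2).toNNReal) μ
  law_Nz : ∀ m t, HasLaw (fun ω => X.Nz ω m t) (complexGaussian (P.σ ^ 2).toNNReal) μ
  indep : iIndepFun X.entry μ

/-! ## Channels, channel estimate and rate -/

section Channels

variable {Ω : Type*} {M N K τ : ℕ} (P : Params M N K τ) (X : Inputs Ω M N K τ)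

/-- User `k`-RIS channel `h_k`. -/
noncomputable def chanUser (k : Fin K) : Fin N → ℂ := ((√(P.α k) : ℝ) : ℂ) • P.hbar k

/-- RIS-BS channel `H_{c,2}`; `CFC.sqrt` is the positive semidefinite square root. -/
noncomputable def chanRIS (ω : Ω) : Matrix (Fin M) (Fin N) ℂ :=
  ((√(P.β / (P.δ + 1)) : ℝ) : ℂ) •
    (((√P.δ : ℝ) : ℂ) • P.Hbar + X.Ht ω * CFC.sqrt P.Rris)

/-- Aggregated channel `q_{c,k} = H_{c,2} Φ h_k + d_k` of user `k`. -/
noncomputable def chan (k : Fin K) (ω : Ω) : Fin M → ℂ :=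
  chanRIS P X ω *ᵥ (P.Φ *ᵥ chanUser P k) + ((√(P.γ k) : ℝ) : ℂ) • X.dt k ω

/-- Received pilot signal `Y_{c,P} = √(τ p) Q_c Sᴴ + H_{c,2} Φ V + N`, where the columns of `Q_c`
are the aggregated channels and `V = R_emi^{1/2} Ṽ`. -/
noncomputable def pilotSignal (ω : Ω) : Matrix (Fin M) (Fin τ) ℂ :=
  ((√(τ * P.p) : ℝ) : ℂ) • ((Matrix.of fun m k => chan P X k ω m) * P.Sᴴ)
    + chanRIS P X ω * P.Φ * (CFC.sqrt P.Remi * X.Vt ω) + X.Nz ω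

/-- Observation vector `y^k_{c,p} = Y_{c,P} s_k / √(τ p)` for user `k`. -/
noncomputable def obs (k : Fin K) (ω : Ω) : Fin M → ℂ :=
  ((1 / √(τ * P.p) : ℝ) : ℂ) • (pilotSignal P X ω *ᵥ fun t => P.S t k)

variable [MeasurableSpace Ω] (μ : Measure Ω)

/-- Entrywise mean of a random vector. -/
noncomputable def mean (Y : Ω → Fin M → ℂ) : Fin M → ℂ := fun m => ∫ ω, Y ω m ∂μ

/-- Cross-covariance matrix `E[(Y - E Y) (Z - E Z)ᴴ]`. -/
noncomputable def crossCov (Y Z : Ω → Fin M → ℂ) : Matrix (Fin M) (Fin M) ℂ :=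
  Matrix.of fun m m' => ∫ ω, (Y ω m - mean μ Y m) * star (Z ω m' - mean μ Z m') ∂μ

/-- Linear minimum mean square error (LMMSE) estimate of `Y` from the observation `Z`. -/
noncomputable def lmmse (Y Z : Ω → Fin M → ℂ) (ω : Ω) : Fin M → ℂ :=
  mean μ Y + (crossCov μ Y Z * (crossCov μ Z Z)⁻¹) *ᵥ (Z ω - mean μ Z)

/-- The LMMSE estimate of the aggregated channel of user `k`. -/
noncomputable def chanEst (k : Fin K) (ω : Ω) : Fin M → ℂ :=
  lmmse μ (chan P X k) (obs P X k) ω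

/-- The output `q̂_{c,k}ᴴ q_{c,i}` of maximum ratio combining for user `k` on the channel of
user `i`. -/
noncomputable def mrc (k i : Fin K) (ω : Ω) : ℂ := star (chanEst P X μ k ω) ⬝ᵥ chan P X i ω

/-- The quadratic form `q̂_{c,k}ᴴ H_{c,2} Φ R_emi Φᴴ H_{c,2}ᴴ q̂_{c,k}`. -/
noncomputable def emiForm (k : Fin K) (ω : Ω) : ℂ :=
  star (chanEst P X μ k ω) ⬝ᵥ
    (chanRIS P X ω * P.Φ * P.Remi * P.Φᴴ * (chanRIS P X ω)ᴴ) *ᵥ chanEst P X μ k ω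

/-- The squared norm `‖q̂_{c,k}‖²`. -/
noncomputable def estNormSq (k : Fin K) (ω : Ω) : ℝ := ∑ m, ‖chanEst P X μ k ω m‖ ^ 2

/-- Power of the desired signal. -/
noncomputable def signal (k : Fin K) : ℝ := ‖∫ ω, mrc P X μ k k ω ∂μ‖ ^ 2

/-- Power of the signal leakage. -/
noncomputable def leak (k : Fin K) : ℝ :=
  (∫ ω, ‖mrc P X μ k k ω‖ ^ 2 ∂μ) - ‖∫ ω, mrc P X μ k k ω ∂μ‖ ^ 2

/-- Power of the interference of user `i` with user `k`. -/
noncomputable def interference (k i : Fin K) : ℝ := ∫ ω, ‖mrc P X μ k i ω‖ ^ 2 ∂μ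

/-- EMI term (the form `emiForm` takes nonnegative real values). -/
noncomputable def emi (k : Fin K) : ℝ := (∫ ω, emiForm P X μ k ω ∂μ).re

/-- Noise term. -/
noncomputable def noise (k : Fin K) : ℝ := ∫ ω, estNormSq P X μ k ω ∂μ

/-- The signal-to-interference-plus-noise ratio of the use-and-then-forget (UatF) bound. -/
noncomputable def sinr (k : Fin K) : ℝ :=
  P.p * signal P X μ k /
    (P.p * leak P X μ k + P.p * ∑ i ∈ Finset.univ.erase k, interference P X μ k i
      + P.σe ^ 2 * emi P X μ k + P.σ ^ 2 * noise P X μ k)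

/-- The UatF bound of the achievable rate of user `k`. -/
noncomputable def rate (k : Fin K) : ℝ :=
  ((P.τc : ℝ) - τ) / P.τc * Real.logb 2 (1 + sinr P X μ k)

end Channels

/-! ## Closed-form expressions

Traces and Hermitian forms that are real by symmetry enter through their real part. -/

namespace Params

variable {M N K τ : ℕ} (P : Params M N K τ)

/-- `ĉ_k`. -/
noncomputable def c (k : Fin K) : ℝ := P.α k * P.β / (P.δ + 1)

/-- `β σe² / (τ p (δ + 1))`. -/
noncomputable def η : ℝ := P.β * P.σe ^ 2 / (τ * P.p * (P.δ + 1))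

/-- `σ² / (τ p)`. -/
noncomputable def ν : ℝ := P.σ ^ 2 / (τ * P.p)

/-- `f_k = a_Nᴴ Φ h̄_k`. -/
noncomputable def f (k : Fin K) : ℂ := star P.aN ⬝ᵥ P.Φ *ᵥ P.hbar k

/-- `f_{c,1}`. -/
noncomputable def f1 : ℝ := (P.Rris * P.Φ * P.Remi * P.Φᴴ).trace.re

/-- `f_{c,k,2}`. -/
noncomputable def f2 (k : Fin K) : ℝ :=
  (star (P.hbar k) ⬝ᵥ (P.Φᴴ * P.Rris * P.Φ) *ᵥ P.hbar k).re

/-- `Υ_k`. -/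
noncomputable def Υ (k : Fin K) : Matrix (Fin M) (Fin M) ℂ :=
  ((P.c k * P.f2 k + P.γ k : ℝ) : ℂ) •
    (((P.c k * P.f2 k + P.γ k + P.σ ^ 2 / (τ * P.p)
        + P.σe ^ 2 * P.β * (P.Remi * P.Φᴴ * P.Rris * P.Φ).trace.re / (τ * P.p * (P.δ + 1)) : ℝ) : ℂ)
          • (1 : Matrix (Fin M) (Fin M) ℂ)
      + ((P.σe ^ 2 * P.β * P.δ / (τ * P.p * (P.δ + 1)) : ℝ) : ℂ)
          • (P.Hbar * P.Φ * P.Remi * P.Φᴴ * P.Hbarᴴ))⁻¹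

/-- `Tr Υ_k`. -/
noncomputable def trΥ (k : Fin K) : ℝ := (P.Υ k).trace.re

/-- `f_{c,k,3}`. -/
noncomputable def f3 (k : Fin K) : ℝ :=
  (P.Υ k ^ 2 * P.Hbar * P.Φ * P.Remi * P.Φᴴ * P.Hbarᴴ).trace.re

/-- `f_{c,k,4}`. -/
noncomputable def f4 (k : Fin K) : ℝ := (P.Υ k ^ 2).trace.re

/-- `f_{c,k,5}`. -/
noncomputable def f5 (k : Fin K) : ℝ := ‖(P.Υ k).trace‖ ^ 2

/-- `f_{c,k,6}`. -/
noncomputable def f6 (k : Fin K) : ℝ :=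
  (star (P.hbar k) ⬝ᵥ (P.Φᴴ * P.Rris * P.Φ * P.Remi * P.Φᴴ * P.Rris * P.Φ) *ᵥ P.hbar k).re

/-- `f_{c,k,7}`. -/
noncomputable def f7 (k : Fin K) : ℝ := ‖P.f k‖ ^ 2

/-- `f_{c,ki,8}`. -/
noncomputable def f8 (k i : Fin K) : ℝ :=
  (star (P.hbar i) ⬝ᵥ (P.Φᴴ * P.Hbarᴴ * P.Υ k ^ 2 * P.Hbar * P.Φ) *ᵥ P.hbar i).re

/-- `f_{c,ki,9}`. -/
noncomputable def f9 (k i : Fin K) : ℝ :=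
  (star (P.hbar i) ⬝ᵥ (P.Φᴴ * P.Hbarᴴ * P.Υ k * P.Hbar * P.Φ * P.Remi * P.Φᴴ * P.Hbarᴴ * (P.Υ k)ᴴ
    * P.Hbar * P.Φ) *ᵥ P.hbar i).re

/-- Closed form of the noise term. -/
noncomputable def noiseCF (k : Fin K) : ℝ :=
  M * P.c k * P.δ * ‖P.f k‖ ^ 2
    + P.c k * P.trΥ k * (star (P.hbar k) ⬝ᵥ (P.Φᴴ * P.Rris * P.Φ) *ᵥ P.hbar k).re
    + P.γ k * P.trΥ k

/-- Closed form of the signal term. -/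
noncomputable def signalCF (k : Fin K) : ℝ := P.noiseCF k ^ 2

/-- The eight parts of the EMI term. -/
noncomputable def emiParts (k : Fin K) : Fin 8 → ℝ :=
  ![M ^ 2 * P.c k * P.δ ^ 2 * P.f7 k * (star P.aN ⬝ᵥ (P.Φ * P.Remi * P.Φᴴ) *ᵥ P.aN).re,
    (P.c k * P.δ * P.f2 k + 2 * P.δ * P.η * P.f1 + P.δ * (P.γ k + P.ν)) * P.f3 k,
    (M * P.c k * P.δ * P.f7 k + (P.ν + P.γ k + P.c k * P.f2 k + P.η * P.f1) * P.f4 k) * P.f1,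
    P.δ ^ 2 * P.η * ((P.Remi * P.Φᴴ * P.Hbarᴴ * P.Υ k * P.Hbar * P.Φ) ^ 2).trace.re,
    2 * P.c k * P.δ * P.trΥ k *
      (star (P.hbar k) ⬝ᵥ
        (P.Φᴴ * P.Hbarᴴ * P.Hbar * P.Φ * P.Remi * P.Φᴴ * P.Rris * P.Φ) *ᵥ P.hbar k).re,
    2 * P.δ * P.η * P.trΥ k *
      (P.Remi * P.Φᴴ * P.Hbarᴴ * (P.Υ k)ᴴ * P.Hbar * P.Φ * P.Remi * P.Φᴴ * P.Rris * P.Φ).trace.re,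
    P.c k * P.f5 k * P.f6 k,
    P.η * P.f5 k * ((P.Rris * P.Φ * P.Remi * P.Φᴴ) ^ 2).trace.re]

/-- Closed form of the EMI term. -/
noncomputable def emiCF (k : Fin K) : ℝ := P.β / (P.δ + 1) * ∑ w, P.emiParts k w

/-- The eight parts of the interference term. -/
noncomputable def interferenceParts (k i : Fin K) : Fin 8 → ℝ :=
  ![P.γ i * P.noiseCF k + M ^ 2 * P.c k * P.c i * P.δ ^ 2 * P.f7 k * P.f7 i,
    (M * P.c k * P.c i * P.δ * P.f7 k
      + (P.c i * (P.γ k + P.ν) + P.c i * P.η * P.f1) * P.f4 k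
      + P.c i * P.δ * P.η * P.f3 k) * P.f2 i,
    (P.c k * P.c i * P.δ * P.f8 k i + P.c k * P.c i * P.f4 k * P.f2 i) * P.f2 k,
    (P.c i * P.δ * P.η * P.f1 + P.c i * P.δ * (P.γ k + P.ν)) * P.f8 k i,
    (P.c k * P.c i * ‖star (P.hbar k) ⬝ᵥ (P.Φᴴ * P.Rris * P.Φ) *ᵥ P.hbar i‖ ^ 2
      + P.c i * P.η * P.f6 i) * P.f5 k,
    2 * P.c k * P.c i * P.δ * P.trΥ k *
      ((star (P.hbar k) ⬝ᵥ (P.Φᴴ * P.Hbarᴴ * P.Hbar * P.Φ) *ᵥ P.hbar i)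
        * (star (P.hbar i) ⬝ᵥ (P.Φᴴ * P.Rris * P.Φ) *ᵥ P.hbar k)).re,
    P.c i * P.δ ^ 2 * P.η * P.f9 k i,
    2 * P.c i * P.δ * P.η * P.trΥ k *
      (star (P.hbar i) ⬝ᵥ (P.Φᴴ * P.Rris * P.Φ * P.Remi * P.Φᴴ * P.Hbarᴴ * (P.Υ k)ᴴ
        * P.Hbar * P.Φ) *ᵥ P.hbar i).re]

/-- Closed form of the interference term. -/
noncomputable def interferenceCF (k i : Fin K) : ℝ := ∑ w, P.interferenceParts k i w

/-- The eight parts of the leakage term. -/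
noncomputable def leakParts (k : Fin K) : Fin 8 → ℝ :=
  ![M * P.c k * P.δ * P.γ k * P.f7 k,
    (M * P.c k ^ 2 * P.δ * P.f7 k + P.c k ^ 2 * P.δ * P.f8 k k
      + (P.c k ^ 2 * P.f2 k + 2 * P.c k * P.γ k + P.c k * P.ν) * P.f4 k) * P.f2 k,
    (P.c k * P.δ * P.γ k + P.c k * P.δ * P.η * P.f1 + P.c k * P.δ * P.ν) * P.f8 k k,
    (P.γ k ^ 2 + P.γ k * P.ν + P.η * (P.γ k + P.c k * P.f2 k) * P.f1) * P.f4 k,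
    P.c k * P.δ ^ 2 * P.η * P.f9 k k,
    2 * P.c k * P.δ * P.η * (P.Υ k)ᴴ.trace.re *
      (star (P.hbar k) ⬝ᵥ (P.Φᴴ * P.Hbarᴴ * P.Υ k * P.Hbar * P.Φ * P.Remi * P.Φᴴ * P.Rris
        * P.Φ) *ᵥ P.hbar k).re,
    P.δ * P.η * (P.γ k + P.c k * P.f2 k) * P.f3 k,
    P.c k * P.η * P.f5 k * P.f6 k]

/-- Closed form of the leakage term. -/
noncomputable def leakCF (k : Fin K) : ℝ := ∑ w, P.leakParts k w

/-- Closed form of the signal-to-interference-plus-noise ratio. -/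
noncomputable def sinrCF (k : Fin K) : ℝ :=
  P.p * P.signalCF k /
    (P.p * P.leakCF k + P.p * ∑ i ∈ Finset.univ.erase k, P.interferenceCF k i
      + P.σe ^ 2 * P.emiCF k + P.σ ^ 2 * P.noiseCF k)

end Params

end RIS

namespace RIS

/-! ## Random variables with moments of all orders -/

section AllMoments

variable {Ω : Type*} [MeasurableSpace Ω] {μ : Measure Ω}

/-! Stack the scattered RIS-BS channel and all direct channels into one matrix Z = [H̃₂, d̃_1, …,
d̃_K] with independent CN(0, 1) entries, and let ξ consist of the entries of Ṽ s_k and of N s_k.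
Every channel is then a + Z b with deterministic a, b (`chanRIS_eq`, `chan_eq`). Orthonormality of
the pilots turns the observation for user k into ∑ ξ_l (A_l + Z B_l), where the weight ξ_l = 1 is
allowed and ξ is centred, uncorrelated and independent of Z (`obs_eq`). The rows of Z are
independent and identically distributed, so Cov(q, y) is a scalar matrix, the LMMSE gain is exactly
Υ_k, and the estimate is again of the form ∑ ξ_l (A_l + Υ_k Z B_l) (`chanEst_eq`).

All terms of the SINR therefore reduce to first and second moments of forms (a + Z b)ᴴ q̂_k. For the
combiner output, a and b are those of the channel of user i; for an entry of the estimate they are a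
unit vector and 0; for the EMI they run over the columns of H_{c,2} Φ R_emi^{1/2}. Such a form is a
combination of the polynomials 1, z_p, conj z_p, conj z_p z_q - δ_pq, each multiplied by a weight
ξ_l. These products are orthogonal (`integral_hermite_mul_star`,
`GaussianWithNoise.integral_hermite_mul_withOne`), so by Parseval the second moment is a sum of four
squared norms for each l (`GaussianWithNoise.integral_norm_sq_form`). Summed over l it is
`Params.formMoment`, and one formula serves leakage, interference, EMI and noise.

What is left is linear algebra. The square roots of the correlation matrices enter only through Gram
matrices, H̄₂ has rank one, and Υ_k times the observation covariance is a scalar matrix. The last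
fact (`obsScalar_mul_frob`) is the orthogonality principle of LMMSE estimation: it gives E[q̂ᴴ q] =
E‖q̂‖², hence the signal term as the square of the noise term. -/

/-- All absolute moments of finite order are finite. -/
def AllMoments (μ : Measure Ω) (f : Ω → ℂ) : Prop :=
  ∀ p : ENNReal, p ≠ ⊤ → MemLp f p μ

lemma AllMoments.const [IsFiniteMeasure μ] (c : ℂ) : AllMoments μ fun _ => c :=
  fun _ _ => memLp_const c

lemma AllMoments.add {f g : Ω → ℂ} (hf : AllMoments μ f) (hg : AllMoments μ g) :
    AllMoments μ fun ω => f ω + g ω :=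
  fun p hp => (hf p hp).add (hg p hp)

lemma AllMoments.sub {f g : Ω → ℂ} (hf : AllMoments μ f) (hg : AllMoments μ g) :
    AllMoments μ fun ω => f ω - g ω :=
  fun p hp => (hf p hp).sub (hg p hp)

lemma AllMoments.star {f : Ω → ℂ} (hf : AllMoments μ f) : AllMoments μ fun ω => star (f ω) :=
  fun p hp => (hf p hp).star

/-- Hölder with exponents 2p, 2p. Closure under products makes the class an algebra, so every
polynomial in the Gaussian entries is integrable without counting degrees. -/
lemma AllMoments.mul {f g : Ω → ℂ} (hf : AllMoments μ f) (hg : AllMoments μ g) :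
    AllMoments μ fun ω => f ω * g ω := by
  intro p hp
  have : ENNReal.HolderTriple (2 * p) (2 * p) p := ⟨by
    rw [ENNReal.mul_inv (by simp) (by simp), ← add_mul, ENNReal.inv_two_add_inv_two, one_mul]⟩
  exact (hg (2 * p) (by finiteness)).mul (hf (2 * p) (by finiteness))

lemma AllMoments.const_mul [IsFiniteMeasure μ] {f : Ω → ℂ} (c : ℂ) (hf : AllMoments μ f) :
    AllMoments μ fun ω => c * f ω :=
  (AllMoments.const c).mul hf

lemma AllMoments.sum {ι : Type*} {s : Finset ι} {f : ι → Ω → ℂ}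
    (hf : ∀ i ∈ s, AllMoments μ (f i)) : AllMoments μ fun ω => ∑ i ∈ s, f i ω :=
  fun p hp => memLp_finsetSum s fun i hi => hf i hi p hp

lemma AllMoments.integrable {f : Ω → ℂ} (hf : AllMoments μ f) : Integrable f μ :=
  memLp_one_iff_integrable.1 (hf 1 (by simp))

lemma AllMoments.integrable_norm_sq {f : Ω → ℂ} (hf : AllMoments μ f) :
    Integrable (fun ω => ‖f ω‖ ^ 2) μ :=
  (hf 2 (by simp)).integrable_norm_pow (by simp)

end AllMoments

/-! ## Moments of Gaussian variables -/

lemma integrable_pow_gaussianReal (v : ℝ≥0) (n : ℕ) :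
    Integrable (fun x : ℝ => x ^ n) (gaussianReal 0 v) := by
  rcases Nat.eq_zero_or_pos n with rfl | hn
  · simp
  · have := (memLp_id_gaussianReal' (μ := 0) (v := v) n (by simp)).integrable_norm_pow hn.ne'
    refine this.mono' (by fun_prop) (Filter.Eventually.of_forall fun x => by simp)

lemma integral_sq_gaussianReal (v : ℝ≥0) : ∫ x, x ^ 2 ∂gaussianReal 0 v = v := by
  rw [← variance_fun_id_gaussianReal (μ := 0) (v := v), variance_of_integral_eq_zero] <;>
  first
  | fun_prop
  | simp

lemma integrable_pow_mul_pow_gaussianReal (v : ℝ≥0) (a b : ℕ) :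
    Integrable (fun z : ℝ × ℝ => z.1 ^ a * z.2 ^ b) ((gaussianReal 0 v).prod (gaussianReal 0 v)) :=
  (integrable_pow_gaussianReal v a).mul_prod (integrable_pow_gaussianReal v b)

lemma integral_pow_mul_pow_gaussianReal (v : ℝ≥0) (a b : ℕ) :
    ∫ z : ℝ × ℝ, z.1 ^ a * z.2 ^ b ∂(gaussianReal 0 v).prod (gaussianReal 0 v) =
      (∫ x, x ^ a ∂gaussianReal 0 v) * ∫ x, x ^ b ∂gaussianReal 0 v :=
  integral_prod_mul (fun x : ℝ => x ^ a) (fun x : ℝ => x ^ b)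

/-- The law N(0, 2v) is computed in two ways. As the law of √2 X it has fourth moment 4m; as the law
of X + Y with independent X, Y it has fourth moment 2m + 6v². Hence m = 3v². -/
lemma integral_pow_four_gaussianReal (v : ℝ≥0) :
    ∫ x, x ^ 4 ∂gaussianReal 0 v = 3 * (v : ℝ) ^ 2 := by
  set m := ∫ x, x ^ 4 ∂gaussianReal 0 v with hm
  have h1 : ∫ x, x ^ 4 ∂gaussianReal 0 (v + v) = 4 * m := by
    have : gaussianReal 0 (v + v) = (gaussianReal 0 v).map (√2 * ·) := by
      rw [gaussianReal_map_const_mul]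
      congr 1
      · simp
      · ext; simp; ring
    rw [this, integral_map (by fun_prop) (by fun_prop), hm, ← integral_const_mul]
    congr 1; ext x
    rw [mul_pow, show √2 ^ 4 = (√2 ^ 2) ^ 2 by ring, Real.sq_sqrt (by norm_num)]; norm_num
  have hpp := integrable_pow_mul_pow_gaussianReal v
  have h2 : ∫ x, x ^ 4 ∂gaussianReal 0 (v + v) = 2 * m + 6 * (v : ℝ) ^ 2 := by
    have : gaussianReal 0 (v + v) = (gaussianReal 0 v) ∗ (gaussianReal 0 v) := by
      rw [gaussianReal_conv_gaussianReal]; simp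
    rw [this, Measure.conv, integral_map (by fun_prop) (by fun_prop)]
    have : ∀ z : ℝ × ℝ, (z.1 + z.2) ^ 4 = z.1 ^ 4 * z.2 ^ 0 + 4 * (z.1 ^ 3 * z.2 ^ 1) +
        6 * (z.1 ^ 2 * z.2 ^ 2) + 4 * (z.1 ^ 1 * z.2 ^ 3) + z.1 ^ 0 * z.2 ^ 4 := by
      intro z; ring
    simp_rw [this]
    rw [integral_add, integral_add, integral_add, integral_add]
    · simp only [integral_const_mul, integral_pow_mul_pow_gaussianReal,
        integral_sq_gaussianReal, ← hm]
      simp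
      ring
    all_goals
      first
      | exact hpp _ _
      | exact (hpp _ _).const_mul _
      | skip
    · exact (hpp _ _).add ((hpp _ _).const_mul _)
    · exact ((hpp _ _).add ((hpp _ _).const_mul _)).add ((hpp _ _).const_mul _)
    · exact (((hpp _ _).add ((hpp _ _).const_mul _)).add ((hpp _ _).const_mul _)).add
        ((hpp _ _).const_mul _)
  linarith

lemma integral_complexGaussian (v : ℝ≥0) {f : ℂ → ℝ} (hf : Continuous f) :
    ∫ z, f z ∂complexGaussian v = ∫ p : ℝ × ℝ, f (p.1 + p.2 * Complex.I)
      ∂((gaussianReal 0 (v / 2)).prod (gaussianReal 0 (v / 2))) := by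
  rw [complexGaussian, integral_map (by fun_prop)]
  exact hf.aestronglyMeasurable

instance (v : ℝ≥0) : IsProbabilityMeasure (complexGaussian v) := by
  unfold complexGaussian
  exact Measure.isProbabilityMeasure_map (by fun_prop)

/-- Multiplication by i is (x, y) ↦ (-y, x), a swap followed by a reflection, and both preserve the
product of two equal centred Gaussians. This quarter turn is all the circular symmetry that is
needed. -/
lemma complexGaussian_map_I_mul (v : ℝ≥0) :
    (complexGaussian v).map (Complex.I * ·) = complexGaussian v := by
  set g := gaussianReal 0 (v / 2) with hg
  have h1 : (g.prod g).map (fun p : ℝ × ℝ => (-p.2, p.1)) = g.prod g := by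
    have : (fun p : ℝ × ℝ => (-p.2, p.1)) = (Prod.map (fun x => -x) id) ∘ Prod.swap := rfl
    rw [this, ← Measure.map_map (by fun_prop) (by fun_prop), Measure.prod_swap,
      ← Measure.map_prod_map _ _ (by fun_prop) (by fun_prop), hg, gaussianReal_map_neg]
    simp
  rw [complexGaussian, ← hg, Measure.map_map (by fun_prop) (by fun_prop)]
  conv_rhs => rw [← h1]
  rw [Measure.map_map (by fun_prop) (by fun_prop)]
  congr 1
  ext p
  simp [mul_add]
  ring_nf
  simp
  ring

/-- The quarter turn multiplies the integral by i^(j-k), which differs from 1 because 0 < |j - k| ≤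
2. This is where the degree bound 2 is used. -/
lemma integral_pow_mul_star_pow_complexGaussian_of_ne (v : ℝ≥0) {j k : ℕ} (hj : j ≤ 2) (hk : k ≤ 2)
    (h : j ≠ k) : ∫ z, z ^ j * star z ^ k ∂complexGaussian v = 0 := by
  have h1 : ∫ z, z ^ j * star z ^ k ∂complexGaussian v =
      (Complex.I ^ j * (-Complex.I) ^ k) * ∫ z, z ^ j * star z ^ k ∂complexGaussian v := by
    conv_lhs => rw [← complexGaussian_map_I_mul]
    rw [integral_map (by fun_prop) (by fun_prop), ← integral_const_mul]
    congr 1; ext z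
    simp [mul_pow]
    ring
  have h2 : Complex.I ^ j * (-Complex.I) ^ k ≠ 1 := by
    interval_cases j <;> interval_cases k <;> simp [Complex.ext_iff] at h ⊢ <;> norm_num
  have h3 : (1 - Complex.I ^ j * (-Complex.I) ^ k) *
      ∫ z, z ^ j * star z ^ k ∂complexGaussian v = 0 := by
    rw [sub_mul, one_mul]; exact sub_eq_zero.2 h1
  exact (mul_eq_zero.1 h3).resolve_left (sub_ne_zero.2 h2.symm)

lemma integral_norm_sq_complexGaussian (v : ℝ≥0) : ∫ z, ‖z‖ ^ 2 ∂complexGaussian v = v := by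
  have hpp := integrable_pow_mul_pow_gaussianReal (v / 2)
  rw [integral_complexGaussian v (by fun_prop)]
  have : ∀ p : ℝ × ℝ, ‖(p.1 + p.2 * Complex.I : ℂ)‖ ^ 2 = p.1 ^ 2 * p.2 ^ 0 + p.1 ^ 0 * p.2 ^ 2 := by
    intro p; simp [← Complex.normSq_eq_norm_sq, Complex.normSq_add_mul_I]
  simp_rw [this]
  rw [integral_add (hpp _ _) (hpp _ _)]
  simp only [integral_pow_mul_pow_gaussianReal, integral_sq_gaussianReal]
  simp

lemma integral_norm_pow_four_complexGaussian (v : ℝ≥0) :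
    ∫ z, ‖z‖ ^ 4 ∂complexGaussian v = 2 * (v : ℝ) ^ 2 := by
  have hpp := integrable_pow_mul_pow_gaussianReal (v / 2)
  rw [integral_complexGaussian v (by fun_prop)]
  have : ∀ p : ℝ × ℝ, ‖(p.1 + p.2 * Complex.I : ℂ)‖ ^ 4 =
      p.1 ^ 4 * p.2 ^ 0 + 2 * (p.1 ^ 2 * p.2 ^ 2) + p.1 ^ 0 * p.2 ^ 4 := by
    intro p
    rw [show ‖(p.1 + p.2 * Complex.I : ℂ)‖ ^ 4 = (‖(p.1 + p.2 * Complex.I : ℂ)‖ ^ 2) ^ 2 by ring]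
    simp only [← Complex.normSq_eq_norm_sq, Complex.normSq_add_mul_I]
    ring
  simp_rw [this]
  rw [integral_add (by exact (hpp _ _).add ((hpp _ _).const_mul _)) (hpp _ _),
    integral_add (hpp _ _) ((hpp _ _).const_mul _)]
  simp only [integral_const_mul, integral_pow_mul_pow_gaussianReal,
    integral_sq_gaussianReal, integral_pow_four_gaussianReal]
  simp
  ring

lemma allMoments_id_complexGaussian (v : ℝ≥0) : AllMoments (complexGaussian v) fun z => z := by
  intro p hp
  have h := memLp_id_gaussianReal' (μ := 0) (v := v / 2) p hp
  rw [complexGaussian, memLp_map_measure_iff (by fun_prop) (by fun_prop)]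
  have h1 : MemLp (fun q : ℝ × ℝ => (q.1 : ℂ)) p
      ((gaussianReal 0 (v / 2)).prod (gaussianReal 0 (v / 2))) :=
    (h.comp_fst _).ofReal
  have h2 : MemLp (fun q : ℝ × ℝ => (q.2 : ℂ)) p
      ((gaussianReal 0 (v / 2)).prod (gaussianReal 0 (v / 2))) :=
    (h.comp_snd _).ofReal
  exact h1.add (h2.mul_const Complex.I)

/-- Mixed moments of a complex Gaussian variable up to order two in the variable and in its
conjugate. -/
noncomputable def gaussianMoment (v : ℝ) (j k : ℕ) : ℂ :=
  if j = k then (j.factorial : ℂ) * (v : ℂ) ^ j else 0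

lemma integral_pow_mul_star_pow_complexGaussian (v : ℝ≥0) {j k : ℕ} (hj : j ≤ 2) (hk : k ≤ 2) :
    ∫ z, z ^ j * star z ^ k ∂complexGaussian v = gaussianMoment v j k := by
  unfold gaussianMoment
  split_ifs with h
  · subst h
    have h1 : ∀ z : ℂ, z ^ j * star z ^ j = ((‖z‖ ^ (2 * j) : ℝ) : ℂ) := by
      intro z
      rw [← mul_pow, Complex.star_def, Complex.mul_conj, Complex.normSq_eq_norm_sq, pow_mul]
      simp
    simp_rw [h1]
    rw [integral_complex_ofReal]
    interval_cases j
    · simp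
    · simp [integral_norm_sq_complexGaussian]
    · simp [integral_norm_pow_four_complexGaussian]
  · exact integral_pow_mul_star_pow_complexGaussian_of_ne v hj hk h

/-! ## Independent standard complex Gaussian variables -/

section Hermite

variable {ι : Type*} [DecidableEq ι]

/-- The Hermite-type polynomials `1`, `z_p`, `conj z_p`, `conj z_p * z_q - δ_pq`, which are
orthonormal in `L²` for independent standard complex Gaussian `z`. -/
def hermite : Unit ⊕ ι ⊕ ι ⊕ ι × ι → (ι → ℂ) → ℂ
  | .inl _ => fun _ => 1
  | .inr (.inl p) => fun z => z p
  | .inr (.inr (.inl p)) => fun z => star (z p)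
  | .inr (.inr (.inr (p, q))) => fun z => star (z p) * z q - if p = q then 1 else 0

lemma continuous_hermite (a : Unit ⊕ ι ⊕ ι ⊕ ι × ι) : Continuous (hermite a) := by
  rcases a with a | a | a | ⟨p, q⟩ <;> simp only [hermite] <;> fun_prop

lemma allMoments_hermite {Ω : Type*} [MeasurableSpace Ω] {μ : Measure Ω} [IsProbabilityMeasure μ]
    {z : ι → Ω → ℂ} (hz : ∀ i, AllMoments μ (z i)) (a : Unit ⊕ ι ⊕ ι ⊕ ι × ι) :
    AllMoments μ fun ω => hermite a fun i => z i ω := by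
  rcases a with a | a | a | ⟨p, q⟩ <;> simp only [hermite]
  · exact AllMoments.const 1
  · exact hz a
  · exact (hz a).star
  · exact ((hz p).star.mul (hz q)).sub (AllMoments.const _)

end Hermite

/-! ### Joint moments of independent complex Gaussians and orthonormality of the polynomials. -/

section Family

variable {Ω ι : Type*} [MeasurableSpace Ω] {μ : Measure Ω}

lemma allMoments_of_hasLaw {f : Ω → ℂ} {v : ℝ≥0} (h : HasLaw f (complexGaussian v) μ) :
    AllMoments μ f := by
  intro p hp
  have h1 := allMoments_id_complexGaussian v p hp
  rw [← h.map_eq] at h1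
  exact (memLp_map_measure_iff h1.aestronglyMeasurable h.aemeasurable).1 h1

lemma integral_pow_mul_star_pow_of_hasLaw {f : Ω → ℂ} {v : ℝ≥0}
    (h : HasLaw f (complexGaussian v) μ) {j k : ℕ} (hj : j ≤ 2) (hk : k ≤ 2) :
    ∫ ω, f ω ^ j * star (f ω) ^ k ∂μ = gaussianMoment v j k := by
  rw [← integral_pow_mul_star_pow_complexGaussian v hj hk]
  exact h.integral_comp (f := fun z : ℂ => z ^ j * star z ^ k) (by fun_prop)

variable [Fintype ι] {z : ι → Ω → ℂ}

/-- Independence factors the monomial, and one factor with unequal exponents annihilates it. The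
mixed moments below are instances in which the exponents are sums of indicators. -/
lemma integral_prod_pow_mul_star_pow {v : ι → ℝ≥0}
    (hz : ∀ i, HasLaw (z i) (complexGaussian (v i)) μ)
    (hi : iIndepFun z μ) {j k : ι → ℕ} (hj : ∀ i, j i ≤ 2) (hk : ∀ i, k i ≤ 2) :
    ∫ ω, (∏ i, z i ω ^ j i) * ∏ i, star (z i ω) ^ k i ∂μ =
      if ∀ i, j i = k i then ∏ i, ((j i).factorial : ℂ) * ((v i : ℝ) : ℂ) ^ j i else 0 := by
  simp_rw [← Finset.prod_mul_distrib]
  rw [hi.integral_fun_prod_comp (f := fun i x => x ^ j i * star x ^ k i)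
    (fun i => (hz i).aemeasurable) (fun i => by fun_prop)]
  simp_rw [fun i => integral_pow_mul_star_pow_of_hasLaw (hz i) (hj i) (hk i), gaussianMoment]
  rw [Finset.prod_ite_zero]
  simp

variable [DecidableEq ι]

lemma prod_pow_ite_eq (f : ι → ℂ) (p : ι) : ∏ i, f i ^ (if i = p then 1 else 0) = f p := by
  simp [pow_ite]

/-- The Isserlis formula in the complex case: only pairings of a variable with a conjugate
contribute. -/
lemma integral_mul_mul_star_mul_star {v : ι → ℝ≥0}
    (hz : ∀ i, HasLaw (z i) (complexGaussian (v i)) μ) (hi : iIndepFun z μ) (p q r s : ι) :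
    ∫ ω, z p ω * z q ω * (star (z r ω) * star (z s ω)) ∂μ =
      (if p = r ∧ q = s then ((v p : ℝ) : ℂ) * ((v q : ℝ) : ℂ) else 0) +
        if p = s ∧ q = r then ((v p : ℝ) : ℂ) * ((v q : ℝ) : ℂ) else 0 := by
  have h := integral_prod_pow_mul_star_pow hz hi
    (j := fun i => (if i = p then 1 else 0) + if i = q then 1 else 0)
    (k := fun i => (if i = r then 1 else 0) + if i = s then 1 else 0)
    (by intro i; split_ifs <;> simp) (by intro i; split_ifs <;> simp)
  simp only [pow_add, Finset.prod_mul_distrib, prod_pow_ite_eq] at h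
  rw [h]
  -- The exponents agree everywhere exactly when {p, q} = {r, s} as multisets.
  have h1 : (∀ i, ((if i = p then 1 else 0) + if i = q then 1 else 0) =
      (if i = r then 1 else 0) + if i = s then 1 else 0) ↔ (p = r ∧ q = s) ∨ (p = s ∧ q = r) := by
    constructor
    · intro H
      have := H p; have := H q
      grind
    · rintro (⟨rfl, rfl⟩ | ⟨rfl, rfl⟩) i
      · rfl
      · rw [add_comm]
  rw [if_congr h1 rfl rfl]
  -- The factor 2! at p = q accounts for the case in which both pairings are present at once.
  have h2 : ∏ i, ((((if i = p then 1 else 0) + if i = q then 1 else 0 : ℕ).factorial : ℂ)) =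
      if p = q then 2 else 1 := by
    split_ifs with hpq
    · subst hpq
      rw [Finset.prod_eq_single p] <;> simp +contextual
    · refine Finset.prod_eq_one fun i _ => ?_
      split_ifs <;> simp_all
  rw [h2]
  by_cases hpq : p = q
  · subst hpq
    by_cases hr : p = r <;> by_cases hs : p = s <;> simp [hr, hs] <;> grind
  · simp only [hpq, if_false, one_mul]
    by_cases h3 : p = r ∧ q = s
    · have : ¬ (p = s ∧ q = r) := by rintro ⟨rfl, rfl⟩; exact hpq h3.1
      rw [if_pos (Or.inl h3), if_pos h3, if_neg this, add_zero]
    · simp [h3]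

lemma integral_mul_mul_star {v : ι → ℝ≥0}
    (hz : ∀ i, HasLaw (z i) (complexGaussian (v i)) μ) (hi : iIndepFun z μ) (p q r : ι) :
    ∫ ω, z p ω * z q ω * star (z r ω) ∂μ = 0 := by
  have h := integral_prod_pow_mul_star_pow hz hi
    (j := fun i => (if i = p then 1 else 0) + if i = q then 1 else 0)
    (k := fun i => (if i = r then 1 else 0))
    (by intro i; split_ifs <;> simp) (by intro i; split_ifs <;> simp)
  simp only [pow_add, Finset.prod_mul_distrib, prod_pow_ite_eq] at h
  rw [h, if_neg]
  intro H
  have := H p; have := H q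
  grind

lemma integral_mul_of_gaussian {v : ι → ℝ≥0}
    (hz : ∀ i, HasLaw (z i) (complexGaussian (v i)) μ) (hi : iIndepFun z μ) (p q : ι) :
    ∫ ω, z p ω * z q ω ∂μ = 0 := by
  have h := integral_prod_pow_mul_star_pow hz hi
    (j := fun i => (if i = p then 1 else 0) + if i = q then 1 else 0)
    (k := fun i => 0) (by intro i; split_ifs <;> simp) (by simp)
  simp only [pow_add, Finset.prod_mul_distrib, prod_pow_ite_eq, pow_zero, Finset.prod_const_one,
    mul_one] at h
  rw [h, if_neg]
  intro H
  simpa using H p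

lemma integral_mul_star_of_gaussian {v : ι → ℝ≥0}
    (hz : ∀ i, HasLaw (z i) (complexGaussian (v i)) μ) (hi : iIndepFun z μ) (p q : ι) :
    ∫ ω, z p ω * star (z q ω) ∂μ = if p = q then ((v p : ℝ) : ℂ) else 0 := by
  have h := integral_prod_pow_mul_star_pow hz hi
    (j := fun i => if i = p then 1 else 0)
    (k := fun i => if i = q then 1 else 0)
    (by intro i; split_ifs <;> simp) (by intro i; split_ifs <;> simp)
  simp only [Finset.prod_mul_distrib, prod_pow_ite_eq] at h
  rw [h]
  by_cases hpq : p = q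
  · subst hpq
    simp only [implies_true, if_true]
    rw [Finset.prod_eq_one, one_mul]
    intro i _
    split_ifs <;> simp
  · rw [if_neg hpq, if_neg]
    intro H
    have := H p
    simp [hpq] at this

lemma integral_of_gaussian {v : ℝ≥0} {f : Ω → ℂ} (hf : HasLaw f (complexGaussian v) μ) :
    ∫ ω, f ω ∂μ = 0 := by
  simpa [gaussianMoment] using
    integral_pow_mul_star_pow_of_hasLaw hf (j := 1) (k := 0) (by simp) (by simp)

variable [IsProbabilityMeasure μ]

/-- Products with different numbers of variables and conjugates have mean zero. For two quadratic
polynomials the Isserlis formula yields δ_pr δ_qs + δ_pq δ_rs, and the centring by δ_pq removes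
precisely the second term. The polynomials z_p z_q are absent because the forms studied later are
linear in Z and linear in its conjugate. -/
lemma integral_hermite_mul_star
    (hz : ∀ i, HasLaw (z i) (complexGaussian 1) μ) (hi : iIndepFun z μ)
    (a b : Unit ⊕ ι ⊕ ι ⊕ ι × ι) :
    ∫ ω, hermite a (fun i => z i ω) * star (hermite b fun i => z i ω) ∂μ =
      if a = b then 1 else 0 := by
  have hm : ∀ i, AllMoments μ (z i) := fun i => allMoments_of_hasLaw (hz i)
  have e1 := fun p => integral_of_gaussian (hz p)
  have e1' : ∀ p, ∫ ω, star (z p ω) ∂μ = 0 := fun p => by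
    have := integral_conj (μ := μ) (f := z p)
    rw [e1, map_zero] at this; exact this
  have e2 := integral_mul_of_gaussian hz hi
  have e2' : ∀ p q, ∫ ω, star (z p ω) * star (z q ω) ∂μ = 0 := fun p q => by
    have := integral_conj (μ := μ) (f := fun ω => z p ω * z q ω)
    rw [e2, map_zero] at this
    simpa using this
  have e11 := integral_mul_star_of_gaussian hz hi
  have e3 := integral_mul_mul_star hz hi
  have e3' : ∀ p q r, ∫ ω, star (z p ω) * star (z q ω) * z r ω ∂μ = 0 := fun p q r => by
    have := integral_conj (μ := μ) (f := fun ω => z p ω * z q ω * star (z r ω))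
    rw [e3, map_zero] at this
    simpa using this
  have e4 := integral_mul_mul_star_mul_star hz hi
  have i2 : ∀ p q, Integrable (fun ω => star (z p ω) * z q ω) μ :=
    fun p q => ((hm p).star.mul (hm q)).integrable
  have e11' : ∀ p q, ∫ ω, star (z p ω) * z q ω ∂μ = if p = q then 1 else 0 := fun p q => by
    simp_rw [mul_comm (star _), e11, eq_comm (a := q)]; simp
  have i1 : ∀ p, Integrable (z p) μ := fun p => (hm p).integrable
  have i1' : ∀ p, Integrable (fun ω => star (z p ω)) μ := fun p => (hm p).star.integrable
  have i3 : ∀ p q r, Integrable (fun ω => star (z p ω) * z q ω * z r ω) μ :=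
    fun p q r => (((hm p).star.mul (hm q)).mul (hm r)).integrable
  have i3' : ∀ p q r, Integrable (fun ω => star (z p ω) * z q ω * star (z r ω)) μ :=
    fun p q r => (((hm p).star.mul (hm q)).mul (hm r).star).integrable
  have i4 : ∀ p q r s, Integrable (fun ω => star (z p ω) * z q ω * (z r ω * star (z s ω))) μ :=
    fun p q r s => (((hm p).star.mul (hm q)).mul ((hm r).mul (hm s).star)).integrable
  have f3 : ∀ p q r, ∫ ω, star (z p ω) * z q ω * z r ω ∂μ = 0 := fun p q r => by
    rw [← e3 q r p]; congr 1; ext ω; ring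
  have f3' : ∀ p q r, ∫ ω, star (z p ω) * z q ω * star (z r ω) ∂μ = 0 := fun p q r => by
    rw [← e3' p r q]; congr 1; ext ω; ring
  have f4 : ∀ p q r s, ∫ ω, star (z p ω) * z q ω * (z r ω * star (z s ω)) ∂μ =
      (if q = p ∧ r = s then 1 else 0) + if q = s ∧ r = p then 1 else 0 := fun p q r s => by
    have := e4 q r p s
    simp only [NNReal.coe_one, Complex.ofReal_one, mul_one] at this
    rw [← this]; congr 1; ext ω; ring
  -- The quadratic polynomials are tested against everything; Hermitian symmetry (`swap`) then
  -- covers a quadratic polynomial in the second slot.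
  have key : ∀ p q b, ∫ ω, hermite (.inr (.inr (.inr (p, q)))) (fun i => z i ω) *
      star (hermite b fun i => z i ω) ∂μ = if .inr (.inr (.inr (p, q))) = b then 1 else 0 := by
    intro p q b
    rcases b with b | b | b | ⟨r, s⟩
    · simp only [hermite, star_one, mul_one, reduceCtorEq, if_false]
      rw [integral_sub (i2 p q) (integrable_const _), e11', integral_const]
      simp
    · simp only [hermite, reduceCtorEq, if_false, Sum.inr.injEq, sub_mul]
      rw [integral_sub (i3' p q b) ((i1' b).const_mul _), f3', integral_const_mul, e1']
      simp
    · simp only [hermite, reduceCtorEq, if_false, Sum.inr.injEq, sub_mul, star_star]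
      rw [integral_sub (i3 p q b) ((i1 b).const_mul _), f3, integral_const_mul, e1]
      simp
    · have : ∀ ω, hermite (.inr (.inr (.inr (p, q)))) (fun i => z i ω) *
          star (hermite (.inr (.inr (.inr (r, s)))) fun i => z i ω) =
          star (z p ω) * z q ω * (z r ω * star (z s ω))
            - (star (z p ω) * z q ω) * (if r = s then 1 else 0)
            - ((if p = q then 1 else 0) * (z r ω * star (z s ω))
              - (if p = q then 1 else 0) * (if r = s then 1 else 0)) := by
        intro ω
        have h1 : star (if r = s then (1 : ℂ) else 0) = if r = s then 1 else 0 := by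
          split_ifs <;> simp
        simp only [hermite, star_sub, star_mul, star_star, h1]
        ring
      simp_rw [this]
      have j2 : Integrable (fun ω => z r ω * star (z s ω)) μ := ((hm r).mul (hm s).star).integrable
      rw [integral_sub (by exact (i4 p q r s).sub ((i2 p q).mul_const _))
          (by exact (j2.const_mul _).sub (integrable_const _)),
        integral_sub (i4 p q r s) ((i2 p q).mul_const _),
        integral_sub (j2.const_mul _) (integrable_const _), f4, integral_mul_const, e11',
        integral_const_mul, e11, integral_const]
      simp only [NNReal.coe_one, Complex.ofReal_one, Sum.inr.injEq, Prod.mk.injEq, probReal_univ,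
        one_smul]
      by_cases h1 : p = q <;> by_cases h2 : r = s <;> by_cases h3 : p = r <;>
        by_cases h4 : q = s <;> grind
  have swap : ∀ a b, ∫ ω, hermite a (fun i => z i ω) * star (hermite b fun i => z i ω) ∂μ =
      star (∫ ω, hermite b (fun i => z i ω) * star (hermite a fun i => z i ω) ∂μ) := by
    intro a b
    rw [Complex.star_def, ← integral_conj]
    congr 1; ext ω
    simp [mul_comm]
  have key' : ∀ a p q, ∫ ω, hermite a (fun i => z i ω) *
      star (hermite (.inr (.inr (.inr (p, q)))) fun i => z i ω) ∂μ =
      if a = .inr (.inr (.inr (p, q))) then 1 else 0 := by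
    intro a p q
    rw [swap, key, eq_comm]
    split_ifs <;> simp_all
  rcases b with b | b | b | ⟨r, s⟩
  · rcases a with a | a | a | ⟨p, q⟩
    · simp [hermite]
    · simpa [hermite] using e1 a
    · simpa [hermite] using e1' a
    · exact key p q _
  · rcases a with a | a | a | ⟨p, q⟩
    · simpa [hermite] using e1' b
    · simpa [hermite] using e11 a b
    · simpa [hermite] using e2' a b
    · exact key p q _
  · rcases a with a | a | a | ⟨p, q⟩
    · simpa [hermite] using e1 b
    · simpa [hermite] using e2 a b
    · simpa [hermite] using e11' a b
    · exact key p q _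
  · exact key' a r s

end Family

/-! ## Expansions in orthogonal polynomials -/

section Expansion

variable {Ω ι L : Type*} [MeasurableSpace Ω]

/-- `z` consists of independent standard complex Gaussian variables, and `ξ` is a centred family
of uncorrelated variables of variance `D`, with all moments, that is independent of `z`. -/
structure GaussianWithNoise (μ : Measure Ω) (z : ι → Ω → ℂ) (ξ : L → Ω → ℂ) (D : L → ℝ)
    [DecidableEq L] : Prop where
  law : ∀ i, HasLaw (z i) (complexGaussian 1) μ
  indep : iIndepFun z μ
  moments : ∀ l, AllMoments μ (ξ l)
  mean : ∀ l, ∫ ω, ξ l ω ∂μ = 0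
  cov : ∀ l l', ∫ ω, ξ l ω * star (ξ l' ω) ∂μ = if l = l' then (D l : ℂ) else 0
  indepFun : IndepFun (fun ω i => z i ω) (fun ω l => ξ l ω) μ

/-- The family `ξ` augmented by the constant `1`. -/
def withOne (x : L → ℂ) : Option L → ℂ
  | none => 1
  | some l => x l

/-- The variances of a noise family, with value `1` for the additional constant. -/
def varWithOne (D : L → ℝ) : Option L → ℝ
  | none => 1
  | some l => D l

lemma measurable_withOne (l : Option L) : Measurable fun x : L → ℂ => withOne x l := by
  cases l <;> simp only [withOne] <;> fun_prop

variable [DecidableEq L] {μ : Measure Ω} [IsProbabilityMeasure μ]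
  {z : ι → Ω → ℂ} {ξ : L → Ω → ℂ} {D : L → ℝ}

lemma GaussianWithNoise.allMoments_withOne (h : GaussianWithNoise μ z ξ D) (l : Option L) :
    AllMoments μ fun ω => withOne (fun l => ξ l ω) l := by
  cases l <;> simp only [withOne]
  · exact AllMoments.const 1
  · exact h.moments _

lemma GaussianWithNoise.integral_withOne_mul_star (h : GaussianWithNoise μ z ξ D)
    (l l' : Option L) :
    ∫ ω, withOne (fun l => ξ l ω) l * star (withOne (fun l => ξ l ω) l') ∂μ =
      if l = l' then (varWithOne D l : ℂ) else 0 := by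
  cases l <;> cases l' <;> simp only [withOne, varWithOne]
  · simp
  · rename_i l
    have := integral_conj (μ := μ) (f := ξ l)
    rw [h.mean, map_zero] at this
    simpa using this
  · simpa using h.mean _
  · simpa using h.cov _ _

variable [DecidableEq ι]

variable [Fintype ι]

/-- Independence of z and ξ splits the expectation into two inner products. Within ξ only second
moments occur, so uncorrelatedness of the noise is enough. -/
lemma GaussianWithNoise.integral_hermite_mul_withOne (h : GaussianWithNoise μ z ξ D)
    (a b : Unit ⊕ ι ⊕ ι ⊕ ι × ι) (l l' : Option L) :
    ∫ ω, (hermite a (fun i => z i ω) * withOne (fun l => ξ l ω) l) *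
        star (hermite b (fun i => z i ω) * withOne (fun l => ξ l ω) l') ∂μ =
      if a = b ∧ l = l' then (varWithOne D l : ℂ) else 0 := by
  have h1 := h.indepFun.comp
    (φ := fun x => hermite a x * star (hermite b x))
    (ψ := fun x => withOne x l * star (withOne x l'))
    ((continuous_hermite a).mul (continuous_hermite b).star).measurable
    ((measurable_withOne l).mul (continuous_star.measurable.comp (measurable_withOne l')))
  have hz := fun i => allMoments_of_hasLaw (h.law i)
  have h2 := h1.integral_fun_mul_eq_mul_integral
    ((allMoments_hermite hz a).mul (allMoments_hermite hz b).star).integrable.aestronglyMeasurable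
    ((h.allMoments_withOne l).mul (h.allMoments_withOne l').star).integrable.aestronglyMeasurable
  simp only [Function.comp_def] at h2
  rw [integral_hermite_mul_star h.law h.indep, h.integral_withOne_mul_star] at h2
  rw [ite_zero_mul, one_mul] at h2
  rw [ite_and, ← h2]
  congr 1; ext ω
  rw [star_mul]; ring

variable [Fintype L]

/-- The random variable with given coefficients with respect to the products of the polynomials
`hermite` in `z` with the noise variables. -/
noncomputable def expansion (z : ι → Ω → ℂ) (ξ : L → Ω → ℂ)
    (c : Unit ⊕ ι ⊕ ι ⊕ ι × ι → Option L → ℂ) (ω : Ω) : ℂ :=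
  ∑ a, ∑ l, c a l * (hermite a (fun i => z i ω) * withOne (fun l => ξ l ω) l)

lemma GaussianWithNoise.allMoments_expansion (h : GaussianWithNoise μ z ξ D)
    (c : Unit ⊕ ι ⊕ ι ⊕ ι × ι → Option L → ℂ) : AllMoments μ (expansion z ξ c) :=
  AllMoments.sum fun a _ => AllMoments.sum fun l _ => AllMoments.const_mul _ <|
    (allMoments_hermite (fun i => allMoments_of_hasLaw (h.law i)) a).mul (h.allMoments_withOne l)

/-- Parseval's identity for the orthogonal system, weighted by the noise variances. -/
lemma GaussianWithNoise.integral_expansion_mul_star (h : GaussianWithNoise μ z ξ D)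
    (c d : Unit ⊕ ι ⊕ ι ⊕ ι × ι → Option L → ℂ) :
    ∫ ω, expansion z ξ c ω * star (expansion z ξ d ω) ∂μ =
      ∑ l, (varWithOne D l : ℂ) * ∑ a, c a l * star (d a l) := by
  have hz := fun i => allMoments_of_hasLaw (h.law i)
  have hm : ∀ a l, AllMoments μ fun ω => hermite a (fun i => z i ω) * withOne (fun l => ξ l ω) l :=
    fun a l => (allMoments_hermite hz a).mul (h.allMoments_withOne l)
  have e : ∀ ω, expansion z ξ c ω * star (expansion z ξ d ω) =
      ∑ p : (_ × Option L), ∑ q : (_ × Option L),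
      (c p.1 p.2 * star (d q.1 q.2)) *
        ((hermite p.1 (fun i => z i ω) * withOne (fun l => ξ l ω) p.2) *
          star (hermite q.1 (fun i => z i ω) * withOne (fun l => ξ l ω) q.2)) := by
    intro ω
    simp only [expansion, ← Fintype.sum_prod_type', star_sum, Finset.sum_mul_sum]
    refine Finset.sum_congr rfl fun p _ => ?_
    simp only [star_mul]
    ring
  simp_rw [e]
  rw [integral_finsetSum _ fun p _ => integrable_finsetSum _ fun q _ =>
    (((hm _ _).mul (hm _ _).star).const_mul _).integrable]
  simp_rw [integral_finsetSum Finset.univ fun (q : _ × Option L) _ =>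
    (((hm _ _).mul (hm q.1 q.2).star).const_mul _).integrable, integral_const_mul,
    h.integral_hermite_mul_withOne, ← Prod.ext_iff]
  simp only [mul_ite, mul_zero, Finset.sum_ite_eq, Finset.mem_univ, if_true]
  rw [Fintype.sum_prod_type_right]
  simp_rw [Finset.mul_sum]
  refine Finset.sum_congr rfl fun p _ => Finset.sum_congr rfl fun q _ => ?_
  ring

/-- The mean is the inner product with the constant 1, which is itself an element of the system. -/
lemma GaussianWithNoise.integral_expansion (h : GaussianWithNoise μ z ξ D)
    (c : Unit ⊕ ι ⊕ ι ⊕ ι × ι → Option L → ℂ) :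
    ∫ ω, expansion z ξ c ω ∂μ = c (.inl ()) none := by
  have := h.integral_expansion_mul_star c
    (fun a l => if a = .inl () then (if l = none then 1 else 0) else 0)
  simpa [expansion, hermite, withOne, varWithOne, Fintype.sum_option] using this

lemma GaussianWithNoise.integral_norm_sq_expansion (h : GaussianWithNoise μ z ξ D)
    (c : Unit ⊕ ι ⊕ ι ⊕ ι × ι → Option L → ℂ) :
    ∫ ω, ‖expansion z ξ c ω‖ ^ 2 ∂μ = ∑ l, varWithOne D l * ∑ a, ‖c a l‖ ^ 2 := by
  have e : ∀ x : ℂ, x * star x = ((‖x‖ ^ 2 : ℝ) : ℂ) := fun x => by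
    rw [Complex.star_def, Complex.mul_conj, Complex.normSq_eq_norm_sq]
  have := h.integral_expansion_mul_star c c
  simp_rw [e] at this
  rw [integral_complex_ofReal] at this
  exact_mod_cast this

end Expansion

/-! ### Moments of affine vectors and sesquilinear forms in a Gaussian matrix. -/

section Forms

variable {Ω L : Type*} {M J : Type*} [Fintype M] [Fintype J] [Fintype L]
  [DecidableEq M] [DecidableEq J]

/-- Sum of the squared absolute values of the entries of a vector. -/
noncomputable def sqNorm {n : Type*} [Fintype n] (v : n → ℂ) : ℝ := ∑ i, ‖v i‖ ^ 2

/-- Sum of the squared absolute values of the entries of a matrix. -/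
noncomputable def frob {m n : Type*} [Fintype m] [Fintype n] (A : Matrix m n ℂ) : ℝ :=
  ∑ i, ∑ j, ‖A i j‖ ^ 2

/-- A family indexed by pairs as a random matrix. -/
def toMat (z : M × J → Ω → ℂ) (ω : Ω) : Matrix M J ℂ := Matrix.of fun m j => z (m, j) ω

/-- The random vector `∑ ξ_l (A_l + X Z B_l)`, where the sum includes a constant `ξ_l = 1`. -/
noncomputable def affine (z : M × J → Ω → ℂ) (ξ : L → Ω → ℂ) (X : Matrix M M ℂ)
    (A : Option L → M → ℂ) (B : Option L → J → ℂ) (ω : Ω) : M → ℂ :=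
  ∑ l, withOne (fun l => ξ l ω) l • (A l + X *ᵥ (toMat z ω *ᵥ B l))

/-- Coefficients of the form `(a + Z b)ᴴ ∑ ξ_l (A_l + X Z B_l)`. -/
noncomputable def formCoeff (a : M → ℂ) (b : J → ℂ) (X : Matrix M M ℂ)
    (A : Option L → M → ℂ) (B : Option L → J → ℂ) :
    Unit ⊕ (M × J) ⊕ (M × J) ⊕ (M × J) × (M × J) → Option L → ℂ
  | .inl _ => fun l => star a ⬝ᵥ A l + X.trace * (star b ⬝ᵥ B l)
  | .inr (.inl (m, j)) => fun l => (star a ᵥ* X) m * B l j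
  | .inr (.inr (.inl (m, j))) => fun l => star (b j) * A l m
  | .inr (.inr (.inr ((m, j), (m', j')))) => fun l => star (b j) * X m m' * B l j'

/-- Multiplying out gives products conj z_p z_q, which have to be centred. The compensation for the
subtracted δ_pq adds up to Tr X · bᴴ B_l and goes into the constant coefficient. -/
lemma form_eq_expansion (z : M × J → Ω → ℂ) (ξ : L → Ω → ℂ) (a : M → ℂ) (b : J → ℂ)
    (X : Matrix M M ℂ) (A : Option L → M → ℂ) (B : Option L → J → ℂ) (ω : Ω) :
    star (a + toMat z ω *ᵥ b) ⬝ᵥ affine z ξ X A B ω = expansion z ξ (formCoeff a b X A B) ω := by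
  have h1 : ∀ l, star a ⬝ᵥ (X *ᵥ (toMat z ω *ᵥ B l)) =
      ∑ p : M × J, (star a ᵥ* X) p.1 * B l p.2 * z p ω := by
    intro l
    rw [dotProduct_mulVec, Fintype.sum_prod_type]
    simp only [dotProduct, mulVec, toMat, Matrix.of_apply, Finset.mul_sum]
    refine Finset.sum_congr rfl fun m _ => Finset.sum_congr rfl fun j _ => by ring
  have h2 : ∀ w : M → ℂ, star (toMat z ω *ᵥ b) ⬝ᵥ w =
      ∑ p : M × J, star (b p.2) * w p.1 * star (z p ω) := by
    intro w
    rw [Fintype.sum_prod_type]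
    simp only [dotProduct, mulVec, toMat, Matrix.of_apply, Pi.star_apply, star_sum, star_mul,
      Finset.sum_mul]
    refine Finset.sum_congr rfl fun m _ => Finset.sum_congr rfl fun j _ => by ring
  have h3 : ∀ l, star (toMat z ω *ᵥ b) ⬝ᵥ (X *ᵥ (toMat z ω *ᵥ B l)) =
      ∑ p : M × J, ∑ q : M × J, star (b p.2) * X p.1 q.1 * B l q.2 * (star (z p ω) * z q ω) := by
    intro l
    rw [h2]
    refine Finset.sum_congr rfl fun p _ => ?_
    rw [Fintype.sum_prod_type]
    simp only [mulVec, dotProduct, toMat, Matrix.of_apply, Finset.mul_sum, Finset.sum_mul]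
    refine Finset.sum_congr rfl fun m _ => Finset.sum_congr rfl fun j _ => by ring
  -- The trace term as a double sum against δ_pq, so that it cancels the centring in `h5`.
  have h4 : ∀ l, X.trace * (star b ⬝ᵥ B l) =
      ∑ p : M × J, ∑ q : M × J, star (b p.2) * X p.1 q.1 * B l q.2 * (if p = q then 1 else 0) := by
    intro l
    simp only [mul_ite, mul_one, mul_zero, Finset.sum_ite_eq, Finset.mem_univ, if_true,
      Fintype.sum_prod_type, trace, dotProduct, Finset.sum_mul_sum, Matrix.diag, Pi.star_apply]
    refine Finset.sum_congr rfl fun m _ => Finset.sum_congr rfl fun j _ => by ring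
  unfold expansion
  rw [Finset.sum_comm]
  simp only [affine, dotProduct_sum]
  refine Finset.sum_congr rfl fun l _ => ?_
  rw [dotProduct_smul, star_add, dotProduct_add, add_dotProduct, add_dotProduct, h1, h2, h3]
  have h5 : ∑ p : M × J, ∑ q : M × J, formCoeff a b X A B (.inr (.inr (.inr (p, q)))) l *
        (hermite (.inr (.inr (.inr (p, q)))) (fun i => z i ω) * withOne (fun l => ξ l ω) l) =
      withOne (fun l => ξ l ω) l * ((∑ p : M × J, ∑ q : M × J,
        star (b p.2) * X p.1 q.1 * B l q.2 * (star (z p ω) * z q ω)) -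
        ∑ p : M × J, ∑ q : M × J, star (b p.2) * X p.1 q.1 * B l q.2 * (if p = q then 1 else 0)) := by
    simp only [← Finset.sum_sub_distrib, Finset.mul_sum]
    refine Finset.sum_congr rfl fun p _ => Finset.sum_congr rfl fun q _ => ?_
    simp only [formCoeff, hermite]
    ring
  have h6 : ∑ p : M × J, formCoeff a b X A B (.inr (.inl p)) l *
        (hermite (.inr (.inl p)) (fun i => z i ω) * withOne (fun l => ξ l ω) l) =
      withOne (fun l => ξ l ω) l * ∑ p : M × J, (star a ᵥ* X) p.1 * B l p.2 * z p ω := by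
    rw [Finset.mul_sum]
    refine Finset.sum_congr rfl fun p _ => ?_
    simp only [formCoeff, hermite]
    ring
  have h7 : ∑ p : M × J, formCoeff a b X A B (.inr (.inr (.inl p))) l *
        (hermite (.inr (.inr (.inl p))) (fun i => z i ω) * withOne (fun l => ξ l ω) l) =
      withOne (fun l => ξ l ω) l * ∑ p : M × J, star (b p.2) * A l p.1 * star (z p ω) := by
    rw [Finset.mul_sum]
    refine Finset.sum_congr rfl fun p _ => ?_
    simp only [formCoeff, hermite]
    ring
  have h8 : ∑ u : Unit, formCoeff a b X A B (.inl u) l *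
        (hermite (.inl u) (fun i => z i ω) * withOne (fun l => ξ l ω) l) =
      withOne (fun l => ξ l ω) l * (star a ⬝ᵥ A l + X.trace * (star b ⬝ᵥ B l)) := by
    simp only [formCoeff, hermite, Finset.univ_unique, Finset.sum_singleton]
    ring
  rw [Fintype.sum_sum_type, Fintype.sum_sum_type, Fintype.sum_sum_type, h6, h7, h8,
    Fintype.sum_prod_type (f := fun x : (M × J) × (M × J) => _), h5, ← h4]
  simp only [smul_eq_mul]
  ring

/-- Coefficients of an entry of the random vector `affine z ξ 1 A B`. -/
noncomputable def entryCoeff (m : M) (A : Option L → M → ℂ) (B : Option L → J → ℂ) :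
    Unit ⊕ (M × J) ⊕ (M × J) ⊕ (M × J) × (M × J) → Option L → ℂ
  | .inl _ => fun l => A l m
  | .inr (.inl (m', j)) => fun l => if m' = m then B l j else 0
  | .inr (.inr _) => fun _ => 0

lemma affine_apply_eq_expansion (z : M × J → Ω → ℂ) (ξ : L → Ω → ℂ)
    (A : Option L → M → ℂ) (B : Option L → J → ℂ) (m : M) (ω : Ω) :
    affine z ξ 1 A B ω m = expansion z ξ (entryCoeff m A B) ω := by
  unfold expansion
  rw [Finset.sum_comm]
  simp only [affine, Finset.sum_apply]
  refine Finset.sum_congr rfl fun l _ => ?_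
  simp only [Fintype.sum_sum_type, Fintype.sum_prod_type, entryCoeff, hermite, zero_mul,
    Finset.sum_const_zero, add_zero, ite_mul, Pi.smul_apply, Pi.add_apply, one_mulVec, mulVec,
    dotProduct, toMat, Matrix.of_apply, Finset.univ_unique, Finset.sum_singleton, smul_eq_mul]
  rw [Finset.sum_comm]
  simp only [Finset.sum_ite_eq', Finset.mem_univ, if_true, mul_add, Finset.mul_sum, one_mul]
  congr 1
  · ring
  · refine Finset.sum_congr rfl fun j _ => by ring

variable [MeasurableSpace Ω] [DecidableEq L]
  {μ : Measure Ω} [IsProbabilityMeasure μ] {z : M × J → Ω → ℂ} {ξ : L → Ω → ℂ} {D : L → ℝ}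

lemma GaussianWithNoise.allMoments_form (h : GaussianWithNoise μ z ξ D) (a : M → ℂ) (b : J → ℂ)
    (X : Matrix M M ℂ) (A : Option L → M → ℂ) (B : Option L → J → ℂ) :
    AllMoments μ fun ω => star (a + toMat z ω *ᵥ b) ⬝ᵥ affine z ξ X A B ω := by
  simp_rw [form_eq_expansion]
  exact h.allMoments_expansion _

lemma GaussianWithNoise.integral_form (h : GaussianWithNoise μ z ξ D) (a : M → ℂ) (b : J → ℂ)
    (X : Matrix M M ℂ) (A : Option L → M → ℂ) (B : Option L → J → ℂ) :
    ∫ ω, star (a + toMat z ω *ᵥ b) ⬝ᵥ affine z ξ X A B ω ∂μ =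
      star a ⬝ᵥ A none + X.trace * (star b ⬝ᵥ B none) := by
  simp_rw [form_eq_expansion]
  exact h.integral_expansion _

/-- The central computation. For each l the four summands are the squared coefficient norms along 1,
z, conj z and the centred products; the last three factor because the coefficients are rank-one
tensors or tensor products with X. -/
lemma GaussianWithNoise.integral_norm_sq_form (h : GaussianWithNoise μ z ξ D)
    (a : M → ℂ) (b : J → ℂ)
    (X : Matrix M M ℂ) (A : Option L → M → ℂ) (B : Option L → J → ℂ) :
    ∫ ω, ‖star (a + toMat z ω *ᵥ b) ⬝ᵥ affine z ξ X A B ω‖ ^ 2 ∂μ =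
      ∑ l, varWithOne D l * (‖star a ⬝ᵥ A l + X.trace * (star b ⬝ᵥ B l)‖ ^ 2
        + sqNorm (star a ᵥ* X) * sqNorm (B l) + sqNorm b * sqNorm (A l)
        + sqNorm b * frob X * sqNorm (B l)) := by
  simp_rw [form_eq_expansion]
  rw [h.integral_norm_sq_expansion]
  refine Finset.sum_congr rfl fun l _ => ?_
  congr 1
  simp only [Fintype.sum_sum_type, Fintype.sum_prod_type, formCoeff, norm_mul, mul_pow, norm_star,
    Finset.univ_unique, Finset.sum_singleton]
  simp only [← Finset.mul_sum, ← Finset.sum_mul, sqNorm, frob]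
  ring

lemma GaussianWithNoise.integral_affine_apply (h : GaussianWithNoise μ z ξ D)
    (A : Option L → M → ℂ) (B : Option L → J → ℂ) (m : M) :
    ∫ ω, affine z ξ 1 A B ω m ∂μ = A none m := by
  simp_rw [affine_apply_eq_expansion]
  exact h.integral_expansion _

/-- Different rows of Z are uncorrelated, so the random part contributes only for m = m', and
equally in every row. -/
lemma GaussianWithNoise.integral_affine_apply_mul_star (h : GaussianWithNoise μ z ξ D)
    (A A' : Option L → M → ℂ) (B B' : Option L → J → ℂ) (m m' : M) :
    ∫ ω, affine z ξ 1 A B ω m * star (affine z ξ 1 A' B' ω m') ∂μ =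
      ∑ l, (varWithOne D l : ℂ) *
        (A l m * star (A' l m') + if m = m' then B l ⬝ᵥ star (B' l) else 0) := by
  simp_rw [affine_apply_eq_expansion]
  rw [h.integral_expansion_mul_star]
  refine Finset.sum_congr rfl fun l _ => ?_
  congr 1
  simp only [Fintype.sum_sum_type, Fintype.sum_prod_type, entryCoeff, zero_mul,
    Finset.sum_const_zero, add_zero, Finset.univ_unique, Finset.sum_singleton]
  congr 1
  rw [Finset.sum_comm]
  simp only [ite_mul, zero_mul, Finset.sum_ite_eq', Finset.mem_univ, if_true]
  split_ifs
  · rfl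
  · simp

end Forms
/-! ## The system model in standard form -/

section Model

variable {M N K τ : ℕ} {Ω : Type*}

/-- Position of an entry of `[H̃₂, d̃_1, …, d̃_K]` in the family of all entries. -/
def gainIndex : Fin M × (Fin N ⊕ Fin K) →
    (Fin M × Fin N) ⊕ (Fin K × Fin M) ⊕ (Fin N × Fin τ) ⊕ (Fin M × Fin τ)
  | (m, .inl n) => .inl (m, n)
  | (m, .inr k) => .inr (.inl (k, m))

/-- Position of an entry of `Ṽ` or of the thermal noise in the family of all entries. -/
def noiseIndex : Fin N ⊕ Fin M → Fin τ →
    (Fin M × Fin N) ⊕ (Fin K × Fin M) ⊕ (Fin N × Fin τ) ⊕ (Fin M × Fin τ)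
  | .inl n => fun t => .inr (.inr (.inl (n, t)))
  | .inr m => fun t => .inr (.inr (.inr (m, t)))

lemma gainIndex_injective :
    Function.Injective (gainIndex : Fin M × (Fin N ⊕ Fin K) →
      (Fin M × Fin N) ⊕ (Fin K × Fin M) ⊕ (Fin N × Fin τ) ⊕ (Fin M × Fin τ)) := by
  rintro ⟨m, n | k⟩ ⟨m', n' | k'⟩ h <;> simp_all [gainIndex]

lemma noiseIndex_eq_iff (l l' : Fin N ⊕ Fin M) (t t' : Fin τ) :
    (noiseIndex l t : (Fin M × Fin N) ⊕ (Fin K × Fin M) ⊕ (Fin N × Fin τ) ⊕ (Fin M × Fin τ)) =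
      noiseIndex l' t' ↔ l = l' ∧ t = t' := by
  rcases l with l | l <;> rcases l' with l' | l' <;> simp [noiseIndex]

lemma gainIndex_ne_noiseIndex (i : Fin M × (Fin N ⊕ Fin K)) (l : Fin N ⊕ Fin M) (t : Fin τ) :
    gainIndex i ≠ noiseIndex l t := by
  rcases i with ⟨m, n | k⟩ <;> rcases l with l | l <;> simp [gainIndex, noiseIndex]

/-- The entries of `[H̃₂, d̃_1, …, d̃_K]`. -/
def Inputs.gain (X : Inputs Ω M N K τ) (i : Fin M × (Fin N ⊕ Fin K)) : Ω → ℂ :=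
  X.entry (gainIndex i)

/-- The entries of `Ṽ s` and of the thermal noise matrix times `s`. -/
def Inputs.despread (X : Inputs Ω M N K τ) (s : Fin τ → ℂ) (l : Fin N ⊕ Fin M) (ω : Ω) : ℂ :=
  ∑ t, s t * X.entry (noiseIndex l t) ω

/-- The variances of the entries of `Ṽ s` and of the thermal noise for a unit vector `s`. -/
def Params.despreadVar (P : Params M N K τ) : Fin N ⊕ Fin M → ℝ
  | .inl _ => P.σe ^ 2
  | .inr _ => P.σ ^ 2

/-- The variances of all entries. -/
noncomputable def Params.entryVar (P : Params M N K τ) :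
    (Fin M × Fin N) ⊕ (Fin K × Fin M) ⊕ (Fin N × Fin τ) ⊕ (Fin M × Fin τ) → ℝ≥0
  | .inl _ => 1
  | .inr (.inl _) => 1
  | .inr (.inr (.inl _)) => (P.σe ^ 2).toNNReal
  | .inr (.inr (.inr _)) => (P.σ ^ 2).toNNReal

variable [MeasurableSpace Ω] {μ : Measure Ω} {P : Params M N K τ} {X : Inputs Ω M N K τ}

lemma IsModel.hasLaw_entry (hX : IsModel μ P X)
    (i : (Fin M × Fin N) ⊕ (Fin K × Fin M) ⊕ (Fin N × Fin τ) ⊕ (Fin M × Fin τ)) :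
    HasLaw (X.entry i) (complexGaussian (P.entryVar i)) μ := by
  rcases i with ⟨m, n⟩ | ⟨k, m⟩ | ⟨n, t⟩ | ⟨m, t⟩
  · exact hX.law_Ht m n
  · exact hX.law_dt k m
  · exact hX.law_Vt n t
  · exact hX.law_Nz m t

lemma Params.entryVar_noiseIndex (P : Params M N K τ) (l : Fin N ⊕ Fin M) (t : Fin τ) :
    (P.entryVar (noiseIndex l t) : ℝ) = P.despreadVar l := by
  rcases l with l | l <;> simp [noiseIndex, entryVar, despreadVar, sq_nonneg]

/-- Combining independent columns with a unit vector s keeps the variances and the uncorrelatedness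
of the rows. Z and ξ are independent because they are built from disjoint sets of entries. -/
lemma IsModel.gaussianWithNoise [IsProbabilityMeasure μ] (hX : IsModel μ P X) {s : Fin τ → ℂ}
    (hs : ∑ t, s t * star (s t) = 1) :
    GaussianWithNoise μ X.gain (X.despread s) P.despreadVar where
  law := by
    rintro ⟨m, n | k⟩
    · exact hX.law_Ht m n
    · exact hX.law_dt k m
  indep := iIndepFun.precomp (g := gainIndex) gainIndex_injective hX.indep
  moments l := AllMoments.sum fun t _ =>
    (allMoments_of_hasLaw (hX.hasLaw_entry _)).const_mul _
  mean l := by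
    unfold Inputs.despread
    rw [integral_finsetSum _ fun t _ =>
      ((allMoments_of_hasLaw (hX.hasLaw_entry _)).const_mul _).integrable]
    simp_rw [integral_const_mul, integral_of_gaussian (hX.hasLaw_entry _), mul_zero,
      Finset.sum_const_zero]
  cov l l' := by
    have hm := fun i => allMoments_of_hasLaw (hX.hasLaw_entry i)
    have e : ∀ ω, X.despread s l ω * star (X.despread s l' ω) = ∑ t, ∑ t',
        (s t * star (s t')) *
          (X.entry (noiseIndex l t) ω * star (X.entry (noiseIndex l' t') ω)) := by
      intro ω
      simp only [Inputs.despread, star_sum, Finset.sum_mul_sum, star_mul]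
      refine Finset.sum_congr rfl fun t _ => Finset.sum_congr rfl fun t' _ => by ring
    simp_rw [e]
    rw [integral_finsetSum _ fun t _ => integrable_finsetSum _ fun t' _ =>
      (((hm _).mul (hm _).star).const_mul _).integrable]
    simp_rw [integral_finsetSum Finset.univ fun t' _ =>
      (((hm _).mul (hm (noiseIndex l' t')).star).const_mul _).integrable, integral_const_mul,
      integral_mul_star_of_gaussian hX.hasLaw_entry hX.indep, noiseIndex_eq_iff,
      Params.entryVar_noiseIndex]
    by_cases h : l = l'
    · subst h
      simp only [true_and, mul_ite, mul_zero, Finset.sum_ite_eq, Finset.mem_univ, if_true,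
        ← Finset.sum_mul, hs, one_mul]
    · simp [h]
  indepFun := by
    classical
    let S : Finset ((Fin M × Fin N) ⊕ (Fin K × Fin M) ⊕ (Fin N × Fin τ) ⊕ (Fin M × Fin τ)) :=
      Finset.univ.image gainIndex
    -- Z is a function of the entries in S, and ξ of those in its complement.
    have hS : ∀ i, gainIndex i ∈ S := fun i => Finset.mem_image_of_mem _ (Finset.mem_univ _)
    have hT : ∀ l t, noiseIndex l t ∈ Sᶜ := by
      intro l t
      simp only [S, Finset.mem_compl, Finset.mem_image, Finset.mem_univ, true_and, not_exists]
      exact fun i => gainIndex_ne_noiseIndex i l t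
    have := hX.indep.indepFun_finset₀ S Sᶜ disjoint_compl_right
      (fun i => (hX.hasLaw_entry i).aemeasurable)
    exact this.comp (φ := fun x i => x ⟨gainIndex i, hS i⟩)
      (ψ := fun x l => ∑ t, s t * x ⟨noiseIndex l t, hT l t⟩) (by fun_prop) (by fun_prop)

end Model

/-! ### Channels and observation as affine functions of Z. -/

section StandardForm

variable {M N K τ : ℕ} {Ω : Type*} (P : Params M N K τ) (X : Inputs Ω M N K τ)

/-- The mean of the RIS-BS channel. -/
noncomputable def Params.losMat : Matrix (Fin M) (Fin N) ℂ :=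
  ((√(P.β / (P.δ + 1)) * √P.δ : ℝ) : ℂ) • P.Hbar

/-- The RIS-BS channel is `losMat + Z * scatMat` with `Z = [H̃₂, d̃_1, …, d̃_K]`. -/
noncomputable def Params.scatMat : Matrix (Fin N ⊕ Fin K) (Fin N) ℂ :=
  ((√(P.β / (P.δ + 1)) : ℝ) : ℂ) • Matrix.fromRows (CFC.sqrt P.Rris) 0

/-- The mean of the channel of user `k`. -/
noncomputable def Params.chanMean (k : Fin K) : Fin M → ℂ :=
  P.losMat *ᵥ (P.Φ *ᵥ chanUser P k)

/-- The channel of user `k` is `chanMean + Z * chanCoeff` with `Z = [H̃₂, d̃_1, …, d̃_K]`. -/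
noncomputable def Params.chanCoeff (k : Fin K) : Fin N ⊕ Fin K → ℂ :=
  P.scatMat *ᵥ (P.Φ *ᵥ chanUser P k) + ((√(P.γ k) : ℝ) : ℂ) • Pi.single (Sum.inr k) 1

/-- The matrix `Φ R_emi^{1/2}`. -/
noncomputable def Params.emiMat : Matrix (Fin N) (Fin N) ℂ := P.Φ * CFC.sqrt P.Remi

/-- The zero rows of `scatMat` switch off the direct channels, so the RIS link and the aggregated
channels are written with the same Gaussian matrix. -/
lemma chanRIS_eq (ω : Ω) : chanRIS P X ω = P.losMat + toMat X.gain ω * P.scatMat := by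
  have : toMat X.gain ω * Matrix.fromRows (CFC.sqrt P.Rris) (0 : Matrix (Fin K) (Fin N) ℂ) =
      X.Ht ω * CFC.sqrt P.Rris := by
    ext m n
    simp [Matrix.mul_apply, toMat, Inputs.gain, gainIndex, Inputs.entry]
  rw [Params.losMat, Params.scatMat, Matrix.mul_smul, this, chanRIS, smul_add, smul_smul]
  simp

lemma chan_eq (k : Fin K) (ω : Ω) :
    chan P X k ω = P.chanMean k + toMat X.gain ω *ᵥ P.chanCoeff k := by
  have : toMat X.gain ω *ᵥ Pi.single (Sum.inr k) 1 = X.dt k ω := by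
    ext m
    simp [toMat, Inputs.gain, gainIndex, Inputs.entry]
  rw [chan, chanRIS_eq, Params.chanMean, Params.chanCoeff, mulVec_add, mulVec_smul, this,
    add_mulVec, mulVec_mulVec (v := P.Φ *ᵥ chanUser P k), add_assoc]

/-- Constant parts of the coefficients of the observation. -/
noncomputable def Params.obsMean (k : Fin K) : Option (Fin N ⊕ Fin M) → Fin M → ℂ
  | none => P.chanMean k
  | some (.inl n) => ((1 / √(τ * P.p) : ℝ) : ℂ) • (P.losMat * P.emiMat).col n
  | some (.inr m) => ((1 / √(τ * P.p) : ℝ) : ℂ) • Pi.single m 1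

/-- Random parts of the coefficients of the observation. -/
noncomputable def Params.obsCoeff (k : Fin K) : Option (Fin N ⊕ Fin M) → Fin N ⊕ Fin K → ℂ
  | none => P.chanCoeff k
  | some (.inl n) => ((1 / √(τ * P.p) : ℝ) : ℂ) • (P.scatMat * P.emiMat).col n
  | some (.inr _) => 0

/-- The pilot sequence of user `k`. -/
def Params.pilot (k : Fin K) : Fin τ → ℂ := fun t => P.S t k

variable {P}

lemma Params.Valid.pilot_norm (hP : P.Valid) (k : Fin K) :
    ∑ t, P.pilot k t * star (P.pilot k t) = 1 := by
  have := congrFun (congrFun hP.pilots k) k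
  rw [Matrix.mul_apply, Matrix.one_apply_eq] at this
  rw [← this]
  refine Finset.sum_congr rfl fun t _ => ?_
  rw [conjTranspose_apply, mul_comm]; rfl

/-- A pilot of length 0 cannot have norm 1. This makes √(τ p) invertible. -/
lemma Params.Valid.pilot_pos (hP : P.Valid) (k : Fin K) : 0 < τ := by
  rcases Nat.eq_zero_or_pos τ with rfl | h
  · simpa using hP.pilot_norm k
  · exact h

/-- Since Sᴴ s_k is a unit vector, despreading isolates the channel of user k. The EMI term is
bilinear in Z and Ṽ s_k; reading it as a sum of columns weighted by the entries of Ṽ s_k puts it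
into `affine` form. -/
lemma obs_eq (hP : P.Valid) (k : Fin K) (ω : Ω) :
    obs P X k ω = affine X.gain (X.despread (P.pilot k)) 1 (P.obsMean k) (P.obsCoeff k) ω := by
  have hτ : (0 : ℝ) < τ * P.p := mul_pos (by exact_mod_cast hP.pilot_pos k) hP.p_pos
  have h1 : (Matrix.of fun m k => chan P X k ω m) *ᵥ (P.Sᴴ *ᵥ P.pilot k) = chan P X k ω := by
    have : P.Sᴴ *ᵥ P.pilot k = Pi.single k 1 := by
      have h := congrArg (fun A : Matrix (Fin K) (Fin K) ℂ => A.col k) hP.pilots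
      ext i
      have := congrFun h i
      simp only [Matrix.col_apply, Matrix.one_apply] at this
      rw [Pi.single_apply, ← this]
      rfl
    rw [this]
    ext m; simp
  have h2 : (CFC.sqrt P.Remi * X.Vt ω) *ᵥ P.pilot k =
      CFC.sqrt P.Remi *ᵥ (fun n => X.despread (P.pilot k) (.inl n) ω) := by
    rw [← mulVec_mulVec]
    congr 1
    ext n
    simp [mulVec, dotProduct, Inputs.despread, noiseIndex, Inputs.entry, mul_comm]
  have h3 : X.Nz ω *ᵥ P.pilot k = fun m => X.despread (P.pilot k) (.inr m) ω := by
    ext n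
    simp [mulVec, dotProduct, Inputs.despread, noiseIndex, Inputs.entry, mul_comm]
  have h4 : ∀ (A : Matrix (Fin M) (Fin N) ℂ) (x : Fin N → ℂ), ∑ n, x n • A.col n = A *ᵥ x := by
    intro A x
    ext m
    simp [mulVec, dotProduct, mul_comm]
  have h5 : ∀ x : Fin M → ℂ, ∑ m, x m • (Pi.single m 1 : Fin M → ℂ) = x := by
    intro x
    ext m
    simp [Pi.single_apply]
  have h6 : ((1 / √(τ * P.p) : ℝ) : ℂ) * ((√(τ * P.p) : ℝ) : ℂ) = 1 := by
    rw [← Complex.ofReal_mul, one_div, inv_mul_cancel₀ (by positivity), Complex.ofReal_one]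
  have h7 : obs P X k ω = ((1 / √(τ * P.p) : ℝ) : ℂ) • (pilotSignal P X ω *ᵥ P.pilot k) := rfl
  have h8 : ∑ m, X.despread (P.pilot k) (.inr m) ω •
      ((1 / √(τ * P.p) : ℝ) : ℂ) • (Pi.single m 1 : Fin M → ℂ) =
      ((1 / √(τ * P.p) : ℝ) : ℂ) • fun m => X.despread (P.pilot k) (.inr m) ω := by
    conv_rhs => rw [← h5 fun m => X.despread (P.pilot k) (.inr m) ω, Finset.smul_sum]
    simp_rw [smul_comm (X.despread _ _ _)]
  have h9 : ∑ n, X.despread (P.pilot k) (.inl n) ω •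
      (((1 / √(τ * P.p) : ℝ) : ℂ) • (P.losMat * P.emiMat).col n +
        toMat X.gain ω *ᵥ (((1 / √(τ * P.p) : ℝ) : ℂ) • (P.scatMat * P.emiMat).col n)) =
      ((1 / √(τ * P.p) : ℝ) : ℂ) •
        ((P.losMat * P.emiMat + toMat X.gain ω * (P.scatMat * P.emiMat)) *ᵥ
        fun n => X.despread (P.pilot k) (.inl n) ω) := by
    rw [← h4, Finset.smul_sum]
    refine Finset.sum_congr rfl fun n _ => ?_
    rw [mulVec_smul, ← smul_add, smul_comm]
    congr 2
  rw [h7, pilotSignal, add_mulVec, add_mulVec, smul_mulVec, ← mulVec_mulVec, h1,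
    ← mulVec_mulVec, h2, h3, mulVec_mulVec, smul_add, smul_add, smul_smul, h6, one_smul,
    chan_eq, chanRIS_eq, affine, Fintype.sum_option, Fintype.sum_sum_type]
  simp only [withOne, one_mulVec, Params.obsMean, Params.obsCoeff, mulVec_zero, add_zero, one_smul,
    h8, h9]
  rw [add_assoc, Matrix.mul_assoc, Matrix.add_mul, Params.emiMat, Matrix.mul_assoc]

end StandardForm

/-! ## Norms of vectors and matrices -/

section Norms

variable {m n l : Type*} [Fintype m] [Fintype n] [Fintype l]

lemma dotProduct_star_self (v : n → ℂ) : v ⬝ᵥ star v = (sqNorm v : ℂ) := by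
  simp only [dotProduct, sqNorm, Pi.star_apply, Complex.star_def, Complex.mul_conj,
    Complex.normSq_eq_norm_sq, Complex.ofReal_sum]

lemma star_dotProduct_self (v : n → ℂ) : star v ⬝ᵥ v = (sqNorm v : ℂ) := by
  rw [dotProduct_comm, dotProduct_star_self]

lemma trace_conjTranspose_mul_self (A : Matrix m n ℂ) : (Aᴴ * A).trace = (frob A : ℂ) := by
  rw [frob, Finset.sum_comm]
  simp only [trace, diag, mul_apply, conjTranspose_apply, Complex.ofReal_sum, Complex.star_def,
    Complex.conj_mul', Complex.ofReal_pow]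

lemma frob_eq (A : Matrix m n ℂ) : frob A = (Aᴴ * A).trace.re := by
  rw [trace_conjTranspose_mul_self, Complex.ofReal_re]

lemma sqNorm_eq (v : n → ℂ) : sqNorm v = (star v ⬝ᵥ v).re := by
  rw [star_dotProduct_self, Complex.ofReal_re]

lemma sqNorm_smul (c : ℂ) (v : n → ℂ) : sqNorm (c • v) = ‖c‖ ^ 2 * sqNorm v := by
  simp [sqNorm, mul_pow, Finset.mul_sum]

lemma frob_smul (c : ℂ) (A : Matrix m n ℂ) : frob (c • A) = ‖c‖ ^ 2 * frob A := by
  simp [frob, mul_pow, Finset.mul_sum]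

lemma sqNorm_star (v : n → ℂ) : sqNorm (star v) = sqNorm v := by simp [sqNorm]

lemma sqNorm_zero : sqNorm (0 : n → ℂ) = 0 := by simp [sqNorm]

lemma sum_sqNorm_col (A : Matrix m n ℂ) : ∑ j, sqNorm (A.col j) = frob A := by
  rw [frob, Finset.sum_comm]; rfl

lemma sqNorm_mulVec (A : Matrix m n ℂ) (v : n → ℂ) :
    sqNorm (A *ᵥ v) = (star v ⬝ᵥ (Aᴴ * A) *ᵥ v).re := by
  rw [sqNorm_eq, star_mulVec, ← dotProduct_mulVec, mulVec_mulVec]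

lemma star_dotProduct_conjTranspose_mulVec (A : Matrix m n ℂ) (v : n → ℂ) (w : m → ℂ) :
    star v ⬝ᵥ Aᴴ *ᵥ w = star (A *ᵥ v) ⬝ᵥ w := by
  rw [star_mulVec, ← dotProduct_mulVec]

lemma conjTranspose_sqrt [DecidableEq n] (A : Matrix n n ℂ) : (CFC.sqrt A)ᴴ = CFC.sqrt A :=
  (CFC.sqrt_nonneg A).isSelfAdjoint

lemma sqrt_mul_sqrt_of_posSemidef [DecidableEq n] {A : Matrix n n ℂ} (hA : A.PosSemidef) :
    CFC.sqrt A * CFC.sqrt A = A :=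
  CFC.sqrt_mul_sqrt_self A hA.nonneg

end Norms

/-! ## The channel estimate -/

section Estimate

variable {M N K τ : ℕ}

lemma affine_sub {M J L Ω : Type*} [Fintype M] [Fintype J] [Fintype L]
    (z : M × J → Ω → ℂ) (ξ : L → Ω → ℂ) (X : Matrix M M ℂ)
    (A : Option L → M → ℂ) (B : Option L → J → ℂ) (ω : Ω) :
    affine z ξ X A B ω - A none =
      affine z ξ X (fun l => l.elim 0 fun l => A (some l)) B ω := by
  simp only [affine, Fintype.sum_option, withOne, one_smul, Option.elim]
  abel

/-- With zero noise coefficients the channel lives in the same expansion as the observation, so that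
their covariance can be read off. -/
lemma chan_eq_affine {Ω : Type*} (P : Params M N K τ) (X : Inputs Ω M N K τ) (s : Fin τ → ℂ)
    (k : Fin K) (ω : Ω) :
    chan P X k ω = affine X.gain (X.despread s) 1 (fun l => l.elim (P.chanMean k) 0)
      (fun l => l.elim (P.chanCoeff k) 0) ω := by
  simp [chan_eq, affine, Fintype.sum_option, withOne]

variable {P : Params M N K τ}

lemma norm_ofReal_sqrt_sq {x : ℝ} (hx : 0 ≤ x) : ‖((√x : ℝ) : ℂ)‖ ^ 2 = x := by
  rw [Complex.norm_real, Real.norm_eq_abs, sq_abs, Real.sq_sqrt hx]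

lemma ofReal_sqrt_mul_sqrt {x : ℝ} (hx : 0 ≤ x) : ((√x : ℝ) : ℂ) * ((√x : ℝ) : ℂ) = x := by
  rw [← Complex.ofReal_mul, Real.mul_self_sqrt hx]

lemma Params.Valid.gain_nonneg (hP : P.Valid) : 0 ≤ P.β / (P.δ + 1) :=
  div_nonneg hP.β_pos.le (by linarith [hP.δ_nonneg])

lemma Params.Valid.norm_sq_scale (hP : P.Valid) :
    ‖((1 / √(τ * P.p) : ℝ) : ℂ)‖ ^ 2 = 1 / (τ * P.p) := by
  have : (0 : ℝ) ≤ τ * P.p := mul_nonneg τ.cast_nonneg hP.p_pos.le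
  rw [Complex.norm_real, Real.norm_eq_abs, sq_abs, div_pow, Real.sq_sqrt this, one_pow]

/-- Only this Gram matrix of `scatMat` enters the moments, which is how R_ris^{1/2} disappears;
`emiMat_mul_conjTranspose` does the same for R_emi^{1/2}. -/
lemma scatMat_conjTranspose_mul (hP : P.Valid) :
    P.scatMatᴴ * P.scatMat = ((P.β / (P.δ + 1) : ℝ) : ℂ) • P.Rris := by
  rw [Params.scatMat, conjTranspose_smul, Matrix.smul_mul, Matrix.mul_smul, smul_smul,
    conjTranspose_fromRows_eq_fromCols_conjTranspose,
    fromCols_mul_fromRows, conjTranspose_sqrt, sqrt_mul_sqrt_of_posSemidef hP.Rris_psd,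
    Complex.star_def, Complex.conj_ofReal, ofReal_sqrt_mul_sqrt hP.gain_nonneg]
  simp

lemma emiMat_mul_conjTranspose (hP : P.Valid) :
    P.emiMat * P.emiMatᴴ = P.Φ * P.Remi * P.Φᴴ := by
  rw [Params.emiMat, conjTranspose_mul, conjTranspose_sqrt, Matrix.mul_assoc,
    ← Matrix.mul_assoc (CFC.sqrt P.Remi), sqrt_mul_sqrt_of_posSemidef hP.Remi_psd, Matrix.mul_assoc]

lemma losMat_mul_conjTranspose (hP : P.Valid) :
    P.losMat * P.emiMat * (P.losMat * P.emiMat)ᴴ =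
      ((P.β / (P.δ + 1) * P.δ : ℝ) : ℂ) • (P.Hbar * P.Φ * P.Remi * P.Φᴴ * P.Hbarᴴ) := by
  have : P.losMat * P.emiMat * (P.losMat * P.emiMat)ᴴ =
      P.losMat * (P.emiMat * P.emiMatᴴ) * P.losMatᴴ := by
    simp only [conjTranspose_mul, Matrix.mul_assoc]
  rw [this, emiMat_mul_conjTranspose hP, Params.losMat, conjTranspose_smul, Matrix.smul_mul,
    Matrix.smul_mul, Matrix.mul_smul, smul_smul, Complex.star_def, Complex.conj_ofReal,
    ← Complex.ofReal_mul]
  congr 1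
  · rw [show ∀ a b : ℝ, a * b * (a * b) = (a * a) * (b * b) by intros; ring,
      Real.mul_self_sqrt hP.gain_nonneg, Real.mul_self_sqrt hP.δ_nonneg]
  · simp only [Matrix.mul_assoc]

lemma sqNorm_chanCoeff (hP : P.Valid) (k : Fin K) :
    sqNorm (P.chanCoeff k) = P.c k * P.f2 k + P.γ k := by
  -- Pythagoras: the reflected and the direct part are supported on complementary index blocks.
  have h1 : sqNorm (P.chanCoeff k) = sqNorm (P.scatMat *ᵥ (P.Φ *ᵥ chanUser P k)) +
      sqNorm (((√(P.γ k) : ℝ) : ℂ) • (Pi.single (Sum.inr k) 1 : Fin N ⊕ Fin K → ℂ)) := by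
    simp only [Params.chanCoeff, Params.scatMat, smul_mulVec, fromRows_mulVec, sqNorm,
      Fintype.sum_sum_type]
    simp
  have h2 : sqNorm (Pi.single (Sum.inr k) 1 : Fin N ⊕ Fin K → ℂ) = 1 := by
    simp [sqNorm, Pi.single_apply, ite_pow, apply_ite]
  rw [h1, sqNorm_smul, h2, norm_ofReal_sqrt_sq (hP.γ_nonneg k), mul_one, sqNorm_mulVec,
    scatMat_conjTranspose_mul hP, chanUser, Params.f2, Params.c, mulVec_smul]
  have h3 : (P.α k * P.β / (P.δ + 1) : ℝ) =
      (((√(P.α k) : ℝ) : ℂ) * ((√(P.α k) : ℝ) : ℂ) * ((P.β / (P.δ + 1) : ℝ) : ℂ)).re := by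
    rw [ofReal_sqrt_mul_sqrt (hP.α_pos k).le, ← Complex.ofReal_mul, Complex.ofReal_re]
    ring
  rw [← Complex.re_ofReal_mul, h3, ← Complex.ofReal_mul, ← Complex.ofReal_mul, Complex.ofReal_re]
  simp only [star_smul, smul_mulVec, mulVec_smul, dotProduct_smul, smul_dotProduct, smul_eq_mul,
    ← mulVec_mulVec, star_dotProduct_conjTranspose_mulVec, Complex.ofReal_mul, Complex.star_def,
    Complex.conj_ofReal]
  congr 2
  ring

lemma frob_scatMat_mul_emiMat (hP : P.Valid) :
    frob (P.scatMat * P.emiMat) = P.β / (P.δ + 1) * (P.Remi * P.Φᴴ * P.Rris * P.Φ).trace.re := by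
  have : (P.scatMat * P.emiMat)ᴴ * (P.scatMat * P.emiMat) =
      P.emiMatᴴ * ((P.scatMatᴴ * P.scatMat) * P.emiMat) := by
    simp only [conjTranspose_mul, Matrix.mul_assoc]
  rw [frob_eq, this, scatMat_conjTranspose_mul hP, trace_mul_comm, Matrix.mul_assoc,
    emiMat_mul_conjTranspose hP, Matrix.smul_mul, trace_smul, smul_eq_mul, Complex.re_ofReal_mul,
    trace_mul_comm, Matrix.mul_assoc, Matrix.mul_assoc, trace_mul_comm]
  simp only [Matrix.mul_assoc]

/-- The covariance matrix of the observation, in closed form. -/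
noncomputable def Params.obsCov (P : Params M N K τ) (k : Fin K) : Matrix (Fin M) (Fin M) ℂ :=
  ((sqNorm (P.chanCoeff k) + P.σ ^ 2 / (τ * P.p) +
    P.σe ^ 2 / (τ * P.p) * frob (P.scatMat * P.emiMat) : ℝ) : ℂ) • 1 +
  ((P.σe ^ 2 / (τ * P.p) : ℝ) : ℂ) • (P.losMat * P.emiMat * (P.losMat * P.emiMat)ᴴ)

/-- Identifies Υ_k with Cov(q, y) Cov(y, y)⁻¹ once `crossCov_chan_obs` and `crossCov_obs_obs` are
known. -/
lemma upsilon_eq (hP : P.Valid) (k : Fin K) :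
    P.Υ k = ((sqNorm (P.chanCoeff k) : ℝ) : ℂ) • (P.obsCov k)⁻¹ := by
  have e1 : P.σe ^ 2 / (τ * P.p) * (P.β / (P.δ + 1) * (P.Remi * P.Φᴴ * P.Rris * P.Φ).trace.re) =
      P.σe ^ 2 * P.β * (P.Remi * P.Φᴴ * P.Rris * P.Φ).trace.re / (τ * P.p * (P.δ + 1)) := by
    simp only [div_eq_mul_inv, mul_inv]; ring
  have e2 : P.σe ^ 2 / (τ * P.p) * (P.β / (P.δ + 1) * P.δ) =
      P.σe ^ 2 * P.β * P.δ / (τ * P.p * (P.δ + 1)) := by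
    simp only [div_eq_mul_inv, mul_inv]; ring
  rw [Params.Υ, Params.obsCov, sqNorm_chanCoeff hP, frob_scatMat_mul_emiMat hP,
    losMat_mul_conjTranspose hP, smul_smul, ← Complex.ofReal_mul, e1, e2]

lemma obsCov_isHermitian (k : Fin K) : (P.obsCov k).IsHermitian := by
  unfold Params.obsCov
  refine IsHermitian.add ?_ ?_
  · rw [IsHermitian, conjTranspose_smul, conjTranspose_one, Complex.star_def, Complex.conj_ofReal]
  · rw [IsHermitian, conjTranspose_smul, (isHermitian_mul_conjTranspose_self _).eq,
      Complex.star_def, Complex.conj_ofReal]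

lemma frob_nonneg {m n : Type*} [Fintype m] [Fintype n] (A : Matrix m n ℂ) : 0 ≤ frob A :=
  Finset.sum_nonneg fun _ _ => Finset.sum_nonneg fun _ _ => by positivity

lemma sqNorm_nonneg {n : Type*} [Fintype n] (v : n → ℂ) : 0 ≤ sqNorm v :=
  Finset.sum_nonneg fun _ _ => by positivity

/-- Thermal noise of positive power makes the scalar part positive, and the line-of-sight EMI adds a
positive semidefinite matrix. So the inverse in the LMMSE estimate is a genuine one. -/
lemma obsCov_isUnit_det (hP : P.Valid) (k : Fin K) : IsUnit (P.obsCov k).det := by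
  have hτ : (0 : ℝ) < τ * P.p := mul_pos (by exact_mod_cast hP.pilot_pos k) hP.p_pos
  have h1 : 0 < sqNorm (P.chanCoeff k) + P.σ ^ 2 / (τ * P.p) +
      P.σe ^ 2 / (τ * P.p) * frob (P.scatMat * P.emiMat) := by
    have := sqNorm_nonneg (P.chanCoeff k)
    have := frob_nonneg (P.scatMat * P.emiMat)
    have := hP.σ_pos
    positivity
  have h2 : (P.obsCov k).PosDef := by
    unfold Params.obsCov
    refine PosDef.add_posSemidef (PosDef.one.smul (by exact_mod_cast h1)) ?_
    refine (posSemidef_self_mul_conjTranspose _).smul ?_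
    exact_mod_cast (by positivity : (0 : ℝ) ≤ P.σe ^ 2 / (τ * P.p))
  exact h2.isUnit.map (detMonoidHom)

lemma upsilon_isHermitian (hP : P.Valid) (k : Fin K) : (P.Υ k)ᴴ = P.Υ k := by
  rw [upsilon_eq hP, conjTranspose_smul, (obsCov_isHermitian k).inv.eq, Complex.star_def,
    Complex.conj_ofReal]

lemma upsilon_mul_obsCov (hP : P.Valid) (k : Fin K) :
    P.Υ k * P.obsCov k = ((sqNorm (P.chanCoeff k) : ℝ) : ℂ) • 1 := by
  rw [upsilon_eq hP, Matrix.smul_mul, nonsing_inv_mul _ (obsCov_isUnit_det hP k)]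

variable {Ω : Type*} [MeasurableSpace Ω] {μ : Measure Ω} [IsProbabilityMeasure μ]
  {X : Inputs Ω M N K τ}

lemma mean_chan (hP : P.Valid) (hX : IsModel μ P X) (k : Fin K) :
    mean μ (chan P X k) = P.chanMean k := by
  have h := hX.gaussianWithNoise (hP.pilot_norm k)
  ext m
  simp_rw [mean, chan_eq_affine P X (P.pilot k)]
  exact h.integral_affine_apply _ _ _

lemma mean_obs (hP : P.Valid) (hX : IsModel μ P X) (k : Fin K) :
    mean μ (obs P X k) = P.chanMean k := by
  have h := hX.gaussianWithNoise (hP.pilot_norm k)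
  ext m
  simp_rw [mean, obs_eq X hP]
  exact h.integral_affine_apply _ _ _

lemma chan_sub_mean (hP : P.Valid) (hX : IsModel μ P X) (k : Fin K) (ω : Ω) :
    chan P X k ω - mean μ (chan P X k) = affine X.gain (X.despread (P.pilot k)) 1 0
      (fun l => l.elim (P.chanCoeff k) 0) ω := by
  rw [mean_chan hP hX, chan_eq_affine P X (P.pilot k)]
  refine (affine_sub _ _ _ _ _ _).trans ?_
  congr 1
  ext l
  cases l <;> rfl

lemma obs_sub_mean (hP : P.Valid) (hX : IsModel μ P X) (k : Fin K) (ω : Ω) :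
    obs P X k ω - mean μ (obs P X k) = affine X.gain (X.despread (P.pilot k)) 1
      (fun l => l.elim 0 fun l => P.obsMean k (some l)) (P.obsCoeff k) ω := by
  rw [mean_obs hP hX, obs_eq X hP]
  exact affine_sub _ _ _ _ _ _

/-- EMI and thermal noise are uncorrelated with the channel, so only the weight 1 survives; there
channel and observation have the same coefficient vector. -/
lemma crossCov_chan_obs (hP : P.Valid) (hX : IsModel μ P X) (k : Fin K) :
    crossCov μ (chan P X k) (obs P X k) = ((sqNorm (P.chanCoeff k) : ℝ) : ℂ) • 1 := by
  have h := hX.gaussianWithNoise (hP.pilot_norm k)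
  ext m m'
  simp only [crossCov, Matrix.of_apply, ← Pi.sub_apply, chan_sub_mean hP hX, obs_sub_mean hP hX]
  rw [h.integral_affine_apply_mul_star]
  simp [Fintype.sum_option, varWithOne, Params.obsCoeff, dotProduct_star_self, Matrix.one_apply]

lemma crossCov_obs_obs (hP : P.Valid) (hX : IsModel μ P X) (k : Fin K) :
    crossCov μ (obs P X k) (obs P X k) = P.obsCov k := by
  have h := hX.gaussianWithNoise (hP.pilot_norm k)
  ext m m'
  simp only [crossCov, Matrix.of_apply, ← Pi.sub_apply, obs_sub_mean hP hX]
  rw [h.integral_affine_apply_mul_star]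
  simp only [Fintype.sum_option, Fintype.sum_sum_type, varWithOne, Params.obsCoeff, Params.obsMean,
    dotProduct_star_self, Option.elim, Params.despreadVar, sqNorm_smul, sqNorm_zero,
    hP.norm_sq_scale]
  have e : ∀ x y : ℂ, (((1 / √(τ * P.p) : ℝ) : ℂ) * x) * star (((1 / √(τ * P.p) : ℝ) : ℂ) * y) =
      ((1 / (τ * P.p) : ℝ) : ℂ) * (x * star y) := by
    intro x y
    rw [← hP.norm_sq_scale, Complex.ofReal_pow, ← Complex.mul_conj', star_mul, ← Complex.star_def]
    ring
  -- EMI: the line-of-sight part gives a full matrix, the scattered part a multiple of the identity.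
  have e1 : ∑ n, ((P.σe ^ 2 : ℝ) : ℂ) *
      (((1 / (τ * P.p) : ℝ) : ℂ) * ((P.losMat * P.emiMat) m n * star ((P.losMat * P.emiMat) m' n))
        + if m = m' then ((1 / (τ * P.p) * sqNorm ((P.scatMat * P.emiMat).col n) : ℝ) : ℂ) else 0) =
      ((P.σe ^ 2 / (τ * P.p) : ℝ) : ℂ) * (P.losMat * P.emiMat * (P.losMat * P.emiMat)ᴴ) m m' +
      if m = m' then ((P.σe ^ 2 / (τ * P.p) * frob (P.scatMat * P.emiMat) : ℝ) : ℂ) else 0 := by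
    rw [← Finset.mul_sum, Finset.sum_add_distrib, ← Finset.mul_sum, Matrix.mul_apply, mul_add]
    congr 1
    · simp only [conjTranspose_apply]
      push_cast
      ring
    · split_ifs
      · rw [← Complex.ofReal_sum, ← Finset.mul_sum, sum_sqNorm_col, ← Complex.ofReal_mul]
        congr 1
        ring
      · simp
  -- Thermal noise contributes a multiple of the identity.
  have e2 : ∑ i : Fin M, ((P.σ ^ 2 : ℝ) : ℂ) * (((1 / (τ * P.p) : ℝ) : ℂ) *
      ((Pi.single i 1 : Fin M → ℂ) m * star ((Pi.single i 1 : Fin M → ℂ) m')) +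
        if m = m' then ((0 : ℝ) : ℂ) else 0) =
      if m = m' then ((P.σ ^ 2 / (τ * P.p) : ℝ) : ℂ) else 0 := by
    by_cases h : m = m'
    · subst h
      simp [Pi.single_apply, div_eq_mul_inv]
    · simp only [h, if_false, add_zero]
      refine Finset.sum_eq_zero fun i _ => ?_
      by_cases h1 : m = i
      · simp [Pi.single_apply, show m' ≠ i from fun h2 => h (h1.trans h2.symm)]
      · simp [Pi.single_apply, h1]
  simp only [Pi.smul_apply, smul_eq_mul, e, Matrix.col_apply, e1, e2, Params.obsCov]
  simp only [Pi.zero_apply, zero_mul, zero_add, Complex.ofReal_one, one_mul, Matrix.add_apply,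
    Matrix.smul_apply, Matrix.one_apply, smul_eq_mul]
  split_ifs <;> push_cast <;> ring

/-- Constant parts of the coefficients of the channel estimate. -/
noncomputable def Params.estMean (P : Params M N K τ) (k : Fin K)
    (l : Option (Fin N ⊕ Fin M)) : Fin M → ℂ :=
  l.elim (P.chanMean k) fun l => P.Υ k *ᵥ P.obsMean k (some l)

/-- The gain Υ_k acts on the centred observation only, so the deterministic mean of the channel is
not multiplied by it; this is why `estMean` treats `none` separately. -/
lemma chanEst_eq (hP : P.Valid) (hX : IsModel μ P X) (k : Fin K) (ω : Ω) :
    chanEst P X μ k ω = affine X.gain (X.despread (P.pilot k)) (P.Υ k) (P.estMean k)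
      (P.obsCoeff k) ω := by
  rw [chanEst, lmmse, crossCov_chan_obs hP hX, crossCov_obs_obs hP hX, Matrix.smul_mul,
    Matrix.one_mul, ← upsilon_eq hP, obs_sub_mean hP hX, mean_chan hP hX]
  simp only [affine, mulVec_sum, Fintype.sum_option, withOne, Option.elim, Params.estMean,
    one_smul, one_mulVec, zero_add, mulVec_add, mulVec_smul, add_assoc]

end Estimate

/-! ## Moments of the combiner output -/

section Moments

variable {M N K τ : ℕ} {P : Params M N K τ}

/-- `Φ h̄_k`. -/
noncomputable def Params.reflected (P : Params M N K τ) (k : Fin K) : Fin N → ℂ :=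
  P.Φ *ᵥ P.hbar k

/-- The scalar part of the covariance matrix of the observation. -/
noncomputable def Params.obsScalar (P : Params M N K τ) (k : Fin K) : ℝ :=
  sqNorm (P.chanCoeff k) + P.σ ^ 2 / (τ * P.p) +
    P.σe ^ 2 / (τ * P.p) * frob (P.scatMat * P.emiMat)

/-- The second moment of `(a + Z b)ᴴ q̂_k`. -/
noncomputable def Params.formMoment (P : Params M N K τ) (k : Fin K) (a : Fin M → ℂ)
    (b : Fin N ⊕ Fin K → ℂ) : ℝ :=
  ‖star a ⬝ᵥ P.chanMean k + P.trΥ k * (star b ⬝ᵥ P.chanCoeff k)‖ ^ 2 +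
    (sqNorm (P.Υ k *ᵥ a) + sqNorm b * frob (P.Υ k)) * P.obsScalar k +
    sqNorm b * sqNorm (P.chanMean k) +
    P.σe ^ 2 / (τ * P.p) *
      (sqNorm (star a ᵥ* (P.Υ k * (P.losMat * P.emiMat)) +
          (P.trΥ k : ℂ) • (star b ᵥ* (P.scatMat * P.emiMat))) +
        sqNorm b * frob (P.Υ k * (P.losMat * P.emiMat)))

lemma trace_upsilon (hP : P.Valid) (k : Fin K) : (P.Υ k).trace = (P.trΥ k : ℂ) := by
  have h : star (P.Υ k).trace = (P.Υ k).trace := by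
    rw [← trace_conjTranspose, upsilon_isHermitian hP]
  exact (Complex.conj_eq_iff_re.1 h).symm

lemma sqNorm_star_vecMul_upsilon (hP : P.Valid) (k : Fin K) (a : Fin M → ℂ) :
    sqNorm (star a ᵥ* P.Υ k) = sqNorm (P.Υ k *ᵥ a) := by
  rw [← sqNorm_star (P.Υ k *ᵥ a), star_mulVec, upsilon_isHermitian hP]

/-- Channel gain, scattered EMI and thermal noise all multiply the same expression ‖Υ a‖² + ‖b‖²
‖Υ‖_F², and their powers add up to `obsScalar`. Thermal noise has no random coefficient; it joins in
because its constant coefficients run over the columns of Υ. -/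
lemma sum_varWithOne_eq_formMoment (hP : P.Valid) (k : Fin K) (a : Fin M → ℂ)
    (b : Fin N ⊕ Fin K → ℂ) :
    ∑ l, varWithOne P.despreadVar l * (‖star a ⬝ᵥ P.estMean k l +
          (P.Υ k).trace * (star b ⬝ᵥ P.obsCoeff k l)‖ ^ 2
        + sqNorm (star a ᵥ* P.Υ k) * sqNorm (P.obsCoeff k l) + sqNorm b * sqNorm (P.estMean k l)
        + sqNorm b * frob (P.Υ k) * sqNorm (P.obsCoeff k l)) = P.formMoment k a b := by
  have e : ∀ x : ℂ, ‖((1 / √(τ * P.p) : ℝ) : ℂ) * x‖ ^ 2 = 1 / (τ * P.p) * ‖x‖ ^ 2 := by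
    intro x
    rw [norm_mul, mul_pow, hP.norm_sq_scale]
  have h1 : ∀ n, star a ⬝ᵥ (P.Υ k *ᵥ (P.losMat * P.emiMat).col n) +
        (P.trΥ k : ℂ) * (star b ⬝ᵥ (P.scatMat * P.emiMat).col n) =
      (star a ᵥ* (P.Υ k * (P.losMat * P.emiMat)) +
          (P.trΥ k : ℂ) • (star b ᵥ* (P.scatMat * P.emiMat))) n := by
    intro n
    rw [dotProduct_mulVec, ← vecMul_vecMul]
    rfl
  have h2 : ∑ n, sqNorm (P.Υ k *ᵥ (P.losMat * P.emiMat).col n) =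
      frob (P.Υ k * (P.losMat * P.emiMat)) := by
    rw [← sum_sqNorm_col]; rfl
  have h3 : ∑ m, ‖star a ⬝ᵥ (P.Υ k *ᵥ Pi.single m 1)‖ ^ 2 = sqNorm (P.Υ k *ᵥ a) := by
    rw [← sqNorm_star_vecMul_upsilon hP]
    simp only [dotProduct_mulVec, dotProduct_single_one]
    rfl
  have h4 : ∑ m, sqNorm (P.Υ k *ᵥ Pi.single m 1) = frob (P.Υ k) := by
    simp_rw [mulVec_single_one]
    exact sum_sqNorm_col _
  rw [trace_upsilon hP, sqNorm_star_vecMul_upsilon hP]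
  simp only [Fintype.sum_option, Fintype.sum_sum_type, varWithOne, Params.despreadVar,
    Params.estMean, Option.elim, Params.obsMean, Params.obsCoeff, mulVec_smul, dotProduct_smul,
    smul_eq_mul, mul_left_comm (P.trΥ k : ℂ), ← mul_add, e, sqNorm_smul, sqNorm_zero,
    hP.norm_sq_scale, dotProduct_zero, mul_zero, add_zero, h1]
  have h5 : ∀ x y : ℝ, ∑ n, P.σe ^ 2 *
      (1 / (τ * P.p) * ‖(star a ᵥ* (P.Υ k * (P.losMat * P.emiMat)) +
          (P.trΥ k : ℂ) • (star b ᵥ* (P.scatMat * P.emiMat))) n‖ ^ 2 +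
        x * (1 / (τ * P.p) * sqNorm ((P.scatMat * P.emiMat).col n)) +
        sqNorm b * (1 / (τ * P.p) * sqNorm (P.Υ k *ᵥ (P.losMat * P.emiMat).col n)) +
        y * (1 / (τ * P.p) * sqNorm ((P.scatMat * P.emiMat).col n))) =
      P.σe ^ 2 / (τ * P.p) * (sqNorm (star a ᵥ* (P.Υ k * (P.losMat * P.emiMat)) +
          (P.trΥ k : ℂ) • (star b ᵥ* (P.scatMat * P.emiMat))) +
        x * frob (P.scatMat * P.emiMat) + sqNorm b * frob (P.Υ k * (P.losMat * P.emiMat)) +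
        y * frob (P.scatMat * P.emiMat)) := by
    intro x y
    have hs : ∀ v : Fin N → ℂ, sqNorm v = ∑ n, ‖v n‖ ^ 2 := fun _ => rfl
    rw [← h2, ← sum_sqNorm_col (P.scatMat * P.emiMat), hs (_ + _)]
    simp only [Finset.mul_sum, ← Finset.sum_add_distrib]
    refine Finset.sum_congr rfl fun n _ => by ring
  have h6 : ∑ m, P.σ ^ 2 * (1 / (τ * P.p) * ‖star a ⬝ᵥ (P.Υ k *ᵥ Pi.single m 1)‖ ^ 2 +
      sqNorm b * (1 / (τ * P.p) * sqNorm (P.Υ k *ᵥ Pi.single m 1))) =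
      P.σ ^ 2 / (τ * P.p) * (sqNorm (P.Υ k *ᵥ a) + sqNorm b * frob (P.Υ k)) := by
    rw [← h3, ← h4]
    simp only [Finset.mul_sum, ← Finset.sum_add_distrib]
    refine Finset.sum_congr rfl fun n _ => by ring
  rw [h5, h6, Params.formMoment, Params.obsScalar]
  ring

variable {Ω : Type*} [MeasurableSpace Ω] {μ : Measure Ω} {X : Inputs Ω M N K τ}

/-- Conjugation moves the channel to the left, where the general form (a + Z b)ᴴ q̂ has it. -/
lemma mrc_eq (k i : Fin K) (ω : Ω) : mrc P X μ k i ω =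
    star (star (P.chanMean i + toMat X.gain ω *ᵥ P.chanCoeff i) ⬝ᵥ chanEst P X μ k ω) := by
  rw [mrc, chan_eq, star_dotProduct]

lemma chanEst_apply (k : Fin K) (m : Fin M) (ω : Ω) : chanEst P X μ k ω m =
    star (Pi.single m 1 + toMat X.gain ω *ᵥ (0 : Fin N ⊕ Fin K → ℂ)) ⬝ᵥ chanEst P X μ k ω := by
  rw [mulVec_zero, add_zero]
  have : star (Pi.single m (1 : ℂ) : Fin M → ℂ) = Pi.single m 1 := by
    rw [← Pi.single_star, star_one]
  rw [this, single_one_dotProduct]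

/-- Factoring Φ R_emi Φᴴ as E Eᴴ turns the quadratic form of degree four in random quantities into
squared forms of the type already treated, one for each column of H_{c,2} E. -/
lemma emiForm_eq (hP : P.Valid) (k : Fin K) (ω : Ω) : emiForm P X μ k ω =
    ∑ n, ((‖star ((P.losMat * P.emiMat).col n + toMat X.gain ω *ᵥ (P.scatMat * P.emiMat).col n) ⬝ᵥ
      chanEst P X μ k ω‖ ^ 2 : ℝ) : ℂ) := by
  have h1 : chanRIS P X ω * P.Φ * P.Remi * P.Φᴴ * (chanRIS P X ω)ᴴ =
      (chanRIS P X ω * P.emiMat) * (chanRIS P X ω * P.emiMat)ᴴ := by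
    rw [conjTranspose_mul, Matrix.mul_assoc _ P.emiMat, ← Matrix.mul_assoc P.emiMat,
      emiMat_mul_conjTranspose hP]
    simp only [Matrix.mul_assoc]
  have h2 : ∀ (T : Matrix (Fin M) (Fin N) ℂ) (q : Fin M → ℂ),
      star q ⬝ᵥ T *ᵥ Tᴴ *ᵥ q = (sqNorm (Tᴴ *ᵥ q) : ℂ) := by
    intro T q
    rw [← star_dotProduct_self, ← star_dotProduct_conjTranspose_mulVec, conjTranspose_conjTranspose]
  have h3 : ∀ n, ((chanRIS P X ω * P.emiMat)ᴴ *ᵥ chanEst P X μ k ω) n =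
      star ((P.losMat * P.emiMat).col n + toMat X.gain ω *ᵥ (P.scatMat * P.emiMat).col n) ⬝ᵥ
        chanEst P X μ k ω := by
    intro n
    rw [chanRIS_eq, Matrix.add_mul, Matrix.mul_assoc (toMat X.gain ω)]
    rfl
  rw [emiForm, h1, ← mulVec_mulVec, h2, sqNorm, Complex.ofReal_sum]
  simp_rw [h3]

variable [IsProbabilityMeasure μ]

lemma allMoments_form_chanEst (hP : P.Valid) (hX : IsModel μ P X) (k : Fin K) (a : Fin M → ℂ)
    (b : Fin N ⊕ Fin K → ℂ) :
    AllMoments μ fun ω => star (a + toMat X.gain ω *ᵥ b) ⬝ᵥ chanEst P X μ k ω := by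
  simp_rw [chanEst_eq hP hX]
  exact (hX.gaussianWithNoise (hP.pilot_norm k)).allMoments_form _ _ _ _ _

lemma integral_norm_sq_form_chanEst (hP : P.Valid) (hX : IsModel μ P X) (k : Fin K)
    (a : Fin M → ℂ) (b : Fin N ⊕ Fin K → ℂ) :
    ∫ ω, ‖star (a + toMat X.gain ω *ᵥ b) ⬝ᵥ chanEst P X μ k ω‖ ^ 2 ∂μ = P.formMoment k a b := by
  simp_rw [chanEst_eq hP hX]
  rw [(hX.gaussianWithNoise (hP.pilot_norm k)).integral_norm_sq_form,
    sum_varWithOne_eq_formMoment hP]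

lemma allMoments_mrc (hP : P.Valid) (hX : IsModel μ P X) (k i : Fin K) :
    AllMoments μ (mrc P X μ k i) := by
  have : mrc P X μ k i = fun ω => _ := funext fun ω => mrc_eq k i ω
  rw [this]
  exact (allMoments_form_chanEst hP hX k _ _).star

lemma interference_eq (hP : P.Valid) (hX : IsModel μ P X) (k i : Fin K) :
    interference P X μ k i = P.formMoment k (P.chanMean i) (P.chanCoeff i) := by
  rw [← integral_norm_sq_form_chanEst hP hX, interference]
  simp_rw [mrc_eq, norm_star]

lemma integral_mrc (hP : P.Valid) (hX : IsModel μ P X) (k : Fin K) :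
    ∫ ω, mrc P X μ k k ω ∂μ =
      ((sqNorm (P.chanMean k) + P.trΥ k * sqNorm (P.chanCoeff k) : ℝ) : ℂ) := by
  simp_rw [mrc_eq, Complex.star_def]
  rw [integral_conj]
  simp_rw [chanEst_eq hP hX]
  rw [(hX.gaussianWithNoise (hP.pilot_norm k)).integral_form, trace_upsilon hP]
  simp only [Params.estMean, Params.obsCoeff, Option.elim, star_dotProduct_self]
  rw [← Complex.ofReal_mul, ← Complex.ofReal_add, Complex.conj_ofReal]

lemma signal_eq (hP : P.Valid) (hX : IsModel μ P X) (k : Fin K) :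
    signal P X μ k = (sqNorm (P.chanMean k) + P.trΥ k * sqNorm (P.chanCoeff k)) ^ 2 := by
  rw [signal, integral_mrc hP hX, Complex.norm_real, Real.norm_eq_abs, sq_abs]

lemma allMoments_chanEst_apply (hP : P.Valid) (hX : IsModel μ P X) (k : Fin K) (m : Fin M) :
    AllMoments μ fun ω => chanEst P X μ k ω m := by
  simp_rw [chanEst_apply]
  exact allMoments_form_chanEst hP hX k _ _

lemma integrable_estNormSq (hP : P.Valid) (hX : IsModel μ P X) (k : Fin K) :
    Integrable (estNormSq P X μ k) μ :=
  integrable_finsetSum _ fun m _ => (allMoments_chanEst_apply hP hX k m).integrable_norm_sq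

/-- The trace of Υ C Υ, where C is the observation covariance and Υ C is scalar. Probabilistically,
the variance of the estimate equals its covariance with the channel. -/
lemma obsScalar_mul_frob (hP : P.Valid) (k : Fin K) :
    P.obsScalar k * frob (P.Υ k) +
      P.σe ^ 2 / (τ * P.p) * frob (P.Υ k * (P.losMat * P.emiMat)) =
      P.trΥ k * sqNorm (P.chanCoeff k) := by
  have h := congrArg (fun A => (A * (P.Υ k)).trace) (upsilon_mul_obsCov hP k)
  simp only [Params.obsCov, mul_add, add_mul, Matrix.mul_smul, Matrix.smul_mul, Matrix.mul_one,
    Matrix.one_mul, trace_add, trace_smul, trace_upsilon hP] at h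
  rw [← Params.obsScalar] at h
  have h1 : (P.Υ k * P.Υ k).trace = (frob (P.Υ k) : ℂ) := by
    rw [← trace_conjTranspose_mul_self, upsilon_isHermitian hP]
  have h2 : (P.Υ k * (P.losMat * P.emiMat * (P.losMat * P.emiMat)ᴴ) * P.Υ k).trace =
      (frob (P.Υ k * (P.losMat * P.emiMat)) : ℂ) := by
    rw [← trace_conjTranspose_mul_self, trace_mul_comm _ (P.Υ k * _), conjTranspose_mul (P.Υ k),
      upsilon_isHermitian hP]
    simp only [Matrix.mul_assoc]
  rw [h1, h2] at h
  simp only [smul_eq_mul, ← Complex.ofReal_mul, ← Complex.ofReal_add, Complex.ofReal_inj] at h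
  rw [h, mul_comm]

/-- Summing the second moments of the entries gives ‖mean‖² + Tr(Υ C Υ), and `obsScalar_mul_frob`
brings this to the value found in `integral_mrc`. -/
lemma noise_eq (hP : P.Valid) (hX : IsModel μ P X) (k : Fin K) :
    noise P X μ k = sqNorm (P.chanMean k) + P.trΥ k * sqNorm (P.chanCoeff k) := by
  have h1 : ∀ m, ∫ ω, ‖chanEst P X μ k ω m‖ ^ 2 ∂μ = P.formMoment k (Pi.single m 1) 0 := by
    intro m
    rw [← integral_norm_sq_form_chanEst hP hX]
    simp_rw [← chanEst_apply]
  unfold noise estNormSq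
  rw [integral_finsetSum _ fun m _ => (allMoments_chanEst_apply hP hX k m).integrable_norm_sq]
  have h2 : ∀ m, star (Pi.single m (1 : ℂ) : Fin M → ℂ) = Pi.single m 1 := fun m => by
    rw [← Pi.single_star, star_one]
  have h3 : ∑ m, sqNorm (P.Υ k *ᵥ Pi.single m 1) = frob (P.Υ k) := by
    simp_rw [mulVec_single_one]
    exact sum_sqNorm_col _
  simp_rw [h1, Params.formMoment, h2, sqNorm_zero, star_zero, zero_dotProduct, zero_vecMul,
    single_one_dotProduct, single_one_vecMul, smul_zero, mul_zero, zero_mul, add_zero]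
  rw [Finset.sum_add_distrib, Finset.sum_add_distrib, ← Finset.sum_mul, ← Finset.mul_sum, h3]
  rw [← obsScalar_mul_frob hP]
  simp only [frob, sqNorm, Matrix.row]
  ring

lemma leak_eq (hP : P.Valid) (hX : IsModel μ P X) (k : Fin K) :
    leak P X μ k = P.formMoment k (P.chanMean k) (P.chanCoeff k) -
      (sqNorm (P.chanMean k) + P.trΥ k * sqNorm (P.chanCoeff k)) ^ 2 := by
  rw [← interference_eq hP hX, ← signal_eq hP hX]
  rfl

lemma integrable_emiForm (hP : P.Valid) (hX : IsModel μ P X) (k : Fin K) :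
    Integrable (emiForm P X μ k) μ := by
  have : emiForm P X μ k = fun ω => _ := funext fun ω => emiForm_eq hP k ω
  rw [this]
  exact integrable_finsetSum _ fun n _ =>
    (allMoments_form_chanEst hP hX k _ _).integrable_norm_sq.ofReal

lemma emi_eq (hP : P.Valid) (hX : IsModel μ P X) (k : Fin K) : emi P X μ k =
    ∑ n, P.formMoment k ((P.losMat * P.emiMat).col n) ((P.scatMat * P.emiMat).col n) := by
  simp_rw [emi, emiForm_eq hP]
  rw [integral_finsetSum _ fun n _ =>
    (allMoments_form_chanEst hP hX k _ _).integrable_norm_sq.ofReal]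
  simp_rw [integral_complex_ofReal, integral_norm_sq_form_chanEst hP hX, ← Complex.ofReal_sum,
    Complex.ofReal_re]

end Moments

/-! ## Closed forms -/

section Norms

variable {m n : Type*} [Fintype m] [Fintype n]

lemma star_dotProduct_mulVec (A : Matrix m n ℂ) (v : m → ℂ) (w : n → ℂ) :
    star v ⬝ᵥ A *ᵥ w = star (Aᴴ *ᵥ v) ⬝ᵥ w := by
  rw [← star_dotProduct_conjTranspose_mulVec, conjTranspose_conjTranspose]

lemma sqNorm_ofReal_smul (x : ℝ) (v : n → ℂ) : sqNorm ((x : ℂ) • v) = x ^ 2 * sqNorm v := by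
  rw [sqNorm_smul, Complex.norm_real, Real.norm_eq_abs, sq_abs]

lemma frob_ofReal_smul (x : ℝ) (A : Matrix m n ℂ) : frob ((x : ℂ) • A) = x ^ 2 * frob A := by
  rw [frob_smul, Complex.norm_real, Real.norm_eq_abs, sq_abs]

lemma norm_sq_smul_add_smul (x y : ℝ) (z w : ℂ) :
    ‖(x : ℂ) * z + (y : ℂ) * w‖ ^ 2 =
      x ^ 2 * ‖z‖ ^ 2 + y ^ 2 * ‖w‖ ^ 2 + 2 * x * y * (star z * w).re := by
  simp only [← Complex.normSq_eq_norm_sq, Complex.normSq_apply]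
  simp
  ring

lemma sqNorm_smul_add_smul (x y : ℝ) (v w : n → ℂ) :
    sqNorm ((x : ℂ) • v + (y : ℂ) • w) =
      x ^ 2 * sqNorm v + y ^ 2 * sqNorm w + 2 * x * y * (star v ⬝ᵥ w).re := by
  simp only [sqNorm, Pi.add_apply, Pi.smul_apply, smul_eq_mul, norm_sq_smul_add_smul,
    Finset.sum_add_distrib, ← Finset.mul_sum, dotProduct, Complex.re_sum, Pi.star_apply]

lemma frob_smul_add_smul (x y : ℝ) (A B : Matrix m n ℂ) :
    frob ((x : ℂ) • A + (y : ℂ) • B) =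
      x ^ 2 * frob A + y ^ 2 * frob B + 2 * x * y * (Aᴴ * B).trace.re := by
  have : (Aᴴ * B).trace = ∑ i, ∑ j, star (A i j) * B i j := by
    rw [Finset.sum_comm]
    simp [trace, mul_apply]
  simp only [this, frob, Matrix.add_apply, Matrix.smul_apply, smul_eq_mul, norm_sq_smul_add_smul,
    Finset.sum_add_distrib, ← Finset.mul_sum, Complex.re_sum]

end Norms

/-! ### Identification of the norms with the deterministic quantities f_1, …, f_9. -/

section ClosedForms

variable {M N K τ : ℕ} {P : Params M N K τ}

lemma Params.sqNorm_aM (P : Params M N K τ) : sqNorm P.aM = M := by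
  have h : ∀ x, ‖P.aM x‖ = 1 := fun x => by
    rw [Params.aM, Params.respBS, mul_comm, Complex.norm_exp_ofReal_mul_I]
  simp [sqNorm, h]

/-- Rank one of H̄₂: all line-of-sight channels are parallel to a_M and differ only in the scalar
f_k. -/
lemma Params.Hbar_mulVec_reflected (P : Params M N K τ) (k : Fin K) :
    P.Hbar *ᵥ P.reflected k = P.f k • P.aM := by
  rw [Params.Hbar, vecMulVec_mulVec, Params.f, Params.reflected, op_smul_eq_smul]

lemma Params.sqNorm_Hbar_mulVec (P : Params M N K τ) (k : Fin K) :
    sqNorm (P.Hbar *ᵥ P.reflected k) = M * P.f7 k := by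
  rw [Params.Hbar_mulVec_reflected, sqNorm_smul, P.sqNorm_aM, Params.f7, mul_comm]

lemma Params.chanMean_eq (P : Params M N K τ) (k : Fin K) :
    P.chanMean k = ((√(P.β / (P.δ + 1)) * √P.δ * √(P.α k) : ℝ) : ℂ) • P.Hbar *ᵥ P.reflected k := by
  rw [Params.chanMean, Params.losMat, chanUser, mulVec_smul, mulVec_smul, smul_mulVec, smul_smul,
    ← Complex.ofReal_mul, mul_comm (√(P.α k))]
  rfl

lemma Params.chanCoeff_eq (P : Params M N K τ) (k : Fin K) :
    P.chanCoeff k = ((√(P.α k) : ℝ) : ℂ) • P.scatMat *ᵥ P.reflected k +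
      ((√(P.γ k) : ℝ) : ℂ) • Pi.single (Sum.inr k) 1 := by
  rw [Params.chanCoeff, chanUser, mulVec_smul, mulVec_smul]
  rfl

lemma scatMat_conjTranspose_mulVec_single (k : Fin K) :
    P.scatMatᴴ *ᵥ (Pi.single (Sum.inr k) 1) = 0 := by
  ext n
  simp [Params.scatMat]

lemma scatMat_conjTranspose_mulVec_chanCoeff (hP : P.Valid) (k : Fin K) :
    P.scatMatᴴ *ᵥ P.chanCoeff k =
      ((P.β / (P.δ + 1) * √(P.α k) : ℝ) : ℂ) • P.Rris *ᵥ P.reflected k := by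
  rw [P.chanCoeff_eq, mulVec_add, mulVec_smul, mulVec_smul, scatMat_conjTranspose_mulVec_single,
    smul_zero, add_zero, mulVec_mulVec, scatMat_conjTranspose_mul hP, smul_mulVec, smul_smul,
    ← Complex.ofReal_mul, mul_comm]

lemma sq_amplitude (hP : P.Valid) (k : Fin K) :
    (√(P.β / (P.δ + 1)) * √P.δ * √(P.α k)) ^ 2 = P.c k * P.δ := by
  rw [mul_pow, mul_pow, Real.sq_sqrt hP.gain_nonneg, Real.sq_sqrt hP.δ_nonneg,
    Real.sq_sqrt (hP.α_pos k).le, Params.c]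
  ring

lemma sqNorm_chanMean (hP : P.Valid) (k : Fin K) :
    sqNorm (P.chanMean k) = M * P.c k * P.δ * P.f7 k := by
  rw [P.chanMean_eq, sqNorm_ofReal_smul, sq_amplitude hP, P.sqNorm_Hbar_mulVec]
  ring

lemma sqNorm_upsilon_mulVec_chanMean (hP : P.Valid) (k i : Fin K) :
    sqNorm (P.Υ k *ᵥ P.chanMean i) = P.c i * P.δ * P.f8 k i := by
  rw [P.chanMean_eq, mulVec_smul, sqNorm_ofReal_smul, sq_amplitude hP, Params.f8, sqNorm_mulVec,
    upsilon_isHermitian hP]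
  simp only [pow_two, ← mulVec_mulVec, star_dotProduct_conjTranspose_mulVec, Params.reflected]

lemma f1_eq (P : Params M N K τ) : (P.Remi * P.Φᴴ * P.Rris * P.Φ).trace.re = P.f1 := by
  rw [Params.f1, Matrix.mul_assoc, trace_mul_comm]
  simp only [Matrix.mul_assoc]

lemma frob_scatMat_mul_emiMat_eq (hP : P.Valid) :
    frob (P.scatMat * P.emiMat) = P.β / (P.δ + 1) * P.f1 := by
  rw [frob_scatMat_mul_emiMat hP, f1_eq]

lemma frob_upsilon (hP : P.Valid) (k : Fin K) : frob (P.Υ k) = P.f4 k := by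
  rw [frob_eq, upsilon_isHermitian hP, Params.f4, pow_two]

lemma frob_upsilon_mul_losMat (hP : P.Valid) (k : Fin K) :
    frob (P.Υ k * (P.losMat * P.emiMat)) = P.β / (P.δ + 1) * P.δ * P.f3 k := by
  have : (P.Υ k * (P.losMat * P.emiMat))ᴴ * (P.Υ k * (P.losMat * P.emiMat)) =
      (P.losMat * P.emiMat)ᴴ * (P.Υ k * P.Υ k * (P.losMat * P.emiMat)) := by
    rw [conjTranspose_mul (P.Υ k), upsilon_isHermitian hP]
    simp only [Matrix.mul_assoc]
  rw [frob_eq, this, trace_mul_comm, Matrix.mul_assoc, losMat_mul_conjTranspose hP, Matrix.mul_smul,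
    trace_smul, smul_eq_mul, Complex.re_ofReal_mul, Params.f3, pow_two]
  simp only [Matrix.mul_assoc]

lemma obsScalar_eq (hP : P.Valid) (k : Fin K) :
    P.obsScalar k = P.c k * P.f2 k + P.γ k + P.ν + P.η * P.f1 := by
  rw [Params.obsScalar, sqNorm_chanCoeff hP, frob_scatMat_mul_emiMat_eq hP, Params.ν, Params.η]
  simp only [div_eq_mul_inv, mul_inv]
  ring

lemma star_emiMat_mulVec (hP : P.Valid) (v : Fin N → ℂ) :
    P.emiMat *ᵥ P.emiMatᴴ *ᵥ v = P.Φ *ᵥ P.Remi *ᵥ P.Φᴴ *ᵥ v := by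
  simp only [mulVec_mulVec, emiMat_mul_conjTranspose hP, Matrix.mul_assoc]

/-- The image of `Φ h̄_i` under `(R_emi^{1/2} Φᴴ H̄₂ᴴ Υ_k H̄₂)`. -/
noncomputable def Params.losEmi (P : Params M N K τ) (k i : Fin K) : Fin N → ℂ :=
  P.emiMatᴴ *ᵥ P.Hbarᴴ *ᵥ P.Υ k *ᵥ P.Hbar *ᵥ P.reflected i

/-- The image of `Φ h̄_i` under `R_emi^{1/2} Φᴴ R_ris`. -/
noncomputable def Params.scatEmi (P : Params M N K τ) (i : Fin K) : Fin N → ℂ :=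
  P.emiMatᴴ *ᵥ P.Rris *ᵥ P.reflected i

/-- The image of `Φ h̄_k` under `R_emi^{1/2} Φᴴ H̄₂ᴴ H̄₂`. -/
noncomputable def Params.losLosEmi (P : Params M N K τ) (k : Fin K) : Fin N → ℂ :=
  P.emiMatᴴ *ᵥ P.Hbarᴴ *ᵥ P.Hbar *ᵥ P.reflected k

/-- The half powers of R_emi recombine in inner products. Hence f_6, f_9 and the cross terms are
squared norms and inner products of `scatEmi`, `losEmi`, `losLosEmi`, and the EMI contributions
follow from expanding ‖v + w‖². -/
lemma star_emiMat_dotProduct (hP : P.Valid) (v w : Fin N → ℂ) :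
    star (P.emiMatᴴ *ᵥ v) ⬝ᵥ P.emiMatᴴ *ᵥ w = star v ⬝ᵥ P.Φ *ᵥ P.Remi *ᵥ P.Φᴴ *ᵥ w := by
  rw [← star_dotProduct_mulVec, star_emiMat_mulVec hP]

lemma star_Rris_dotProduct (hP : P.Valid) (v w : Fin N → ℂ) :
    star (P.Rris *ᵥ v) ⬝ᵥ w = star v ⬝ᵥ P.Rris *ᵥ w := by
  rw [star_dotProduct_mulVec, hP.Rris_psd.1.eq]

lemma star_losEmi_dotProduct (hP : P.Valid) (k i : Fin K) (w : Fin N → ℂ) :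
    star (P.losEmi k i) ⬝ᵥ P.emiMatᴴ *ᵥ w = star (P.hbar i) ⬝ᵥ P.Φᴴ *ᵥ P.Hbarᴴ *ᵥ P.Υ k *ᵥ
      P.Hbar *ᵥ P.Φ *ᵥ P.Remi *ᵥ P.Φᴴ *ᵥ w := by
  rw [Params.losEmi, star_emiMat_dotProduct hP, star_dotProduct_conjTranspose_mulVec,
    star_dotProduct_conjTranspose_mulVec, ← star_dotProduct_mulVec]
  nth_rw 1 [← upsilon_isHermitian hP]
  rw [← star_dotProduct_mulVec, Params.reflected]

lemma star_scatEmi_dotProduct (hP : P.Valid) (i : Fin K) (w : Fin N → ℂ) :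
    star (P.scatEmi i) ⬝ᵥ P.emiMatᴴ *ᵥ w = star (P.hbar i) ⬝ᵥ P.Φᴴ *ᵥ P.Rris *ᵥ
      P.Φ *ᵥ P.Remi *ᵥ P.Φᴴ *ᵥ w := by
  rw [Params.scatEmi, star_emiMat_dotProduct hP, star_dotProduct_conjTranspose_mulVec,
    star_Rris_dotProduct hP, Params.reflected]

lemma star_losLosEmi_dotProduct (hP : P.Valid) (k : Fin K) (w : Fin N → ℂ) :
    star (P.losLosEmi k) ⬝ᵥ P.emiMatᴴ *ᵥ w = star (P.hbar k) ⬝ᵥ P.Φᴴ *ᵥ P.Hbarᴴ *ᵥ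
      P.Hbar *ᵥ P.Φ *ᵥ P.Remi *ᵥ P.Φᴴ *ᵥ w := by
  rw [Params.losLosEmi, star_emiMat_dotProduct hP, star_dotProduct_conjTranspose_mulVec,
    star_dotProduct_conjTranspose_mulVec, ← star_dotProduct_mulVec, Params.reflected]

lemma f9_eq (hP : P.Valid) (k i : Fin K) : P.f9 k i = sqNorm (P.losEmi k i) := by
  rw [sqNorm_eq]
  nth_rw 2 [Params.losEmi]
  rw [star_losEmi_dotProduct hP, Params.f9, upsilon_isHermitian hP]
  simp only [← mulVec_mulVec, Params.reflected]

lemma f6_eq (hP : P.Valid) (i : Fin K) : P.f6 i = sqNorm (P.scatEmi i) := by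
  rw [sqNorm_eq]
  nth_rw 2 [Params.scatEmi]
  rw [star_scatEmi_dotProduct hP, Params.f6]
  simp only [← mulVec_mulVec, Params.reflected]

lemma re_star_losEmi_dotProduct_scatEmi (hP : P.Valid) (k i : Fin K) :
    (star (P.losEmi k i) ⬝ᵥ P.scatEmi i).re =
      (star (P.hbar i) ⬝ᵥ (P.Φᴴ * P.Hbarᴴ * P.Υ k * P.Hbar * P.Φ * P.Remi * P.Φᴴ * P.Rris
        * P.Φ) *ᵥ P.hbar i).re := by
  rw [Params.scatEmi, star_losEmi_dotProduct hP]
  simp only [← mulVec_mulVec, Params.reflected]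

lemma re_star_scatEmi_dotProduct_losEmi (hP : P.Valid) (k i : Fin K) :
    (star (P.losEmi k i) ⬝ᵥ P.scatEmi i).re =
      (star (P.hbar i) ⬝ᵥ (P.Φᴴ * P.Rris * P.Φ * P.Remi * P.Φᴴ * P.Hbarᴴ * (P.Υ k)ᴴ
        * P.Hbar * P.Φ) *ᵥ P.hbar i).re := by
  rw [star_dotProduct, Complex.star_def, Complex.conj_re, Params.losEmi,
    star_scatEmi_dotProduct hP, upsilon_isHermitian hP]
  simp only [← mulVec_mulVec, Params.reflected]

lemma re_star_losLosEmi_dotProduct_scatEmi (hP : P.Valid) (k : Fin K) :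
    (star (P.losLosEmi k) ⬝ᵥ P.scatEmi k).re =
      (star (P.hbar k) ⬝ᵥ
        (P.Φᴴ * P.Hbarᴴ * P.Hbar * P.Φ * P.Remi * P.Φᴴ * P.Rris * P.Φ) *ᵥ P.hbar k).re := by
  rw [Params.scatEmi, star_losLosEmi_dotProduct hP]
  simp only [← mulVec_mulVec, Params.reflected]

/-- By rank one, H̄₂ᴴ H̄₂ Φ h̄_k = M f_k a_N. -/
lemma sqNorm_losLosEmi (hP : P.Valid) (k : Fin K) : sqNorm (P.losLosEmi k) =
    M ^ 2 * P.f7 k * (star P.aN ⬝ᵥ (P.Φ * P.Remi * P.Φᴴ) *ᵥ P.aN).re := by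
  have h : P.Hbarᴴ *ᵥ P.aM = (M : ℂ) • P.aN := by
    rw [Params.Hbar, conjTranspose_vecMulVec, vecMulVec_mulVec, star_dotProduct_self, P.sqNorm_aM,
      star_star, op_smul_eq_smul, Complex.ofReal_natCast]
  rw [Params.losLosEmi, P.Hbar_mulVec_reflected, mulVec_smul, h, smul_smul, mulVec_smul,
    sqNorm_smul, sqNorm_eq, star_emiMat_dotProduct hP, Params.f7]
  simp only [← mulVec_mulVec, norm_mul, mul_pow, Complex.norm_natCast]
  ring

lemma losMat_mul_emiMat_conjTranspose_mulVec (P : Params M N K τ) (v : Fin M → ℂ) :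
    (P.losMat * P.emiMat)ᴴ *ᵥ v =
      ((√(P.β / (P.δ + 1)) * √P.δ : ℝ) : ℂ) • P.emiMatᴴ *ᵥ P.Hbarᴴ *ᵥ v := by
  rw [conjTranspose_mul, ← mulVec_mulVec, Params.losMat, conjTranspose_smul, smul_mulVec,
    mulVec_smul, Complex.star_def, Complex.conj_ofReal]

lemma losMat_mul_emiMat_mulVec_upsilon_chanMean (hP : P.Valid) (k i : Fin K) :
    (P.losMat * P.emiMat)ᴴ *ᵥ P.Υ k *ᵥ P.chanMean i =
      ((P.β / (P.δ + 1) * √(P.α i) : ℝ) : ℂ) • (P.δ : ℂ) • P.losEmi k i := by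
  rw [losMat_mul_emiMat_conjTranspose_mulVec, P.chanMean_eq]
  simp only [mulVec_smul]
  rw [smul_smul, smul_smul, ← Complex.ofReal_mul, ← Complex.ofReal_mul, Params.losEmi]
  congr 2
  -- Both line-of-sight amplitudes carry √(β/(δ+1)) √δ; their product is rational, and factoring out
  -- β/(δ+1) · √α_i leaves the weight δ.
  linear_combination √(P.α i) * (√P.δ ^ 2 * Real.sq_sqrt hP.gain_nonneg +
    P.β / (P.δ + 1) * Real.sq_sqrt hP.δ_nonneg)

lemma losMat_mul_emiMat_mulVec_chanMean (hP : P.Valid) (k : Fin K) :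
    (P.losMat * P.emiMat)ᴴ *ᵥ P.chanMean k =
      ((P.β / (P.δ + 1) * √(P.α k) : ℝ) : ℂ) • (P.δ : ℂ) • P.losLosEmi k := by
  rw [losMat_mul_emiMat_conjTranspose_mulVec, P.chanMean_eq]
  simp only [mulVec_smul]
  rw [smul_smul, smul_smul, ← Complex.ofReal_mul, ← Complex.ofReal_mul, Params.losLosEmi]
  congr 2
  linear_combination √(P.α k) * (√P.δ ^ 2 * Real.sq_sqrt hP.gain_nonneg +
    P.β / (P.δ + 1) * Real.sq_sqrt hP.δ_nonneg)

lemma scatMat_mul_emiMat_mulVec_chanCoeff (hP : P.Valid) (i : Fin K) :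
    (P.scatMat * P.emiMat)ᴴ *ᵥ P.chanCoeff i =
      ((P.β / (P.δ + 1) * √(P.α i) : ℝ) : ℂ) • P.scatEmi i := by
  rw [conjTranspose_mul, ← mulVec_mulVec, scatMat_conjTranspose_mulVec_chanCoeff hP, mulVec_smul]
  rfl

lemma sq_gain_mul_sqrt (hP : P.Valid) (i : Fin K) :
    (P.β / (P.δ + 1) * √(P.α i)) ^ 2 = P.β / (P.δ + 1) * P.c i := by
  rw [mul_pow, Real.sq_sqrt (hP.α_pos i).le, Params.c]
  ring

/-- After passing to the adjoint column, the line-of-sight and scattered parts share the factor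
β/(δ+1) · √α_i, and ‖δ v + Tr(Υ) w‖² is expanded. -/
lemma sqNorm_emi_row (hP : P.Valid) (k i : Fin K) :
    sqNorm (star (P.chanMean i) ᵥ* (P.Υ k * (P.losMat * P.emiMat)) +
        (P.trΥ k : ℂ) • (star (P.chanCoeff i) ᵥ* (P.scatMat * P.emiMat))) =
      P.β / (P.δ + 1) * P.c i * (P.δ ^ 2 * P.f9 k i + P.trΥ k ^ 2 * P.f6 i +
        2 * P.δ * P.trΥ k * (star (P.losEmi k i) ⬝ᵥ P.scatEmi i).re) := by
  have h1 : star (P.chanMean i) ᵥ* (P.Υ k * (P.losMat * P.emiMat)) +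
        (P.trΥ k : ℂ) • (star (P.chanCoeff i) ᵥ* (P.scatMat * P.emiMat)) =
      star ((P.losMat * P.emiMat)ᴴ *ᵥ P.Υ k *ᵥ P.chanMean i +
        (P.trΥ k : ℂ) • (P.scatMat * P.emiMat)ᴴ *ᵥ P.chanCoeff i) := by
    rw [star_add, star_smul, mulVec_mulVec, star_mulVec, star_mulVec, conjTranspose_mul,
      conjTranspose_conjTranspose, conjTranspose_conjTranspose, upsilon_isHermitian hP,
      Complex.star_def, Complex.conj_ofReal]
  rw [h1, sqNorm_star, losMat_mul_emiMat_mulVec_upsilon_chanMean hP,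
    scatMat_mul_emiMat_mulVec_chanCoeff hP, smul_comm (P.trΥ k : ℂ), ← smul_add,
    sqNorm_ofReal_smul, sq_gain_mul_sqrt hP, sqNorm_smul_add_smul, f9_eq hP, f6_eq hP]

lemma sqNorm_emi_column (hP : P.Valid) (k : Fin K) :
    sqNorm ((P.losMat * P.emiMat)ᴴ *ᵥ P.chanMean k +
        (P.trΥ k : ℂ) • (P.scatMat * P.emiMat)ᴴ *ᵥ P.chanCoeff k) =
      P.β / (P.δ + 1) * P.c k * (P.δ ^ 2 * sqNorm (P.losLosEmi k) + P.trΥ k ^ 2 * P.f6 k +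
        2 * P.δ * P.trΥ k * (star (P.losLosEmi k) ⬝ᵥ P.scatEmi k).re) := by
  rw [losMat_mul_emiMat_mulVec_chanMean hP,
    scatMat_mul_emiMat_mulVec_chanCoeff hP, smul_comm (P.trΥ k : ℂ), ← smul_add,
    sqNorm_ofReal_smul, sq_gain_mul_sqrt hP, sqNorm_smul_add_smul, f6_eq hP]

lemma frob_emi (hP : P.Valid) (k : Fin K) :
    frob ((P.losMat * P.emiMat)ᴴ * (P.Υ k * (P.losMat * P.emiMat)) +
        (P.trΥ k : ℂ) • ((P.scatMat * P.emiMat)ᴴ * (P.scatMat * P.emiMat))) =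
      (P.β / (P.δ + 1)) ^ 2 *
        (P.δ ^ 2 * ((P.Remi * P.Φᴴ * P.Hbarᴴ * P.Υ k * P.Hbar * P.Φ) ^ 2).trace.re +
          P.trΥ k ^ 2 * ((P.Rris * P.Φ * P.Remi * P.Φᴴ) ^ 2).trace.re +
          2 * P.δ * P.trΥ k * (P.Remi * P.Φᴴ * P.Hbarᴴ * (P.Υ k)ᴴ * P.Hbar * P.Φ * P.Remi * P.Φᴴ
            * P.Rris * P.Φ).trace.re) := by
  have h1 : (P.losMat * P.emiMat)ᴴ * (P.Υ k * (P.losMat * P.emiMat)) =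
      ((P.β / (P.δ + 1) : ℝ) : ℂ) • (P.δ : ℂ) •
        (P.emiMatᴴ * (P.Hbarᴴ * P.Υ k * P.Hbar) * P.emiMat) := by
    rw [Params.losMat, conjTranspose_mul, conjTranspose_smul, Complex.star_def,
      Complex.conj_ofReal]
    simp only [Matrix.smul_mul, Matrix.mul_smul, smul_smul, Matrix.mul_assoc, ← Complex.ofReal_mul]
    congr 2
    linear_combination √P.δ ^ 2 * Real.sq_sqrt hP.gain_nonneg +
      P.β / (P.δ + 1) * Real.sq_sqrt hP.δ_nonneg
  have h2 : (P.scatMat * P.emiMat)ᴴ * (P.scatMat * P.emiMat) =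
      ((P.β / (P.δ + 1) : ℝ) : ℂ) • (P.emiMatᴴ * P.Rris * P.emiMat) := by
    rw [conjTranspose_mul, Matrix.mul_assoc, ← Matrix.mul_assoc P.scatMatᴴ,
      scatMat_conjTranspose_mul hP, Matrix.smul_mul, Matrix.mul_smul, Matrix.mul_assoc]
  have h3 : (P.emiMatᴴ * (P.Hbarᴴ * P.Υ k * P.Hbar) * P.emiMat)ᴴ =
      P.emiMatᴴ * (P.Hbarᴴ * P.Υ k * P.Hbar) * P.emiMat := by
    simp only [conjTranspose_mul, conjTranspose_conjTranspose, upsilon_isHermitian hP,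
      Matrix.mul_assoc]
  have h4 : (P.emiMatᴴ * P.Rris * P.emiMat)ᴴ = P.emiMatᴴ * P.Rris * P.emiMat := by
    simp only [conjTranspose_mul, conjTranspose_conjTranspose, hP.Rris_psd.1.eq, Matrix.mul_assoc]
  -- Both blocks are Hermitian (`h3`, `h4`), so all Frobenius terms are traces of products of two
  -- such blocks, evaluated by cyclicity.
  have h5 : ∀ A B : Matrix (Fin N) (Fin N) ℂ,
      (P.emiMatᴴ * A * P.emiMat * (P.emiMatᴴ * B * P.emiMat)).trace =
      (P.Remi * P.Φᴴ * A * P.Φ * P.Remi * P.Φᴴ * B * P.Φ).trace := by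
    intro A B
    have e1 : P.emiMatᴴ * A * P.emiMat * (P.emiMatᴴ * B * P.emiMat) =
        P.emiMatᴴ * (A * (P.emiMat * P.emiMatᴴ) * B * P.emiMat) := by
      simp only [Matrix.mul_assoc]
    have e2 : A * (P.emiMat * P.emiMatᴴ) * B * P.emiMat * P.emiMatᴴ =
      A * (P.emiMat * P.emiMatᴴ) * B * (P.emiMat * P.emiMatᴴ) := by
      simp only [Matrix.mul_assoc]
    rw [e1, trace_mul_comm, e2, emiMat_mul_conjTranspose hP]
    rw [show A * (P.Φ * P.Remi * P.Φᴴ) * B * (P.Φ * P.Remi * P.Φᴴ) =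
      (A * (P.Φ * P.Remi * P.Φᴴ) * B * P.Φ) * (P.Remi * P.Φᴴ) by simp only [Matrix.mul_assoc],
      trace_mul_comm]
    simp only [Matrix.mul_assoc]
  have h6 : (P.Remi * P.Φᴴ * P.Rris * P.Φ * P.Remi * P.Φᴴ * P.Rris * P.Φ).trace =
      ((P.Rris * P.Φ * P.Remi * P.Φᴴ) ^ 2).trace := by
    rw [pow_two, show P.Remi * P.Φᴴ * P.Rris * P.Φ * P.Remi * P.Φᴴ * P.Rris * P.Φ =
      (P.Remi * P.Φᴴ) * (P.Rris * P.Φ * P.Remi * P.Φᴴ * P.Rris * P.Φ) by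
        simp only [Matrix.mul_assoc], trace_mul_comm]
    simp only [Matrix.mul_assoc]
  rw [h1, h2, smul_comm (P.trΥ k : ℂ), ← smul_add, frob_ofReal_smul, frob_smul_add_smul, frob_eq,
    frob_eq, h3, h4, h5, h5, h5, h6, upsilon_isHermitian hP, pow_two (P.Remi * _ * _ * _ * _ * _)]
  simp only [Matrix.mul_assoc]

lemma f5_eq (hP : P.Valid) (k : Fin K) : P.f5 k = P.trΥ k ^ 2 := by
  rw [Params.f5, trace_upsilon hP, Complex.norm_real, Real.norm_eq_abs, sq_abs]

lemma eta_eq (P : Params M N K τ) : P.σe ^ 2 / (τ * P.p) * (P.β / (P.δ + 1)) = P.η := by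
  rw [Params.η]
  simp only [div_eq_mul_inv, mul_inv]
  ring

lemma noiseCF_eq (hP : P.Valid) (k : Fin K) :
    P.noiseCF k = sqNorm (P.chanMean k) + P.trΥ k * sqNorm (P.chanCoeff k) := by
  rw [sqNorm_chanMean hP, sqNorm_chanCoeff hP, Params.noiseCF, Params.f7, ← Params.f2]
  ring

lemma leakCF_eq (hP : P.Valid) (k : Fin K) :
    P.leakCF k = P.formMoment k (P.chanMean k) (P.chanCoeff k) -
      (sqNorm (P.chanMean k) + P.trΥ k * sqNorm (P.chanCoeff k)) ^ 2 := by
  -- For i = k this term is the squared mean, which the definition of the leakage subtracts.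
  have h1 : ‖star (P.chanMean k) ⬝ᵥ P.chanMean k +
      P.trΥ k * (star (P.chanCoeff k) ⬝ᵥ P.chanCoeff k)‖ ^ 2 =
      (sqNorm (P.chanMean k) + P.trΥ k * sqNorm (P.chanCoeff k)) ^ 2 := by
    rw [star_dotProduct_self, star_dotProduct_self, ← Complex.ofReal_mul, ← Complex.ofReal_add,
      Complex.norm_real, Real.norm_eq_abs, sq_abs]
  have h2 : (P.Υ k)ᴴ.trace.re = P.trΥ k := by rw [upsilon_isHermitian hP]; rfl
  rw [Params.formMoment, h1, sqNorm_emi_row hP, sqNorm_upsilon_mulVec_chanMean hP,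
    frob_upsilon hP, frob_upsilon_mul_losMat hP, obsScalar_eq hP, sqNorm_chanMean hP,
    sqNorm_chanCoeff hP, re_star_losEmi_dotProduct_scatEmi hP, ← eta_eq, Params.leakCF]
  simp only [Params.leakParts, Fin.sum_univ_eight, h2, f5_eq hP, ← eta_eq]
  simp
  ring

lemma interferenceCF_eq (hP : P.Valid) {k i : Fin K} (hik : i ≠ k) :
    P.interferenceCF k i = P.formMoment k (P.chanMean i) (P.chanCoeff i) := by
  set x := star (P.Hbar *ᵥ P.reflected i) ⬝ᵥ P.Hbar *ᵥ P.reflected k with hx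
  set y := star (P.reflected i) ⬝ᵥ P.Rris *ᵥ P.reflected k with hy
  -- The amplitude common to the line-of-sight and the scattered correlation of the two channels.
  set κ := P.β / (P.δ + 1) * √(P.α i) * √(P.α k) with hκ
  have hκ2 : κ ^ 2 = P.c i * P.c k := by
    rw [hκ, mul_pow, mul_pow, Real.sq_sqrt (hP.α_pos i).le, Real.sq_sqrt (hP.α_pos k).le,
      Params.c, Params.c]
    ring
  have h1 : star (P.chanMean i) ⬝ᵥ P.chanMean k = (κ : ℂ) * ((P.δ : ℂ) * x) := by
    rw [P.chanMean_eq, P.chanMean_eq, star_smul, smul_dotProduct, dotProduct_smul, ← hx,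
      Complex.star_def, Complex.conj_ofReal, smul_eq_mul, smul_eq_mul, ← mul_assoc, ← mul_assoc,
      ← Complex.ofReal_mul, ← Complex.ofReal_mul]
    congr 2
    linear_combination √(P.α i) * √(P.α k) * (√P.δ ^ 2 * Real.sq_sqrt hP.gain_nonneg +
      P.β / (P.δ + 1) * Real.sq_sqrt hP.δ_nonneg)
  have h2 : star (P.chanCoeff i) ⬝ᵥ P.chanCoeff k = (κ : ℂ) * y := by
    -- Here i ≠ k matters: the direct channels of different users are uncorrelated.
    have e1 : star (Pi.single (Sum.inr i) 1 : Fin N ⊕ Fin K → ℂ) ⬝ᵥ P.chanCoeff k = 0 := by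
      rw [← Pi.single_star, star_one, single_one_dotProduct, P.chanCoeff_eq, Params.scatMat]
      simp [hik, fromRows_mulVec, smul_mulVec]
    nth_rw 1 [P.chanCoeff_eq]
    rw [star_add, add_dotProduct, star_smul, star_smul, smul_dotProduct, smul_dotProduct, e1,
      smul_zero, add_zero, ← star_dotProduct_conjTranspose_mulVec,
      scatMat_conjTranspose_mulVec_chanCoeff hP, dotProduct_smul, ← hy, smul_smul,
      Complex.star_def, Complex.conj_ofReal, ← Complex.ofReal_mul, smul_eq_mul]
    congr 2
    ring
  have h3 : ‖star (P.chanMean i) ⬝ᵥ P.chanMean k +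
      P.trΥ k * (star (P.chanCoeff i) ⬝ᵥ P.chanCoeff k)‖ ^ 2 =
      P.c i * P.c k * (P.δ ^ 2 * ‖x‖ ^ 2 + P.trΥ k ^ 2 * ‖y‖ ^ 2 +
        2 * P.δ * P.trΥ k * (star x * y).re) := by
    rw [h1, h2, mul_left_comm (P.trΥ k : ℂ), ← mul_add, norm_mul, mul_pow, norm_sq_smul_add_smul,
      Complex.norm_real, Real.norm_eq_abs, sq_abs, hκ2]
  have h4 : ‖x‖ ^ 2 = M ^ 2 * P.f7 k * P.f7 i := by
    rw [hx, P.Hbar_mulVec_reflected, P.Hbar_mulVec_reflected, star_smul, smul_dotProduct,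
      dotProduct_smul, star_dotProduct_self, P.sqNorm_aM, Params.f7, Params.f7]
    simp
    ring
  have h5 : star (P.hbar i) ⬝ᵥ (P.Φᴴ * P.Rris * P.Φ) *ᵥ P.hbar k = y := by
    rw [hy, ← mulVec_mulVec, ← mulVec_mulVec, star_dotProduct_conjTranspose_mulVec]
    rfl
  have h6 : ‖star (P.hbar k) ⬝ᵥ (P.Φᴴ * P.Rris * P.Φ) *ᵥ P.hbar i‖ = ‖y‖ := by
    rw [hy, ← star_Rris_dotProduct hP, star_dotProduct (P.Rris *ᵥ P.reflected i), norm_star,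
      ← mulVec_mulVec, ← mulVec_mulVec, star_dotProduct_conjTranspose_mulVec]
    rfl
  have h7 : star (P.hbar k) ⬝ᵥ (P.Φᴴ * P.Hbarᴴ * P.Hbar * P.Φ) *ᵥ P.hbar i = star x := by
    rw [hx, ← star_dotProduct]
    simp only [← mulVec_mulVec, star_dotProduct_conjTranspose_mulVec, Params.reflected]
  rw [Params.formMoment, h3, sqNorm_emi_row hP, sqNorm_upsilon_mulVec_chanMean hP,
    frob_upsilon hP, frob_upsilon_mul_losMat hP, obsScalar_eq hP, sqNorm_chanMean hP,
    sqNorm_chanCoeff hP, re_star_scatEmi_dotProduct_losEmi hP, Params.interferenceCF]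
  simp only [Params.interferenceParts, Fin.sum_univ_eight, h4, h5, h6, h7, f5_eq hP]
  -- The direct channel of user i contributes γ_i times ‖mean‖² + Tr(Υ C Υ); the closed form has γ_i
  -- times the noise term instead, and this identity makes them equal.
  have h8 := obsScalar_mul_frob hP k
  rw [frob_upsilon hP, frob_upsilon_mul_losMat hP, obsScalar_eq hP, sqNorm_chanCoeff hP] at h8
  rw [noiseCF_eq hP, sqNorm_chanMean hP, sqNorm_chanCoeff hP]
  simp only [← eta_eq] at h8 ⊢
  simp
  linear_combination (-P.γ i) * h8

lemma emiCF_eq (hP : P.Valid) (k : Fin K) : P.emiCF k =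
    ∑ n, P.formMoment k ((P.losMat * P.emiMat).col n) ((P.scatMat * P.emiMat).col n) := by
  -- The conjugated column n is row n of the adjoint, so the sum over columns is the squared norm of
  -- a vector here and of a matrix in `h2`, both definitionally.
  have h1 : ∑ n, ‖star ((P.losMat * P.emiMat).col n) ⬝ᵥ P.chanMean k +
      P.trΥ k * (star ((P.scatMat * P.emiMat).col n) ⬝ᵥ P.chanCoeff k)‖ ^ 2 =
      sqNorm ((P.losMat * P.emiMat)ᴴ *ᵥ P.chanMean k +
        (P.trΥ k : ℂ) • (P.scatMat * P.emiMat)ᴴ *ᵥ P.chanCoeff k) := rfl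
  have h2 : ∑ n, sqNorm (star ((P.losMat * P.emiMat).col n) ᵥ* (P.Υ k * (P.losMat * P.emiMat)) +
      (P.trΥ k : ℂ) • (star ((P.scatMat * P.emiMat).col n) ᵥ* (P.scatMat * P.emiMat))) =
      frob ((P.losMat * P.emiMat)ᴴ * (P.Υ k * (P.losMat * P.emiMat)) +
        (P.trΥ k : ℂ) • ((P.scatMat * P.emiMat)ᴴ * (P.scatMat * P.emiMat))) := rfl
  have h3 : ∑ n, sqNorm (P.Υ k *ᵥ (P.losMat * P.emiMat).col n) =
      frob (P.Υ k * (P.losMat * P.emiMat)) := by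
    rw [← sum_sqNorm_col]; rfl
  simp only [Params.formMoment, Finset.sum_add_distrib, ← Finset.sum_mul, ← Finset.mul_sum, h1, h2,
    h3, sum_sqNorm_col]
  rw [frob_emi hP, sqNorm_emi_column hP, frob_upsilon hP, frob_upsilon_mul_losMat hP,
    frob_scatMat_mul_emiMat_eq hP, obsScalar_eq hP, sqNorm_chanMean hP, sqNorm_losLosEmi hP,
    re_star_losLosEmi_dotProduct_scatEmi hP, Params.emiCF]
  simp only [Params.emiParts, Fin.sum_univ_eight, f5_eq hP, ← eta_eq]
  simp
  ring

end ClosedForms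

end RIS

/-! ### Assembly of the terms into the SINR and the rate. -/

theorem theorem4 {M N K τ : ℕ} (P : RIS.Params M N K τ) (hP : P.Valid)
    {Ω : Type*} [MeasurableSpace Ω] (μ : Measure Ω) [IsProbabilityMeasure μ]
    (X : RIS.Inputs Ω M N K τ) (hX : RIS.IsModel μ P X) (k : Fin K) :
    -- the expectations in the definition of the UatF bound exist
    ((∀ i, Integrable (RIS.mrc P X μ k i) μ) ∧
      (∀ i, Integrable (fun ω => ‖RIS.mrc P X μ k i ω‖ ^ 2) μ) ∧
      Integrable (RIS.emiForm P X μ k) μ ∧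
      Integrable (RIS.estNormSq P X μ k) μ) ∧
    -- closed forms of the five terms
    RIS.noise P X μ k = P.noiseCF k ∧
    RIS.signal P X μ k = P.signalCF k ∧
    RIS.emi P X μ k = P.emiCF k ∧
    (∀ i, i ≠ k → RIS.interference P X μ k i = P.interferenceCF k i) ∧
    RIS.leak P X μ k = P.leakCF k ∧
    -- closed form of the rate
    RIS.sinr P X μ k = P.sinrCF k ∧
    RIS.rate P X μ k = ((P.τc : ℝ) - τ) / P.τc * Real.logb 2 (1 + P.sinrCF k) := by
  have hnoise : RIS.noise P X μ k = P.noiseCF k := by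
    rw [RIS.noise_eq hP hX, RIS.noiseCF_eq hP]
  have hsignal : RIS.signal P X μ k = P.signalCF k := by
    rw [RIS.signal_eq hP hX, RIS.Params.signalCF, RIS.noiseCF_eq hP]
  have hemi : RIS.emi P X μ k = P.emiCF k := by
    rw [RIS.emi_eq hP hX, RIS.emiCF_eq hP]
  have hint : ∀ i, i ≠ k → RIS.interference P X μ k i = P.interferenceCF k i := fun i hi => by
    rw [RIS.interference_eq hP hX, RIS.interferenceCF_eq hP hi]
  have hleak : RIS.leak P X μ k = P.leakCF k := by
    rw [RIS.leak_eq hP hX, RIS.leakCF_eq hP]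
  -- Numerators and denominators agree term by term, so a vanishing denominator needs no separate
  -- case: both quotients are then 0 by the convention for division.
  have hsinr : RIS.sinr P X μ k = P.sinrCF k := by
    rw [RIS.sinr, RIS.Params.sinrCF, hnoise, hsignal, hemi, hleak,
      Finset.sum_congr rfl fun i hi => hint i (Finset.ne_of_mem_erase hi)]
  exact ⟨⟨fun i => (RIS.allMoments_mrc hP hX k i).integrable,
    fun i => (RIS.allMoments_mrc hP hX k i).integrable_norm_sq,
    RIS.integrable_emiForm hP hX k, RIS.integrable_estNormSq hP hX k⟩,
    hnoise, hsignal, hemi, hint, hleak, hsinr, by rw [RIS.rate, hsinr]⟩
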